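/- Let $\mathcal{CAMP}_{n,t}$ be the asynchronous message-passing model with $n$ deterministic sequential processes $p_1,\dots,p_n$, of which at most $t$ may crash (halt prematurely, possibly in the middle of a broadcast), and in which every ordered pair of processes (also a process with itself) is connected by a reliable asynchronous channel (no loss, no creation, no corruption of messages; every message sent to a non-faulty process is eventually received, but there is no bound on transit times). SCD-broadcast provides the operation $\mathsf{scd\_broadcast}(m)$ and deliveries of non-empty sets of messages; all messages that are scd-broadcast are assumed to be different. It is defined by the following properties. Validity: a message that is scd-delivered was scd-broadcast before by some process. Integrity: no process scd-delivers a message twice. MS-Ordering: if a process scd-delivers first a set containing $m$ and later another set containing $m'$, then no process scd-delivers first a set containing $m'$ and later another set containing $m$. Termination-1: if a non-faulty process scd-broadcasts $m$, its invocation terminates and it scd-delivers a set containing $m$. Termination-2: if a non-faulty process scd-delivers $m$, every non-faulty process scd-delivers a set containing $m$. Consider the following algorithm (code for $p_i$). Initially $buffer_i=\emptyset$, $sn_i=0$, and every $clock_i[j]$ is smaller than all sequence numbers. - To execute $\mathsf{scd\_broadcast}(m)$: call $\mathsf{forward}(m,i,sn_i,i,sn_i)$, then wait until no $msg\in buffer_i$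 has $msg.sd=i$. - When FORWARD$(m,sd,sn_{sd},f,sn_f)$ is fifo-delivered: call $\mathsf{forward}(m,sd,sn_{sd},f,sn_f)$, then $\mathsf{try\_deliver}()$. - $\mathsf{forward}(m,sd,sn_{sd},f,sn_f)$: if $sn_{sd}>clock_i[sd]$, then: if some $msg\in buffer_i$ has $msg.sd=sd$ and $msg.sn=sn_{sd}$, set $msg.cl[f]\leftarrow sn_f$; otherwise add to $buffer_i$ the quadruplet $\langle m,sd,sn_{sd},cl\rangle$ with $cl[f]=sn_f$ and all other entries of $cl$ equal to $+\infty$, fifo-broadcast FORWARD$(m,sd,sn_{sd},i,sn_i)$ to all processes, and set $sn_i\leftarrow sn_i+1$. - $\mathsf{try\_deliver}()$: let $T=\{msg\in buffer_i : |\{f: msg.cl[f]<\infty\}|>n/2\}$; as long as there are $msg\in T$ and $msg'\in buffer_i\setminus T$ with $|\{f: msg.cl[f]<msg'.cl[f]\}|\le n/2$, withdraw such a $msg$ from $T$; then, if $T\ne\emptyset$, raise each $clock_i[msg.sd]$ to at least $msg.sn$ for all $msg\in T$, remove $T$ from $buffer_i$, and scd-deliver the set $\{msg.m : msg\in T\}$.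 This algorithm is resiliency optimal. That is, for all $n$ and $t$: 1. If $t<n/2$, the algorithm implements SCD-broadcast in $\mathcal{CAMP}_{n,t}$, for every set of application messages: both when the channels are FIFO, and when they may reorder messages and FIFO communication is obtained from them by numbering the messages of each channel. 2. If $n/2\le t<n$, then, whether or not the channels are FIFO, no algorithm implements in $\mathcal{CAMP}_{n,t}$ an atomic (linearizable, with every operation of a non-faulty process terminating) read/write register with at least two values, whatever its set of writers and its set of readers (single-writer or multi-writer, single-reader or multi-reader), as soon as some writer and some reader are different processes; and no algorithm implements SCD-broadcast in $\mathcal{CAMP}_{n,t}$ for a set of at least two application messages. -/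

import Mathlib

universe u v w x y

/-!
# Crash-prone asynchronous message passing, SCD-broadcast, atomic registers
-/

/-! ## Distributed algorithms -/

/-- An atomic instruction of a process: send a protocol message to a process, return from the
current operation with a response, or hand an indication (e.g. a delivery) to the client. -/
inductive Instr (n : ℕ) (Msg : Type v) (Resp : Type x) (Ind : Type y) where
  | send (dst : Fin n) (m : Msg)
  | respond (r : Resp)
  | indicate (d : Ind)

/-- A deterministic distributed algorithm for `n` processes. Its clients invoke operations `In`,
operations return responses `Resp`, and clients may receive indications `Ind`. Process `i` reacts to
an invocation, to the reception of a message, or takes an internal step; each reaction changes the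
local state and performs a finite sequence of actions, in the order of the list. -/
structure Algorithm (n : ℕ) (In : Type w) (Resp : Type x) (Ind : Type y) where
  State : Type v
  Msg : Type v
  start : Fin n → State
  onInvoke : (i : Fin n) → In → State → State × List (Instr n Msg Resp Ind)
  onReceive : (i src : Fin n) → Msg → State → State × List (Instr n Msg Resp Ind)
  onInternal : (i : Fin n) → State → State × List (Instr n Msg Resp Ind)

/-! ## Runs of the asynchronous message-passing model -/

/-- Channel discipline: both kinds of channels are reliable and asynchronous; `unordered` channels
may deliver messages in any order, `fifo` channels deliver them in their sending order. -/
inductive Channels where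
  | unordered
  | fifo

/-- What makes a process take a step. `receive src k` is the reception of the `k`-th message (counted
from `0`) ever sent to this process by `src`. -/
inductive Trigger (n : ℕ) (In : Type w) where
  | invoke (a : In)
  | receive (src : Fin n) (k : ℕ)
  | internal

/-- A scheduler event. In `step i tr none`, process `i` executes its whole reaction to `tr`; in
`step i tr (some k)` it crashes during that reaction, after the first `k` actions of it (so a process
may crash in the middle of a broadcast). -/
inductive Event (n : ℕ) (In : Type w) where
  | idle
  | step (i : Fin n) (tr : Trigger n In) (cut : Option ℕ)

/-- The events which are visible to the clients. -/
inductive HistEvent (n : ℕ) (In : Type w) (Resp : Type x) (Ind : Type y) where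
  | inv (i : Fin n) (a : In)
  | res (i : Fin n) (r : Resp)
  | ind (i : Fin n) (d : Ind)

/-- A global configuration. `sent i j` lists all messages sent so far by `i` to `j`, `rcvd i j` is the
set of positions in this list that `j` has already received, `pending i` says that the last operation
invoked by `i` has not returned, and `hist` is the sequence of visible events so far. -/
structure Config {n : ℕ} {In : Type w} {Resp : Type x} {Ind : Type y}
    (A : Algorithm.{v} n In Resp Ind) where
  state : Fin n → A.State
  sent : Fin n → Fin n → List A.Msg
  rcvd : Fin n → Fin n → Finset ℕ
  crashed : Fin n → Prop
  pending : Fin n → Prop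
  hist : List (HistEvent n In Resp Ind)

namespace Instr

variable {n : ℕ} {Msg : Type v} {Resp : Type x} {Ind : Type y}

/-- The message sent to `j` by an action, if any. -/
def sendTo (j : Fin n) : Instr n Msg Resp Ind → Option Msg
  | send dst m => if dst = j then some m else none
  | respond _ => none
  | indicate _ => none

/-- The visible event produced by an action of process `i`, if any. -/
def visible (In : Type w) (i : Fin n) : Instr n Msg Resp Ind → Option (HistEvent n In Resp Ind)
  | send _ _ => none
  | respond r => some (HistEvent.res i r)
  | indicate d => some (HistEvent.ind i d)

end Instr

namespace Config

variable {n : ℕ} {In : Type w} {Resp : Type x} {Ind : Type y} {A : Algorithm.{v} n In Resp Ind}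

/-- The initial configuration. -/
def initial (A : Algorithm.{v} n In Resp Ind) : Config A where
  state := A.start
  sent := fun _ _ => []
  rcvd := fun _ _ => ∅
  crashed := fun _ => False
  pending := fun _ => False
  hist := []

/-- The complete reaction of process `i` to a trigger: new local state and actions. (A reception of
a message that was never sent is not `Enabled`; here it has no effect.) -/
def reaction (c : Config A) (i : Fin n) :
    Trigger n In → A.State × List (Instr n A.Msg Resp Ind)
  | Trigger.invoke a => A.onInvoke i a (c.state i)
  | Trigger.receive src k =>
      match (c.sent src i)[k]? with
      | some m => A.onReceive i src m (c.state i)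
      | none => (c.state i, [])
  | Trigger.internal => A.onInternal i (c.state i)

/-- The actions that are really performed: all of them, or those that precede the crash. -/
def performed (c : Config A) (i : Fin n) (tr : Trigger n In) (cut : Option ℕ) :
    List (Instr n A.Msg Resp Ind) :=
  match cut with
  | none => (c.reaction i tr).2
  | some k => (c.reaction i tr).2.take k

/-- The events that may occur in a configuration. Processes are sequential: a process can invoke an
operation only if its previous one has returned. A message is received at most once. -/
def Enabled (ch : Channels) (c : Config A) : Event n In → Prop
  | Event.idle => True
  | Event.step i tr _ => ¬ c.crashed i ∧
      match tr with
      | Trigger.invoke _ => ¬ c.pending i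
      | Trigger.receive src k =>
          k < (c.sent src i).length ∧ k ∉ c.rcvd src i ∧
            (ch = Channels.fifo → ∀ k' < k, k' ∈ c.rcvd src i)
      | Trigger.internal => True

/-- The configuration after an event. -/
def after (c : Config A) : Event n In → Config A
  | Event.idle => c
  | Event.step i tr cut =>
      { state := Function.update c.state i (c.reaction i tr).1
        sent := fun a b =>
          if a = i then c.sent a b ++ (c.performed i tr cut).filterMap (Instr.sendTo b)
          else c.sent a b
        rcvd := fun a b =>
          match tr with
          | Trigger.receive src k => if a = src ∧ b = i then insert k (c.rcvd a b) else c.rcvd a b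
          | _ => c.rcvd a b
        crashed := fun j => c.crashed j ∨ (j = i ∧ cut.isSome)
        pending := fun j =>
          if j = i then
            (c.pending i ∨ ∃ a, tr = Trigger.invoke a) ∧
              ∀ r, Instr.respond r ∉ c.performed i tr cut
          else c.pending j
        hist := c.hist ++
          (match tr with
            | Trigger.invoke a => [HistEvent.inv i a]
            | _ => []) ++
          (c.performed i tr cut).filterMap (Instr.visible In i) }

/-- The configuration reached at time `τ` under a sequence of events. -/
def configAt (A : Algorithm.{v} n In Resp Ind) (ev : ℕ → Event n In) : ℕ → Config A
  | 0 => initial A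
  | τ + 1 => (Config.configAt A ev τ).after (ev τ)

end Config

section Runs

variable {n : ℕ} {In : Type w} {Resp : Type x} {Ind : Type y}

/-- The non-faulty processes: those that never crash. -/
def correctSet (A : Algorithm.{v} n In Resp Ind) (ev : ℕ → Event n In) : Set (Fin n) :=
  {i | ∀ τ, ¬ (Config.configAt A ev τ).crashed i}

/-- `ev` is a run of `A` in the crash-prone asynchronous message-passing model with `n` processes,
of which at most `t` crash: every event is possible when it occurs, every non-faulty process takes
infinitely many internal steps, and every message sent to a non-faulty process is received. -/
structure IsRun (ch : Channels) (t : ℕ) (A : Algorithm.{v} n In Resp Ind)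
    (ev : ℕ → Event n In) : Prop where
  enabled : ∀ τ, (Config.configAt A ev τ).Enabled ch (ev τ)
  crashes : (correctSet A ev)ᶜ.ncard ≤ t
  progress : ∀ i ∈ correctSet A ev, ∀ τ, ∃ τ' ≥ τ, ev τ' = Event.step i Trigger.internal none
  reliable : ∀ i, ∀ j ∈ correctSet A ev, ∀ τ, ∀ k < ((Config.configAt A ev τ).sent i j).length,
    ∃ τ', k ∈ (Config.configAt A ev τ').rcvd i j

/-- A (finite or infinite) history: `h p e` says that the `p`-th visible event is `e`. -/
abbrev History (n : ℕ) (In : Type w) (Resp : Type x) (Ind : Type y) :=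
  ℕ → HistEvent n In Resp Ind → Prop

/-- The history of a run. -/
def historyOf (A : Algorithm.{v} n In Resp Ind) (ev : ℕ → Event n In) : History n In Resp Ind :=
  fun p e => ∃ τ, (Config.configAt A ev τ).hist[p]? = some e

/-- The operation invoked by process `i` at position `p` returns `r` at position `q`: this is the
first response of `i` after `p`. -/
def Returns (h : History n In Resp Ind) (i : Fin n) (p q : ℕ) (r : Resp) : Prop :=
  p < q ∧ h q (HistEvent.res i r) ∧ ∀ k r', p < k → k < q → ¬ h k (HistEvent.res i r')

end Runs

/-! ## SCD-broadcast

Invoking the operation `m : M` is scd-broadcasting `m`; it returns `()`. The indication `ms : Set M`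
is the scd-delivery of the message set `ms`. -/

/-- All scd-broadcast messages are different. -/
def DistinctBroadcasts {n : ℕ} {M : Type u} (h : History n M Unit (Set M)) : Prop :=
  ∀ p p' i i' m, h p (HistEvent.inv i m) → h p' (HistEvent.inv i' m) → p = p'

/-- The properties that define SCD-broadcast. In `ms_ordering`, "first" and "later" refer to
positions in the history; by `integrity` the two sets delivered by the same process differ. -/
structure IsSCDBroadcast {n : ℕ} {M : Type u} (h : History n M Unit (Set M))
    (correct : Set (Fin n)) : Prop where
  nonempty : ∀ q i ms, h q (HistEvent.ind i ms) → ms.Nonempty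
  validity : ∀ q i ms, h q (HistEvent.ind i ms) → ∀ m ∈ ms, ∃ p < q, ∃ j, h p (HistEvent.inv j m)
  integrity : ∀ i q q' ms ms', h q (HistEvent.ind i ms) → h q' (HistEvent.ind i ms') →
    ∀ m, m ∈ ms → m ∈ ms' → q = q'
  ms_ordering : ∀ i a a' msi msi', h a (HistEvent.ind i msi) → h a' (HistEvent.ind i msi') → a < a' →
    ∀ m ∈ msi, ∀ m' ∈ msi',
      ¬ ∃ j b b' msj msj', h b' (HistEvent.ind j msj') ∧ h b (HistEvent.ind j msj) ∧ b' < b ∧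
        m' ∈ msj' ∧ m ∈ msj
  termination1 : ∀ i ∈ correct, ∀ p m, h p (HistEvent.inv i m) →
    (∃ q, Returns h i p q ()) ∧ ∃ q ms, h q (HistEvent.ind i ms) ∧ m ∈ ms
  termination2 : ∀ i ∈ correct, ∀ q ms, h q (HistEvent.ind i ms) → ∀ m ∈ ms,
    ∀ j ∈ correct, ∃ q' ms', h q' (HistEvent.ind j ms') ∧ m ∈ ms'

/-- `A` implements SCD-broadcast in the model with `n` processes and at most `t` crashes. -/
def ImplementsSCD {n : ℕ} {M : Type u} (ch : Channels) (t : ℕ)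
    (A : Algorithm.{v} n M Unit (Set M)) : Prop :=
  ∀ ev, IsRun ch t A ev → DistinctBroadcasts (historyOf A ev) →
    IsSCDBroadcast (historyOf A ev) (correctSet A ev)

/-! ## Atomic read/write registers -/

inductive RegOp (V : Type u) where
  | read
  | write (a : V)

inductive RegResp (V : Type u) where
  | ack
  | value (a : V)

/-- A candidate linearization: operations are named by the position of their invocation, `ops` is the
set of the linearized ones, and they are executed by increasing `rank`. The read at `p` has to return
the value of the closest write that precedes it, or the initial value `v₀` if there is none. -/
def ReadsValue {n : ℕ} {V : Type u} (v₀ : V) (h : History n (RegOp V) (RegResp V) Empty)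
    (ops : Set ℕ) (rank : ℕ → ℕ) (p : ℕ) (a : V) : Prop :=
  (∃ s ∈ ops, ∃ i, h s (HistEvent.inv i (RegOp.write a)) ∧ rank s < rank p ∧
    ∀ s' ∈ ops, ∀ i' a', h s' (HistEvent.inv i' (RegOp.write a')) → rank s' < rank p →
      rank s' ≤ rank s) ∨
  (a = v₀ ∧ ∀ s ∈ ops, ∀ i a', h s (HistEvent.inv i (RegOp.write a')) → ¬ rank s < rank p)

/-- The history is one of an atomic register with initial value `v₀`. Every operation that returned
is linearized; a pending operation (the last one of a faulty process) may or may not be. -/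
structure IsAtomicRegister {n : ℕ} {V : Type u} (v₀ : V)
    (h : History n (RegOp V) (RegResp V) Empty) (correct : Set (Fin n)) : Prop where
  liveness : ∀ i ∈ correct, ∀ p o, h p (HistEvent.inv i o) → ∃ q r, Returns h i p q r
  consistency : ∃ (ops : Set ℕ) (rank : ℕ → ℕ),
    (∀ p ∈ ops, ∃ i o, h p (HistEvent.inv i o)) ∧
    (∀ i p o q r, h p (HistEvent.inv i o) → Returns h i p q r → p ∈ ops) ∧
    Set.InjOn rank ops ∧
    (∀ i p o q r, h p (HistEvent.inv i o) → Returns h i p q r →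
      ∀ p' ∈ ops, q < p' → rank p < rank p') ∧
    (∀ i p a q r, h p (HistEvent.inv i (RegOp.write a)) → Returns h i p q r → r = RegResp.ack) ∧
    (∀ i p q r, h p (HistEvent.inv i RegOp.read) → Returns h i p q r →
      ∃ a, r = RegResp.value a ∧ ReadsValue v₀ h ops rank p a)

/-- Only processes of `W` write and only processes of `R` read. -/
def RespectsRoles {n : ℕ} {V : Type u} (W R : Set (Fin n))
    (h : History n (RegOp V) (RegResp V) Empty) : Prop :=
  ∀ p i, (h p (HistEvent.inv i RegOp.read) → i ∈ R) ∧
    ∀ a, h p (HistEvent.inv i (RegOp.write a)) → i ∈ W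

/-- `A` implements an atomic register with set of writers `W` and set of readers `R` (an MWMR register
for `W = R = univ`, an SWMR register if `W` is a singleton and `R = univ`). -/
def ImplementsRegister {n : ℕ} {V : Type u} (ch : Channels) (t : ℕ) (v₀ : V) (W R : Set (Fin n))
    (A : Algorithm.{v} n (RegOp V) (RegResp V) Empty) : Prop :=
  ∀ ev, IsRun ch t A ev → RespectsRoles W R (historyOf A ev) →
    IsAtomicRegister v₀ (historyOf A ev) (correctSet A ev)

/-! ## The SCD-broadcast algorithm -/

namespace SCD

/-- The protocol message FORWARD(m, sd, snsd, f, snf). -/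
structure Forward (n : ℕ) (M : Type u) where
  m : M
  sd : Fin n
  snsd : ℕ
  f : Fin n
  snf : ℕ

/-- A quadruplet ⟨m, sd, sn, cl⟩ of the buffer; `⊤` stands for `+∞`. -/
structure Quad (n : ℕ) (M : Type u) where
  m : M
  sd : Fin n
  sn : ℕ
  cl : Fin n → ℕ∞

/-- Local state. `clock j` is the greatest sequence number of a message of `j` scd-delivered so far,
and `⊥` (smaller than every sequence number) if there is none. `waiting` says that an operation is
blocked at its wait statement. -/
structure LocalState (n : ℕ) (M : Type u) where
  buffer : Finset (Quad n M)
  sn : ℕ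
  clock : Fin n → WithBot ℕ
  waiting : Prop

variable {n : ℕ} {M : Type u}

abbrev Act (n : ℕ) (M : Type u) := Instr n (Forward n M) Unit (Set M)

/-- Broadcast to all processes, including the sender. -/
def broadcast (msg : Forward n M) : List (Act n M) :=
  (List.finRange n).map fun j => Instr.send j msg

open Classical in
/-- The procedure forward(m, sd, snsd, f, snf) at process `i`. -/
noncomputable def forward (i : Fin n) (msg : Forward n M) (s : LocalState n M) :
    LocalState n M × List (Act n M) :=
  if s.clock msg.sd < (msg.snsd : WithBot ℕ) then
    if ∃ q ∈ s.buffer, q.sd = msg.sd ∧ q.sn = msg.snsd then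
      ({ s with
          buffer := s.buffer.image fun q =>
            if q.sd = msg.sd ∧ q.sn = msg.snsd then
              { q with cl := Function.update q.cl msg.f (msg.snf : ℕ∞) }
            else q }, [])
    else
      ({ s with
          buffer := insert
            { m := msg.m, sd := msg.sd, sn := msg.snsd,
              cl := Function.update (fun _ => ⊤) msg.f (msg.snf : ℕ∞) } s.buffer
          sn := s.sn + 1 },
        broadcast { m := msg.m, sd := msg.sd, snsd := msg.snsd, f := i, snf := s.sn })
  else (s, [])

/-- `|{f : q.cl[f] < q'.cl[f]}| ≤ n / 2`. -/
def NotMajorityBefore (q q' : Quad n M) : Prop :=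
  2 * {f : Fin n | q.cl f < q'.cl f}.ncard ≤ n

/-- `|{f : q.cl[f] < ∞}| > n / 2`. -/
def SeenByMajority (q : Quad n M) : Prop :=
  n < 2 * {f : Fin n | q.cl f < ⊤}.ncard

open Classical in
/-- The while loop of tryDeliver: as long as some `q` in `T` and `q'` in `buffer \ T` satisfy
`NotMajorityBefore q q'`, one such `q` is withdrawn from `T`. -/
noncomputable def purge (buffer T : Finset (Quad n M)) : Finset (Quad n M) :=
  if h : ∃ q ∈ T, ∃ q' ∈ buffer \ T, NotMajorityBefore q q' then
    purge buffer (T.erase h.choose)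
  else T
termination_by T.card
decreasing_by exact Finset.card_erase_lt_of_mem h.choose_spec.1

open Classical in
/-- The set of quadruplets to deliver, as computed by tryDeliver. -/
noncomputable def toDeliver (buffer : Finset (Quad n M)) : Finset (Quad n M) :=
  purge buffer (buffer.filter SeenByMajority)

open Classical in
/-- The procedure tryDeliver(). -/
noncomputable def tryDeliver (s : LocalState n M) : LocalState n M × List (Act n M) :=
  if (toDeliver s.buffer).Nonempty then
    ({ s with
        clock := fun j => s.clock j ⊔
          ((toDeliver s.buffer).filter fun q => q.sd = j).sup fun q => (q.sn : WithBot ℕ)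
        buffer := s.buffer \ toDeliver s.buffer },
      [Instr.indicate {m | ∃ q ∈ toDeliver s.buffer, q.m = m}])
  else (s, [])

open Classical in
/-- The SCD-broadcast algorithm. The wait statement of an operation of process `i` is evaluated at the
internal steps of `i`. -/
noncomputable def algorithm (n : ℕ) (M : Type u) : Algorithm.{u} n M Unit (Set M) where
  State := LocalState n M
  Msg := Forward n M
  start := fun _ => { buffer := ∅, sn := 0, clock := fun _ => ⊥, waiting := False }
  onInvoke := fun i m s =>
    forward i { m := m, sd := i, snsd := s.sn, f := i, snf := s.sn } { s with waiting := True }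
  onReceive := fun i _ msg s =>
    ((tryDeliver (forward i msg s).1).1, (forward i msg s).2 ++ (tryDeliver (forward i msg s).1).2)
  onInternal := fun i s =>
    if s.waiting ∧ ¬ ∃ q ∈ s.buffer, q.sd = i then
      ({ s with waiting := False }, [Instr.respond ()])
    else (s, [])

end SCD

/-! ## FIFO communication on top of unordered channels -/

namespace Fifo

variable {n : ℕ} {In : Type w} {Resp : Type x} {Ind : Type y}

/-- Local state of the layer: the state of the upper algorithm, the number of messages sent to each
process, the number of messages fifo-delivered from each process, the received messages by sender and
sequence number, and a round-robin counter. -/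
structure LayerState (A : Algorithm.{v} n In Resp Ind) where
  inner : A.State
  nextOut : Fin n → ℕ
  nextIn : Fin n → ℕ
  pool : Fin n → ℕ → Option A.Msg
  turn : ℕ

/-- Number the messages sent by a sequence of actions, destination by destination. -/
def number {Msg : Type v} : (Fin n → ℕ) → List (Instr n Msg Resp Ind) →
    (Fin n → ℕ) × List (Instr n (ℕ × Msg) Resp Ind)
  | c, [] => (c, [])
  | c, Instr.send j m :: l =>
      ((number (Function.update c j (c j + 1)) l).1,
        Instr.send j (c j, m) :: (number (Function.update c j (c j + 1)) l).2)
  | c, Instr.respond r :: l => ((number c l).1, Instr.respond r :: (number c l).2)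
  | c, Instr.indicate d :: l => ((number c l).1, Instr.indicate d :: (number c l).2)

/-- Execute a reaction of the upper algorithm, numbering the messages it sends. -/
def run {A : Algorithm.{v} n In Resp Ind} (s : LayerState A)
    (a : A.State × List (Instr n A.Msg Resp Ind)) :
    LayerState A × List (Instr n (ℕ × A.Msg) Resp Ind) :=
  ({ s with inner := a.1, nextOut := (number s.nextOut a.2).1 }, (number s.nextOut a.2).2)

/-- The algorithm `A` over a FIFO layer: messages carry sequence numbers, received messages are stored,
and at its internal steps a process, in round-robin fashion, fifo-delivers to `A` the next message
from process `0`, …, process `n - 1` (if it is there), and then executes an internal step of `A`. -/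
def layer (A : Algorithm.{v} n In Resp Ind) : Algorithm.{v} n In Resp Ind where
  State := LayerState A
  Msg := ℕ × A.Msg
  start := fun i =>
    { inner := A.start i, nextOut := fun _ => 0, nextIn := fun _ => 0,
      pool := fun _ _ => none, turn := 0 }
  onInvoke := fun i a s => run s (A.onInvoke i a s.inner)
  onReceive := fun _ src msg s =>
    ({ s with pool := Function.update s.pool src (Function.update (s.pool src) msg.1 (some msg.2)) },
      [])
  onInternal := fun i s =>
    if hj : s.turn % (n + 1) < n then
      match s.pool ⟨s.turn % (n + 1), hj⟩ (s.nextIn ⟨s.turn % (n + 1), hj⟩) with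
      | some m =>
          run
            { s with
              turn := s.turn + 1
              nextIn := Function.update s.nextIn ⟨s.turn % (n + 1), hj⟩
                (s.nextIn ⟨s.turn % (n + 1), hj⟩ + 1) }
            (A.onReceive i ⟨s.turn % (n + 1), hj⟩ m s.inner)
      | none => ({ s with turn := s.turn + 1 }, [])
    else run { s with turn := s.turn + 1 } (A.onInternal i s.inner)

end Fifo

/-! Safety. The counter `sn` of a process counts its broadcast FORWARD messages, so the number
carried by such a message is its position in the log of its author, and an application message is
identified by its sender and its position in the sender's log. `Before L x y f` says that `f` has
logged `x`, with `y` nowhere up to that point; growing logs cannot destroy this. The core of `Inv`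
is the field `before`: if some process has delivered `x` but not `y`, then a majority has forwarded
`x` before `y`. As two majorities meet, no two processes deliver `x` and `y` in opposite orders
(`Maj.not_before`). The field is preserved by deliveries (`Inv.before_of_toDeliver`) because
whatever the withdrawal loop keeps is seen by a majority and is ahead, on a majority of entries, of
everything left in the buffer, and because FIFO reception makes those entries reliable evidence
about the logs. One clock entry per sender is enough since the wait statement orders the messages of
a sender (field `wait`). Crashes are made invisible to the invariant: an interrupted reaction is
logged as if it had been completed.

Liveness. The loop computes the greatest stable set, so a finite set of messages none of which has
to wait for an outside one is delivered once all its FORWARD messages from non-faulty processes are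
there (`del_of_good`). If only finitely many messages are forwarded by non-faulty processes, take
all of them. Otherwise some non-faulty `s` broadcasts infinitely often; the wait statement then
forces `s` to deliver everything (`del_of_infinite_sender`), and the messages that `s` has delivered
by a late enough time form a good set (`del_of_star`). An operation returns because all messages of
its process get delivered.

FIFO layer. A run of the layered algorithm simulates a run of the upper algorithm over FIFO channels
with the same history and the same non-faulty processes (`Fifo.Sim`, `Fifo.isRun_innerRun`).

Impossibility. If `n ≤ 2 * t`, split the processes into two groups of at most `t`. Each group must
make progress when the other one is initially crashed. Replaying both solo runs one after the other,
with all messages between the groups delayed, gives a run without crashes in which the second group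
acts in ignorance of the first (`exists_glued`): a read misses a completed write, or two processes
deliver two messages in opposite orders. -/

namespace SCD

variable {n : ℕ} {M : Type u}

/-! ## Correctness of the SCD-broadcast algorithm: the safety invariant -/

/-- A set of processes that contains a majority. -/
def Maj (S : Set (Fin n)) : Prop := n < 2 * S.ncard

theorem Maj.mono {S S' : Set (Fin n)} (h : Maj S) (hs : S ⊆ S') : Maj S' := by
  have := Set.ncard_le_ncard hs (Set.toFinite _)
  unfold Maj at *
  omega

theorem Maj.inter {S S' : Set (Fin n)} (h : Maj S) (h' : Maj S') : (S ∩ S').Nonempty := by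
  by_contra hne
  rw [Set.not_nonempty_iff_eq_empty, ← Set.disjoint_iff_inter_eq_empty] at hne
  have h1 := Set.ncard_union_eq hne (Set.toFinite _) (Set.toFinite _)
  have h2 : (S ∪ S').ncard ≤ n := by
    have := Set.ncard_le_ncard (Set.subset_univ (S ∪ S')) (Set.toFinite _)
    simpa [Set.ncard_univ] using this
  unfold Maj at *
  omega

/-! ### Logs of FORWARD messages and their order -/

/-- Application messages are identified by their sender and sequence number. -/
def Quad.key (q : Quad n M) : Fin n × ℕ := (q.sd, q.sn)

/-- The `k`-th FORWARD message broadcast by `f` concerns the application message `x`. -/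
def At (L : Fin n → List (Forward n M)) (f : Fin n) (k : ℕ) (x : Fin n × ℕ) : Prop :=
  ∃ w, (L f)[k]? = some w ∧ (w.sd, w.snsd) = x

/-- The application message `x` was broadcast by its sender, with contents `m`. -/
def IsMsg (L : Fin n → List (Forward n M)) (x : Fin n × ℕ) (m : M) : Prop :=
  (L x.1)[x.2]? = some ⟨m, x.1, x.2, x.1, x.2⟩

/-- The clock of `i` has passed `x`. -/
def Del (st : Fin n → LocalState n M) (i : Fin n) (x : Fin n × ℕ) : Prop :=
  (x.2 : WithBot ℕ) ≤ (st i).clock x.1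

/-- Process `f` has forwarded `x`, and not `y` before. -/
def Before (L : Fin n → List (Forward n M)) (x y : Fin n × ℕ) (f : Fin n) : Prop :=
  ∃ k, At L f k x ∧ ∀ k' ≤ k, ¬ At L f k' y

theorem At.lt {L : Fin n → List (Forward n M)} {f k x} (h : At L f k x) : k < (L f).length := by
  obtain ⟨w, hw, -⟩ := h
  exact (List.getElem?_eq_some_iff.1 hw).1

theorem At.key_eq {L : Fin n → List (Forward n M)} {f k x y} (h : At L f k x) (h' : At L f k y) :
    x = y := by
  obtain ⟨w, hw, rfl⟩ := h
  obtain ⟨w', hw', rfl⟩ := h'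
  rw [hw] at hw'
  cases hw'
  rfl

theorem IsMsg.at {L : Fin n → List (Forward n M)} {x m} (h : IsMsg L x m) : At L x.1 x.2 x :=
  ⟨_, h, rfl⟩

theorem IsMsg.unique {L : Fin n → List (Forward n M)} {x m m'} (h : IsMsg L x m)
    (h' : IsMsg L x m') : m = m' := by
  unfold IsMsg at *
  rw [h] at h'
  cases h'
  rfl

theorem not_before_of_before {L : Fin n → List (Forward n M)} {x y f} (h : Before L x y f)
    (h' : Before L y x f) : False := by
  obtain ⟨k, hk, hk'⟩ := h
  obtain ⟨l, hl, hl'⟩ := h'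
  rcases le_total k l with hkl | hkl
  · exact hl' k hkl hk
  · exact hk' l hkl hl

/-- A process common to both majorities would have forwarded each message before the other.
MS-Ordering reduces to this. -/
theorem Maj.not_before {L : Fin n → List (Forward n M)} {x y} (h : Maj {f | Before L x y f})
    (h' : Maj {f | Before L y x f}) : False := by
  obtain ⟨f, hf, hf'⟩ := h.inter h'
  exact not_before_of_before hf hf'

/-- Every log of `L` is a prefix of the corresponding one of `L'`. -/
def LogLE (L L' : Fin n → List (Forward n M)) : Prop := ∀ i, L i <+: L' i

theorem getElem?_of_prefix {α : Type*} {l l' : List α} (h : l <+: l') {k : ℕ} {a : α}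
    (ha : l[k]? = some a) : l'[k]? = some a := by
  obtain ⟨t, rfl⟩ := h
  rw [List.getElem?_append_left (List.getElem?_eq_some_iff.1 ha).1, ha]

theorem LogLE.at {L L' : Fin n → List (Forward n M)} (h : LogLE L L') {f k x} (hx : At L f k x) :
    At L' f k x := by
  obtain ⟨w, hw, hx⟩ := hx
  exact ⟨w, getElem?_of_prefix (h f) hw, hx⟩

theorem LogLE.at_iff {L L' : Fin n → List (Forward n M)} (h : LogLE L L') {f k x}
    (hk : k < (L f).length) : At L' f k x ↔ At L f k x := by
  refine ⟨fun hx => ?_, h.at⟩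
  have : At L f k ((L f)[k].sd, (L f)[k].snsd) := ⟨_, List.getElem?_eq_getElem hk, rfl⟩
  rwa [(h.at this).key_eq hx] at this

theorem LogLE.isMsg {L L' : Fin n → List (Forward n M)} (h : LogLE L L') {x m}
    (hx : IsMsg L x m) : IsMsg L' x m :=
  getElem?_of_prefix (h _) hx

/-- `Before` inspects the log of `f` only up to the position of `x`, and that part never changes. -/
theorem LogLE.before {L L' : Fin n → List (Forward n M)} (h : LogLE L L') {f x y}
    (hx : Before L x y f) : Before L' x y f := by
  obtain ⟨k, hk, hk'⟩ := hx
  exact ⟨k, h.at hk, fun k' hkk' hy => hk' k' hkk' ((h.at_iff (hkk'.trans_lt hk.lt)).1 hy)⟩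

theorem LogLE.maj {L L' : Fin n → List (Forward n M)} (h : LogLE L L') {x y}
    (hx : Maj {f | Before L x y f}) : Maj {f | Before L' x y f} :=
  hx.mono fun _ hf => h.before hf

theorem logLE_append (L : Fin n → List (Forward n M)) (i : Fin n) (l : List (Forward n M)) :
    LogLE L (Function.update L i (L i ++ l)) := by
  intro j
  by_cases hj : j = i
  · subst hj; simp
  · simp [hj]

theorem at_append {L : Fin n → List (Forward n M)} {i e f k x} :
    At (Function.update L i (L i ++ [e])) f k x ↔
      At L f k x ∨ (f = i ∧ k = (L i).length ∧ (e.sd, e.snsd) = x) := by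
  by_cases hf : f = i
  · subst hf
    simp only [At, Function.update_self, true_and]
    rcases lt_trichotomy k (L f).length with hk | hk | hk
    · simp [List.getElem?_append_left hk, hk.ne]
    · simp [hk]
    · rw [List.getElem?_eq_none (by simp; omega), List.getElem?_eq_none (by omega)]
      simp [hk.ne']
  · simp [At, hf]

theorem isMsg_append {L : Fin n → List (Forward n M)} {i e x m} :
    IsMsg (Function.update L i (L i ++ [e])) x m ↔
      IsMsg L x m ∨ (x.1 = i ∧ x.2 = (L i).length ∧ e = ⟨m, x.1, x.2, x.1, x.2⟩) := by
  obtain ⟨f, k⟩ := x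
  by_cases hf : f = i
  · subst hf
    simp only [IsMsg, Function.update_self, true_and]
    rcases lt_trichotomy k (L f).length with hk | hk | hk
    · simp [List.getElem?_append_left hk, hk.ne]
    · simp [hk]
    · rw [List.getElem?_eq_none (by simp; omega), List.getElem?_eq_none (by omega)]
      simp [hk.ne']
  · simp [IsMsg, hf]

/-! ### The inductive invariant -/

/-- The safety invariant on local states `st`, logs `L` of all broadcast FORWARD messages, and
numbers `got f i` of FORWARD messages of `f` received by `i`. -/
structure Inv (st : Fin n → LocalState n M) (L : Fin n → List (Forward n M))
    (got : Fin n → Fin n → ℕ) : Prop where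
  len : ∀ i, (L i).length = (st i).sn
  -- Sequence numbers are log positions, and each forwarded message is genuine: it stands in its
  -- sender's log at the position that names it.
  form : ∀ i k (w : Forward n M), (L i)[k]? = some w → w.f = i ∧ w.snf = k ∧ IsMsg L (w.sd, w.snsd) w.m
  inj : ∀ i k k' x, At L i k x → At L i k' x → k = k'
  cover : ∀ i k x, At L i k x → (∃ q ∈ (st i).buffer, q.key = x) ∨ Del st i x
  got_le : ∀ f i, got f i ≤ (L f).length
  rcv : ∀ f i k x, k < got f i → At L f k x → ∃ k', At L i k' x
  buf : ∀ i, ∀ q ∈ (st i).buffer, ¬ Del st i q.key ∧ IsMsg L q.key q.m ∧ ∃ k, At L i k q.key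
  uniq : ∀ i, ∀ q ∈ (st i).buffer, ∀ q' ∈ (st i).buffer, q.key = q'.key → q = q'
  -- The exception is a process that has just broadcast its own message: its own entry is filled in
  -- before its FORWARD message comes back to it.
  cl_at : ∀ i, ∀ q ∈ (st i).buffer, ∀ f (k : ℕ), q.cl f = k →
    At L f k q.key ∧ (k < got f i ∨ f = i ∧ q.sd = i)
  cl_rcv : ∀ i, ∀ q ∈ (st i).buffer, ∀ f k, k < got f i → At L f k q.key → q.cl f = k
  cl_own : ∀ i, ∀ q ∈ (st i).buffer, q.sd = i → q.cl i = q.sn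
  -- What the sender of `x` had forwarded before broadcasting `x` is forwarded before `x` by
  -- everybody; this comes from FIFO reception.
  causal : ∀ x m k' y f k, IsMsg L x m → k' < x.2 → At L x.1 k' y → At L f k x →
    ∃ k'' < k, At L f k'' y
  del_log : ∀ i x m, IsMsg L x m → Del st i x → ∃ k, At L i k x
  own : ∀ i, ¬ (st i).waiting → ∀ q ∈ (st i).buffer, q.sd ≠ i
  clock : ∀ i j, (st i).clock j < (st j).sn
  -- The heart of safety: deliveries respect an order witnessed by a majority.
  before : ∀ i x m y, IsMsg L x m → Del st i x → ¬ Del st i y → Maj {f | Before L x y f}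
  wait : ∀ s a b m m', IsMsg L (s, a) m → IsMsg L (s, b) m' → a < b →
    Del st s (s, a) ∧ Maj {f | Before L (s, a) (s, b) f}

theorem inv_initial : Inv (n := n) (M := M)
    (fun _ => { buffer := ∅, sn := 0, clock := fun _ => ⊥, waiting := False })
    (fun _ => []) (fun _ _ => 0) := by
  constructor <;> simp [At, IsMsg, Del]

variable {st : Fin n → LocalState n M} {L : Fin n → List (Forward n M)} {got : Fin n → Fin n → ℕ}

/-- Increment one of the counters. -/
def bump (got : Fin n → Fin n → ℕ) (src i : Fin n) : Fin n → Fin n → ℕ :=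
  fun a b => if a = src ∧ b = i then got a b + 1 else got a b

theorem Inv.msg_of_at (h : Inv st L got) {f k x} (hx : At L f k x) : ∃ m, IsMsg L x m := by
  obtain ⟨w, hw, rfl⟩ := hx
  exact ⟨_, (h.form _ _ _ hw).2.2⟩

/-! ### Preservation of the invariant by receptions, invocations and responses -/

/-- Reception of a FORWARD message for a message that was already delivered. -/
theorem Inv.skip (h : Inv st L got) {src i w} (hw : (L src)[got src i]? = some w)
    (hd : Del st i (w.sd, w.snsd)) : Inv st L (bump got src i) where
  len := h.len
  form := h.form
  inj := h.inj
  cover := h.cover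
  got_le f j := by
    have := h.got_le f j
    have := (List.getElem?_eq_some_iff.1 hw).1
    unfold bump
    split <;> grind
  rcv f j k x hk hx := by
    by_cases hk' : k < got f j
    · exact h.rcv f j k x hk' hx
    · have : f = src ∧ j = i ∧ k = got f j := by unfold bump at hk; split at hk <;> grind
      obtain ⟨rfl, rfl, rfl⟩ := this
      have : At L f (got f j) (w.sd, w.snsd) := ⟨w, hw, rfl⟩
      rw [← this.key_eq hx]
      exact h.del_log _ _ _ (h.form _ _ _ hw).2.2 hd
  buf := h.buf
  uniq := h.uniq
  cl_at j q hq f k hk := by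
    obtain ⟨h1, h2⟩ := h.cl_at j q hq f k hk
    refine ⟨h1, h2.imp (fun h3 => ?_) id⟩
    unfold bump
    split <;> omega
  cl_rcv j q hq f k hk hx := by
    by_cases hk' : k < got f j
    · exact h.cl_rcv j q hq f k hk' hx
    · have : f = src ∧ j = i ∧ k = got f j := by unfold bump at hk; split at hk <;> grind
      obtain ⟨rfl, rfl, rfl⟩ := this
      have : At L f (got f j) (w.sd, w.snsd) := ⟨w, hw, rfl⟩
      rw [this.key_eq hx] at hd
      exact absurd hd (h.buf _ q hq).1
  cl_own := h.cl_own
  causal := h.causal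
  del_log := h.del_log
  own := h.own
  clock := h.clock
  before := h.before
  wait := h.wait

/-- Replace the buffer of `i`. -/
def setBuf (st : Fin n → LocalState n M) (i : Fin n) (b : Finset (Quad n M)) :
    Fin n → LocalState n M :=
  Function.update st i { st i with buffer := b }

@[simp] theorem setBuf_sn (i b j) : (setBuf st i b j).sn = (st j).sn := by
  by_cases hj : j = i
  · subst hj; simp [setBuf]
  · simp [setBuf, hj]

@[simp] theorem setBuf_clock (i b j) : (setBuf st i b j).clock = (st j).clock := by
  by_cases hj : j = i
  · subst hj; simp [setBuf]
  · simp [setBuf, hj]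

@[simp] theorem setBuf_waiting (i b j) : (setBuf st i b j).waiting = (st j).waiting := by
  by_cases hj : j = i
  · subst hj; simp [setBuf]
  · simp [setBuf, hj]

@[simp] theorem setBuf_buffer_self (i b) : (setBuf st i b i).buffer = b := by
  simp [setBuf]

@[simp] theorem setBuf_buffer_ne {i b j} (hj : j ≠ i) :
    (setBuf st i b j).buffer = (st j).buffer := by
  simp [setBuf, hj]

@[simp] theorem del_setBuf (i b j x) : Del (setBuf st i b) j x ↔ Del st j x := by
  simp [Del]

open Classical in
/-- The update of a quadruplet at the reception of a FORWARD message. -/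
noncomputable def mark (w : Forward n M) (q : Quad n M) : Quad n M :=
  if q.sd = w.sd ∧ q.sn = w.snsd then { q with cl := Function.update q.cl w.f (w.snf : ℕ∞) } else q

@[simp] theorem mark_key (w : Forward n M) (q : Quad n M) : (mark w q).key = q.key := by
  unfold mark; split <;> rfl

@[simp] theorem mark_m (w : Forward n M) (q : Quad n M) : (mark w q).m = q.m := by
  unfold mark; split <;> rfl

theorem mark_cl (w : Forward n M) (q : Quad n M) (f : Fin n) :
    (mark w q).cl f = if q.key = (w.sd, w.snsd) ∧ f = w.f then (w.snf : ℕ∞) else q.cl f := by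
  unfold mark Quad.key
  by_cases h : q.sd = w.sd ∧ q.sn = w.snsd
  · by_cases hf : f = w.f
    · subst hf; simp [h]
    · simp [h, hf]
  · simp [h]

open Classical in
/-- Reception of a FORWARD message for a message in the buffer. -/
theorem Inv.mark (h : Inv st L got) {src i w} (hw : (L src)[got src i]? = some w)
    (hb : ∃ q ∈ (st i).buffer, q.key = (w.sd, w.snsd)) :
    Inv (setBuf st i ((st i).buffer.image (mark w))) L (bump got src i) := by
  have hwat : At L src (got src i) (w.sd, w.snsd) := ⟨w, hw, rfl⟩
  obtain ⟨hwf, hwk, hwm⟩ := h.form _ _ _ hw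
  have hmem : ∀ j, ∀ q ∈ (setBuf st i ((st i).buffer.image (SCD.mark w)) j).buffer,
      ∃ q' ∈ (st j).buffer, q'.key = q.key ∧ q'.m = q.m ∧ 
        ∀ f, q.cl f = if j = i ∧ q'.key = (w.sd, w.snsd) ∧ f = w.f then (w.snf : ℕ∞)
          else q'.cl f := by
    intro j q hq
    by_cases hj : j = i
    · subst hj
      simp only [setBuf_buffer_self, Finset.mem_image] at hq
      obtain ⟨q', hq', rfl⟩ := hq
      exact ⟨q', hq', by simp, by simp, fun f => by simp [mark_cl]⟩
    · rw [setBuf_buffer_ne hj] at hq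
      exact ⟨q, hq, by simp [hj]⟩
  have hnew : ∀ f j k, k < bump got src i f j → ¬ k < got f j →
      f = src ∧ j = i ∧ k = got f j := by
    intro f j k hk hk'
    unfold bump at hk; split at hk <;> grind
  have hbump : ∀ f j, got f j ≤ bump got src i f j := by
    intro f j; unfold bump; split <;> omega
  constructor
  case len => simpa using h.len
  case form => exact h.form
  case inj => exact h.inj
  case cover =>
    intro j k x hx
    rw [del_setBuf]
    refine (h.cover j k x hx).imp_left ?_
    rintro ⟨q, hq, rfl⟩
    by_cases hj : j = i
    · subst hj
      exact ⟨SCD.mark w q, by simpa using ⟨q, hq, rfl⟩, by simp⟩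
    · exact ⟨q, by simpa [hj] using hq, rfl⟩
  case got_le =>
    intro f j
    have := h.got_le f j
    have := (List.getElem?_eq_some_iff.1 hw).1
    unfold bump
    split <;> grind
  case rcv =>
    intro f j k x hk hx
    by_cases hk' : k < got f j
    · exact h.rcv f j k x hk' hx
    · obtain ⟨rfl, rfl, rfl⟩ := hnew f j k hk hk'
      obtain ⟨q, hq, hqk⟩ := hb
      rw [← hwat.key_eq hx, ← hqk]
      exact (h.buf _ q hq).2.2
  case buf =>
    intro j q hq
    obtain ⟨q', hq', hk, hm, -⟩ := hmem j q hq
    rw [del_setBuf, ← hk, ← hm]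
    exact h.buf j q' hq'
  case uniq =>
    intro j q hq r hr hqr
    by_cases hj : j = i
    · subst hj
      simp only [setBuf_buffer_self, Finset.mem_image] at hq hr
      obtain ⟨q', hq', rfl⟩ := hq
      obtain ⟨r', hr', rfl⟩ := hr
      rw [h.uniq _ q' hq' r' hr' (by simpa using hqr)]
    · rw [setBuf_buffer_ne hj] at hq hr
      exact h.uniq j q hq r hr hqr
  case cl_at =>
    intro j q hq f k hqf
    obtain ⟨q', hq', hk, hm, hcl⟩ := hmem j q hq
    have hsd : q'.sd = q.sd := congrArg Prod.fst hk
    rw [hcl f] at hqf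
    split at hqf
    · rename_i hc
      obtain ⟨rfl, hc, rfl⟩ := hc
      have hk0 : w.snf = k := by exact_mod_cast hqf
      rw [hwf, ← hk, hc, ← hk0, hwk]
      refine ⟨hwat, Or.inl ?_⟩
      simp [bump]
    · obtain ⟨h1, h2⟩ := h.cl_at j q' hq' f k hqf
      rw [← hk, ← hsd]
      exact ⟨h1, h2.imp_left fun h3 => h3.trans_le (hbump f j)⟩
  case cl_rcv =>
    intro j q hq f k hk0 hx
    obtain ⟨q', hq', hk, hm, hcl⟩ := hmem j q hq
    rw [hcl f]
    rw [← hk] at hx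
    split
    · rename_i hc
      obtain ⟨rfl, hc, rfl⟩ := hc
      rw [hc, hwf] at hx
      rw [hwk, h.inj _ _ _ _ hx hwat]
    · rename_i hc
      by_cases hk' : k < got f j
      · exact h.cl_rcv j q' hq' f k hk' hx
      · obtain ⟨rfl, rfl, rfl⟩ := hnew f j k hk0 hk'
        exact absurd ⟨rfl, hx.key_eq hwat, hwf.symm⟩ hc
  case cl_own =>
    intro j q hq hqj
    obtain ⟨q', hq', hk, hm, hcl⟩ := hmem j q hq
    have hsd : q'.sd = q.sd := congrArg Prod.fst hk
    have hsn : q'.sn = q.sn := congrArg Prod.snd hk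
    rw [hcl j, ← hsn]
    split
    -- The process receives its own FORWARD message back; it forwarded its message only once, so the
    -- entry is overwritten with the value it already has.
    · rename_i hc
      obtain ⟨rfl, hc, hf⟩ := hc
      have h1 : At L j q'.sn q'.key := by
        have := (h.buf j q' hq').2.1.at
        rwa [show q'.key.1 = j from hsd.trans hqj] at this
      rw [hc] at h1
      rw [← hwf, ← hf] at hwat
      rw [hwk, h.inj _ _ _ _ h1 hwat, hf, hwf]
    · exact h.cl_own j q' hq' (hsd.trans hqj)
  case causal => exact h.causal
  case del_log => simpa using h.del_log
  case own =>
    intro j hj q hq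
    obtain ⟨q', hq', hk, hm, hcl⟩ := hmem j q hq
    have hsd : q'.sd = q.sd := congrArg Prod.fst hk
    rw [← hsd]
    exact h.own j (by simpa using hj) q' hq'
  case clock => simpa using h.clock
  case before => simpa using h.before
  case wait => simpa using h.wait

end SCD

namespace SCD

variable {n : ℕ} {M : Type u}
variable {st : Fin n → LocalState n M} {L : Fin n → List (Forward n M)} {got : Fin n → Fin n → ℕ}

open Classical in
/-- The state of a process after it has added a quadruplet to its buffer. -/
noncomputable def addQuad (s : LocalState n M) (q : Quad n M) (b : Prop) : LocalState n M :=
  { buffer := insert q s.buffer, sn := s.sn + 1, clock := s.clock, waiting := b }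

/-- A process adds a message to its buffer and forwards it, either because it receives the `k₀`-th
FORWARD message of `f₀`, or because it broadcasts the message itself. -/
theorem Inv.add (h : Inv st L got) {i f₀ : Fin n} {x : Fin n × ℕ} {m : M} {k₀ : ℕ} {b : Prop}
    {got' : Fin n → Fin n → ℕ} (hnd : ¬ Del st i x) (hnb : ∀ q ∈ (st i).buffer, q.key ≠ x)
    (hle : ∀ f j, got f j ≤ got' f j) (hle' : ∀ f j, got' f j ≤ (L f).length)
    (hnew : ∀ f j k, k < got' f j → ¬ k < got f j → f = f₀ ∧ j = i ∧ k = k₀)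
    (hx : (IsMsg L x m ∧ At L f₀ k₀ x ∧ k₀ < got' f₀ i ∧ (∀ k' < k₀, k' < got f₀ i) ∧
        ((st i).waiting ↔ b)) ∨
      (x = (i, (L i).length) ∧ f₀ = i ∧ k₀ = (L i).length ∧ ¬ (st i).waiting ∧ b ∧ got' = got)) :
    Inv (Function.update st i (addQuad (st i)
        ⟨m, x.1, x.2, Function.update (fun _ => ⊤) f₀ (k₀ : ℕ∞)⟩ b))
      (Function.update L i (L i ++ [⟨m, x.1, x.2, i, (st i).sn⟩])) got' := by
  classical
  -- By `cover`, a message forwarded earlier would be in the buffer or delivered; hence nothing is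
  -- ever forwarded twice.
  have hfresh : ∀ k, ¬ At L i k x := by
    intro k hk
    rcases h.cover i k x hk with ⟨q, hq, hqx⟩ | hd
    · exact hnb q hq hqx
    · exact hnd hd
  have hlen := h.len i
  set q₀ : Quad n M := ⟨m, x.1, x.2, Function.update (fun _ => ⊤) f₀ (k₀ : ℕ∞)⟩ with hq₀
  have hq₀k : q₀.key = x := rfl
  set e : Forward n M := ⟨m, x.1, x.2, i, (st i).sn⟩ with he
  set st' := Function.update st i (addQuad (st i) q₀ b) with hst
  set L' := Function.update L i (L i ++ [e]) with hL
  have hLL : LogLE L L' := logLE_append L i [e]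
  have hAt : ∀ f k y, At L' f k y ↔ At L f k y ∨ (f = i ∧ k = (L i).length ∧ x = y) := by
    intro f k y
    exact at_append
  -- The appended entry is an original broadcast only for an invocation: a received message already
  -- occupies an older position in its sender's log.
  have hMsg : ∀ y m', IsMsg L' y m' → IsMsg L y m' ∨
      (y = (i, (L i).length) ∧ y = x ∧ m' = m ∧ f₀ = i ∧ k₀ = (L i).length) := by
    intro y m' hy
    rcases isMsg_append.1 hy with hy | ⟨h1, h2, h3⟩
    · exact Or.inl hy
    · refine Or.inr ?_
      have h4 : y = x := Prod.ext (congrArg Forward.sd h3).symm (congrArg Forward.snsd h3).symm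
      have h5 : y = (i, (L i).length) := Prod.ext h1 h2
      refine ⟨h5, h4, (congrArg Forward.m h3).symm, ?_⟩
      rcases hx with ⟨h6, -⟩ | ⟨-, h6, h7, -⟩
      · rw [← h4, h5] at h6
        exact absurd h6.at.lt (by simp)
      · exact ⟨h6, h7⟩
  have hxMsg : IsMsg L' x m := by
    rcases hx with ⟨h6, -⟩ | ⟨h6, -⟩
    · exact hLL.isMsg h6
    · refine isMsg_append.2 (Or.inr ⟨by rw [h6], by rw [h6], ?_⟩)
      simp [he, h6, hlen]
  have hxAt : At L' i (L i).length x := (hAt _ _ _).2 (Or.inr ⟨rfl, rfl, rfl⟩)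
  have hDel : ∀ j y, Del st' j y ↔ Del st j y := by
    intro j y
    by_cases hj : j = i
    · subst hj; simp [Del, hst, addQuad]
    · simp [Del, hst, hj]
  have hmem : ∀ j, ∀ q, q ∈ (st' j).buffer ↔ q ∈ (st j).buffer ∨ (j = i ∧ q = q₀) := by
    intro j q
    by_cases hj : j = i
    · subst hj; simp [hst, addQuad, or_comm]
    · simp [hst, hj]
  have hgot : ∀ f j k y, k < got' f j → At L' f k y → At L f k y := fun f j k y hk hy =>
    (hLL.at_iff (hk.trans_le (hle' f j))).1 hy
  have hAtf : At L' f₀ k₀ x := by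
    rcases hx with ⟨-, h6, -⟩ | ⟨-, rfl, rfl, -⟩
    · exact hLL.at h6
    · exact hxAt
  constructor
  case len =>
    intro j
    by_cases hj : j = i
    · subst hj; simp [hL, hst, addQuad, hlen]
    · simp [hL, hst, hj, h.len]
  case form =>
    intro j k w hw
    by_cases hj : j = i
    · subst hj
      by_cases hk : k < (L j).length
      · have : (L j)[k]? = some w := by
          rw [← hw, hL]
          simp [List.getElem?_append_left hk]
        obtain ⟨h1, h2, h3⟩ := h.form j k w this
        exact ⟨h1, h2, hLL.isMsg h3⟩
      · have hk' : k = (L j).length := by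
          have := (List.getElem?_eq_some_iff.1 hw).1
          simp [hL] at this
          omega
        have hw' : e = w := by
          simpa [hL, hk'] using hw
        subst hw'
        exact ⟨rfl, by simp [he, hk', hlen], hxMsg⟩
    · have : (L j)[k]? = some w := by
        rw [← hw, hL]
        simp [hj]
      obtain ⟨h1, h2, h3⟩ := h.form j k w this
      exact ⟨h1, h2, hLL.isMsg h3⟩
  case inj =>
    intro j k k' y hk hk'
    rcases (hAt _ _ _).1 hk with h1 | ⟨rfl, rfl, rfl⟩ <;>
    rcases (hAt _ _ _).1 hk' with h2 | ⟨h3, h4, h5⟩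
    · exact h.inj _ _ _ _ h1 h2
    · subst h3 h5; exact absurd h1 (hfresh _)
    · exact absurd h2 (hfresh _)
    · exact h4.symm
  case cover =>
    intro j k y hy
    rw [hDel]
    rcases (hAt _ _ _).1 hy with h1 | ⟨rfl, rfl, rfl⟩
    · refine (h.cover j k y h1).imp_left ?_
      rintro ⟨q, hq, hqy⟩
      exact ⟨q, (hmem _ _).2 (Or.inl hq), hqy⟩
    · exact Or.inl ⟨q₀, (hmem _ _).2 (Or.inr ⟨rfl, rfl⟩), hq₀k⟩
  case got_le =>
    intro f j
    exact (hle' f j).trans (hLL f).length_le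
  case rcv =>
    intro f j k y hk hy
    by_cases hk' : k < got f j
    · obtain ⟨k', h1⟩ := h.rcv f j k y hk' (hgot f j k y hk hy)
      exact ⟨k', hLL.at h1⟩
    · obtain ⟨rfl, rfl, rfl⟩ := hnew f j k hk hk'
      rw [hy.key_eq hAtf]
      exact ⟨_, hxAt⟩
  case buf =>
    intro j q hq
    rw [hDel]
    rcases (hmem _ _).1 hq with hq | ⟨rfl, rfl⟩
    · obtain ⟨h1, h2, k, h3⟩ := h.buf j q hq
      exact ⟨h1, hLL.isMsg h2, k, hLL.at h3⟩
    · exact ⟨hnd, hxMsg, _, hxAt⟩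
  case uniq =>
    intro j q hq q' hq' hqq
    rcases (hmem _ _).1 hq with hqb | ⟨rfl, rfl⟩ <;>
    rcases (hmem _ _).1 hq' with hqb' | ⟨h1, rfl⟩
    · exact h.uniq j q hqb q' hqb' hqq
    · subst h1; exact absurd hqq (hnb _ hqb)
    · exact absurd hqq.symm (hnb _ hqb')
    · rfl
  case cl_at =>
    intro j q hq f k hqf
    rcases (hmem _ _).1 hq with hq | ⟨rfl, rfl⟩
    · obtain ⟨h1, h2⟩ := h.cl_at j q hq f k hqf
      exact ⟨hLL.at h1, h2.imp_left fun h3 => h3.trans_le (hle f j)⟩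
    · by_cases hf : f = f₀
      · subst hf
        have hk : k₀ = k := by
          have : (k₀ : ℕ∞) = k := by simpa [hq₀] using hqf
          exact_mod_cast this
        subst hk
        refine ⟨hAtf, ?_⟩
        rcases hx with ⟨-, -, h6, -⟩ | ⟨h6, rfl, -⟩
        · exact Or.inl h6
        · exact Or.inr ⟨rfl, by simp [hq₀, h6]⟩
      · simp [hq₀, hf] at hqf
  case cl_rcv =>
    intro j q hq f k hk hy
    have hy' := hgot f j k _ hk hy
    rcases (hmem _ _).1 hq with hqb | ⟨rfl, rfl⟩
    · by_cases hk' : k < got f j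
      · exact h.cl_rcv j q hqb f k hk' hy'
      · obtain ⟨rfl, rfl, rfl⟩ := hnew f j k hk hk'
        exact absurd (hy.key_eq hAtf) (hnb q hqb)
    -- All entries but one of the new quadruplet are `⊤`. This loses nothing: a FORWARD message
    -- about `x` received earlier would have made `i` forward `x` already.
    · by_cases hk' : k < got f j
      · obtain ⟨k', h1⟩ := h.rcv f j k _ hk' hy'
        exact absurd h1 (hfresh k')
      · obtain ⟨rfl, -, rfl⟩ := hnew f j k hk hk'
        simp [hq₀]
  case cl_own =>
    intro j q hq hqj
    rcases (hmem _ _).1 hq with hq | ⟨rfl, rfl⟩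
    · exact h.cl_own j q hq hqj
    · have hx1 : x.1 = j := hqj
      rcases hx with ⟨h6, -⟩ | ⟨h6, rfl, h7, -⟩
      · have := h6.at
        rw [hx1] at this
        exact absurd this (hfresh _)
      · simp [hq₀, h7, h6]
  case causal =>
    intro z m' k' y f k hz hk' hy hk
    rcases (hAt _ _ _).1 hk with h1 | ⟨rfl, rfl, rfl⟩
    · rcases hMsg _ _ hz with hz | ⟨h2, rfl, -⟩
      · rcases (hAt _ _ _).1 hy with hy | ⟨h2, rfl, -⟩
        · obtain ⟨k'', h3, h4⟩ := h.causal z m' k' y f k hz hk' hy h1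
          exact ⟨k'', h3, hLL.at h4⟩
        · have := hz.at.lt
          rw [h2] at this
          omega
      · obtain ⟨m'', h3⟩ := h.msg_of_at h1
        have := h3.at.lt
        simp [h2] at this
    · rcases hMsg _ _ hz with hz | ⟨h2, -⟩
      -- The forwarder `f₀` logged `y` ahead of `x`; FIFO reception means that `i` has received that
      -- earlier message, and hence has forwarded `y` before forwarding `x` now.
      · rcases hx with ⟨h6, h7, h8, h9, -⟩ | ⟨h6, -⟩
        · have hy' : At L x.1 k' y := (hLL.at_iff (hk'.trans hz.at.lt)).1 hy
          obtain ⟨k'', h3, h4⟩ := h.causal x m' k' y f₀ k₀ hz hk' hy' h7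
          obtain ⟨k3, h5⟩ := h.rcv f₀ f k'' y (h9 _ h3) h4
          exact ⟨k3, h5.lt, hLL.at h5⟩
        · have := hz.at.lt
          simp [h6] at this
      · simp only [h2] at hk' hy
        exact ⟨k', hk', hy⟩
  case del_log =>
    intro j y m' hy hd
    rw [hDel] at hd
    rcases hMsg _ _ hy with hy | ⟨h2, -⟩
    · obtain ⟨k, hk⟩ := h.del_log j y m' hy hd
      exact ⟨k, hLL.at hk⟩
    · have := h.clock j i
      simp [Del, h2, hlen] at hd
      exact absurd (hd.trans_lt this) (lt_irrefl _)
  case own =>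
    intro j hj q hq
    rcases (hmem _ _).1 hq with hq | ⟨rfl, rfl⟩
    · refine h.own j (fun hw => hj ?_) q hq
      by_cases hji : j = i
      · subst hji
        rcases hx with ⟨-, -, -, -, h6⟩ | ⟨-, -, -, h6, -⟩
        · simpa [hst, addQuad, ← h6] using hw
        · exact absurd hw h6
      · simpa [hst, hji] using hw
    · intro hx1
      have hx1 : x.1 = j := hx1
      rcases hx with ⟨h6, -⟩ | ⟨-, -, -, -, h6, -⟩
      · have := h6.at
        rw [hx1] at this
        exact absurd this (hfresh _)
      · exact hj (by simpa [hst, addQuad] using h6)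
  case clock =>
    intro j l
    have h1 : (st' j).clock = (st j).clock := by
      by_cases hj : j = i
      · subst hj; simp [hst, addQuad]
      · simp [hst, hj]
    have h2 : (st l).sn ≤ (st' l).sn := by
      by_cases hj : l = i
      · subst hj; simp [hst, addQuad]
      · simp [hst, hj]
    rw [h1]
    exact (h.clock j l).trans_le (by exact_mod_cast h2)
  case before =>
    intro j y m' z hy hd hnd'
    rw [hDel] at hd hnd'
    rcases hMsg _ _ hy with hy | ⟨h2, -⟩
    · exact hLL.maj (h.before j y m' z hy hd hnd')
    · have := h.clock j i
      simp [Del, h2, hlen] at hd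
      exact absurd (hd.trans_lt this) (lt_irrefl _)
  case wait =>
    intro s a c m₁ m₂ ha hc hac
    rw [hDel]
    rcases hMsg _ _ hc with hc' | ⟨h2, h3, -⟩
    · rcases hMsg _ _ ha with ha | ⟨h2, -⟩
      · obtain ⟨h3, h4⟩ := h.wait s a c m₁ m₂ ha hc' hac
        exact ⟨h3, hLL.maj h4⟩
      · obtain ⟨rfl, rfl⟩ := Prod.mk.inj h2
        have : c < (L s).length := hc'.at.lt
        omega
    · obtain ⟨rfl, rfl⟩ := Prod.mk.inj h2
      rcases hMsg _ _ ha with ha | ⟨h4, -⟩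
      · rcases hx with ⟨h6, -⟩ | ⟨-, -, -, h6, -⟩
        · rw [← h3] at h6
          exact absurd h6.at.lt (by simp)
        -- A process that invokes is not waiting, so none of its messages is left in its buffer: the
        -- older one is delivered. The new one is not, and `before` gives the majority.
        · have hd : Del st s (s, a) := by
            rcases h.cover s a (s, a) ha.at with ⟨q, hq, hqa⟩ | hd
            · exact absurd (congrArg Prod.fst hqa) (h.own s h6 q hq)
            · exact hd
          exact ⟨hd, hLL.maj (h.before s _ _ _ ha hd (h3 ▸ hnd))⟩
      · simp at h4
        omega

/-- The flag `waiting` may be cleared when no own message is in the buffer. -/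
theorem Inv.respond (h : Inv st L got) {i : Fin n} (hi : ∀ q ∈ (st i).buffer, q.sd ≠ i) :
    Inv (Function.update st i { st i with waiting := False }) L got := by
  set st' := Function.update st i { st i with waiting := False } with hst
  have h1 : ∀ j, (st' j).buffer = (st j).buffer := by
    intro j; by_cases hj : j = i
    · subst hj; simp [hst]
    · simp [hst, hj]
  have h2 : ∀ j, (st' j).sn = (st j).sn := by
    intro j; by_cases hj : j = i
    · subst hj; simp [hst]
    · simp [hst, hj]
  have h3 : ∀ j, (st' j).clock = (st j).clock := by
    intro j; by_cases hj : j = i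
    · subst hj; simp [hst]
    · simp [hst, hj]
  have h4 : ∀ j x, Del st' j x ↔ Del st j x := fun j x => by simp [Del, h3]
  constructor <;> try simp only [h1, h2, h3, h4]
  case len => exact h.len
  case form => exact h.form
  case inj => exact h.inj
  case cover => exact h.cover
  case got_le => exact h.got_le
  case rcv => exact h.rcv
  case buf => exact h.buf
  case uniq => exact h.uniq
  case cl_at => exact h.cl_at
  case cl_rcv => exact h.cl_rcv
  case cl_own => exact h.cl_own
  case causal => exact h.causal
  case del_log => exact h.del_log
  case own =>
    intro j hj
    by_cases hji : j = i
    · subst hji; exact hi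
    · exact h.own j (by simpa [hst, hji] using hj)
  case clock => exact h.clock
  case before => exact h.before
  case wait => exact h.wait

/-! ### Deliveries -/

open Classical in
theorem purge_subset (b T : Finset (Quad n M)) : purge b T ⊆ T := by
  induction T using Finset.strongInduction with
  | _ T ih =>
    rw [purge]
    split
    · rename_i hc
      exact (ih _ (Finset.erase_ssubset hc.choose_spec.1)).trans (Finset.erase_subset _ _)
    · exact subset_rfl

open Classical in
theorem purge_spec (b T : Finset (Quad n M)) :
    ∀ q ∈ purge b T, ∀ q' ∈ b, q' ∉ purge b T → ¬ NotMajorityBefore q q' := by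
  induction T using Finset.strongInduction with
  | _ T ih =>
    rw [purge]
    split
    · rename_i hc
      exact ih _ (Finset.erase_ssubset hc.choose_spec.1)
    · rename_i hc
      push Not at hc
      intro q hq q' hq' hqq
      exact hc q hq q' (by simp [hq', hqq])

-- The first element of a stable set `S` to be withdrawn would need a witness outside the current
-- `T`, hence outside `S`, which stability forbids. Together with `purge_spec`, this makes the
-- result of the loop the greatest stable subset of `T`, whatever choices the loop makes; liveness
-- relies on it.
open Classical in
theorem subset_purge {b T S : Finset (Quad n M)} (hST : S ⊆ T)
    (hS : ∀ q ∈ S, ∀ q' ∈ b, q' ∉ S → ¬ NotMajorityBefore q q') : S ⊆ purge b T := by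
  induction T using Finset.strongInduction with
  | _ T ih =>
    rw [purge]
    split
    · rename_i hc
      refine ih _ (Finset.erase_ssubset hc.choose_spec.1) fun q hq => ?_
      refine Finset.mem_erase.2 ⟨?_, hST hq⟩
      rintro rfl
      obtain ⟨q', hq', hqq⟩ := hc.choose_spec.2
      rw [Finset.mem_sdiff] at hq'
      exact hS _ hq q' hq'.1 (fun h => hq'.2 (hST h)) hqq
    · exact hST

open Classical in
theorem toDeliver_subset (b : Finset (Quad n M)) : toDeliver b ⊆ b :=
  (purge_subset _ _).trans (Finset.filter_subset _ _)

open Classical in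
theorem seenByMajority_of_mem {b : Finset (Quad n M)} {q} (hq : q ∈ toDeliver b) :
    Maj {f | q.cl f < ⊤} := (Finset.mem_filter.1 (purge_subset _ _ hq)).2

/-- If `y` is in the buffer, the loop provides a majority of entries on which `q` is ahead; if not,
the majority that has seen `q` serves, since FIFO reception shows that its members had not forwarded
`y` by then. Entries of received FORWARD messages tell the truth about the logs; only the process's
own entry, filled in before reception, needs care. -/
theorem Inv.before_of_toDeliver (h : Inv st L got) {i : Fin n} {q : Quad n M}
    (hq : q ∈ toDeliver (st i).buffer) {y : Fin n × ℕ} (hy : ¬ Del st i y)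
    (hyT : ∀ q' ∈ toDeliver (st i).buffer, q'.key ≠ y) : Maj {f | Before L q.key y f} := by
  classical
  have hqb := toDeliver_subset _ hq
  by_cases hyb : ∃ q' ∈ (st i).buffer, q'.key = y
  · obtain ⟨q', hq', rfl⟩ := hyb
    have hm : Maj {f | q.cl f < q'.cl f} := by
      have := purge_spec _ _ q hq q' hq' (fun h => hyT q' h rfl)
      unfold NotMajorityBefore at this
      unfold Maj
      omega
    -- The case where the comparison of entries could mislead: `q` is an own message whose FORWARD
    -- message is not back yet, and `i` forwarded `q'` earlier without having received that FORWARD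
    -- message of its own either, so that the entry of `q'` is still `⊤`.
    by_cases hbad : ∃ k, q.cl i = (k : ℕ) ∧ got i i ≤ k ∧ q'.cl i = ⊤ ∧ ∃ k' ≤ k, At L i k' q'.key
    · obtain ⟨k, hk, hgk, hqi, k', hk', hat⟩ := hbad
      obtain ⟨hatk, h1⟩ := h.cl_at i q hqb i k hk
      have hsd : q.sd = i := by
        rcases h1 with h1 | h1
        · omega
        · exact h1.2
      have hqs : q.sn = k := by
        have := h.cl_own i q hqb hsd
        rw [hk] at this
        exact_mod_cast this.symm
      have hne : k' ≠ k := by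
        rintro rfl
        have := hat.key_eq hatk
        have := h.uniq i q' hq' q hqb this
        subst this
        rw [hqi] at hk
        simp at hk
      -- By causality everybody forwards `q'` before `q`, because `i` did so before broadcasting
      -- `q`. For `f ≠ i` FIFO reception then gives `q'` the smaller entry, so `i` is the only
      -- process on which `q` seems to be ahead.
      have hsub : {f | q.cl f < q'.cl f} ⊆ {i} := by
        intro f hf
        by_contra hfi
        have hfi : f ≠ i := hfi
        obtain ⟨l, hl⟩ := ENat.ne_top_iff_exists.1 (hf.trans_le le_top).ne
        obtain ⟨h2, h3⟩ := h.cl_at i q hqb f l hl.symm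
        obtain ⟨l', hl', h4⟩ := h.causal q.key _ k' q'.key f l (h.buf i q hqb).2.1
          (by simp [Quad.key]; omega) (by simpa [Quad.key, hsd] using hat) h2
        have h5 : l < got f i := by
          rcases h3 with h3 | h3
          · exact h3
          · exact absurd h3.1 hfi
        have h6 := h.cl_rcv i q' hq' f l' (hl'.trans h5) h4
        have hf' : q.cl f < q'.cl f := hf
        rw [h6, ← hl] at hf'
        have : l < l' := by exact_mod_cast hf'
        omega
      have hcard := Set.ncard_le_ncard hsub (Set.toFinite _)
      rw [Set.ncard_singleton] at hcard
      -- A single process is a majority only here; but then `q'` is an own message too and its entry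
      -- is finite.
      have hn : n = 1 := by
        have := i.pos
        unfold Maj at hm
        omega
      subst hn
      have := h.cl_own i q' hq' (Subsingleton.elim _ _)
      rw [hqi] at this
      simp at this
    -- Outside the bad case, an earlier position of `q'` in the log of `f` is either received, hence
    -- recorded with a smaller entry, or own and already filled in.
    · refine hm.mono fun f hf => ?_
      have hf : q.cl f < q'.cl f := hf
      obtain ⟨k, hk⟩ := ENat.ne_top_iff_exists.1 (hf.trans_le le_top).ne
      obtain ⟨h1, h2⟩ := h.cl_at i q hqb f k hk.symm
      refine ⟨k, h1, fun k' hk' hat => ?_⟩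
      by_cases hg : k' < got f i
      · have h3 := h.cl_rcv i q' hq' f k' hg hat
        rw [h3, ← hk] at hf
        have : k < k' := by exact_mod_cast hf
        omega
      · have hfi : f = i := by
          rcases h2 with h2 | h2
          · omega
          · exact h2.1
        subst hfi
        refine hbad ⟨k, hk.symm, by omega, ?_, k', hk', hat⟩
        by_contra hne
        obtain ⟨l, hl⟩ := ENat.ne_top_iff_exists.1 hne
        obtain ⟨h3, -⟩ := h.cl_at f q' hq' f l hl.symm
        have := h.inj _ _ _ _ hat h3
        subst this
        rw [← hk, ← hl] at hf
        have : k < k' := by exact_mod_cast hf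
        omega
  -- Neither in the buffer nor delivered means never forwarded by `i`, hence never received in a
  -- FORWARD message.
  · have hno : ∀ k, ¬ At L i k y := by
      intro k hk
      rcases h.cover i k y hk with h1 | h1
      · exact hyb h1
      · exact hy h1
    refine (seenByMajority_of_mem hq).mono fun f hf => ?_
    obtain ⟨k, hk⟩ := ENat.ne_top_iff_exists.1 (ne_of_lt hf)
    obtain ⟨h1, h2⟩ := h.cl_at i q hqb f k hk.symm
    refine ⟨k, h1, fun k' hk' hat => ?_⟩
    rcases h2 with h2 | ⟨rfl, -⟩
    · obtain ⟨l, hl⟩ := h.rcv f i k' y (by omega) hat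
      exact hno l hl
    · exact hno _ hat

open Classical in
/-- The state after `tryDeliver`, if `T` is delivered. -/
noncomputable def delivered (s : LocalState n M) : LocalState n M :=
  { s with
    clock := fun j => s.clock j ⊔
      ((toDeliver s.buffer).filter fun q => q.sd = j).sup fun q => (q.sn : WithBot ℕ)
    buffer := s.buffer \ toDeliver s.buffer }

/-- Raising a clock entry to `q.sn` formally marks all smaller numbers of the sender as delivered.
For genuine messages this is harmless: an undelivered older one would be preceded by `q` on a
majority, whereas `wait` provides the opposite majority. -/
theorem Inv.del_delivered (h : Inv st L got) {i : Fin n} {x : Fin n × ℕ} {m : M}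
    (hx : IsMsg L x m) :
    (x.2 : WithBot ℕ) ≤ (delivered (st i)).clock x.1 ↔
      Del st i x ∨ ∃ q ∈ toDeliver (st i).buffer, q.key = x := by
  classical
  constructor
  · intro hd
    by_contra hcon
    push Not at hcon
    obtain ⟨hnd, hnT⟩ := hcon
    have hnd' : ¬ (x.2 : WithBot ℕ) ≤ (st i).clock x.1 := hnd
    simp only [delivered, le_sup_iff, hnd', false_or] at hd
    rw [Finset.le_sup_iff (WithBot.bot_lt_coe _)] at hd
    obtain ⟨q, hq, hle⟩ := hd
    rw [Finset.mem_filter] at hq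
    obtain ⟨hq, hqx⟩ := hq
    have hle : x.2 ≤ q.sn := by exact_mod_cast hle
    have hne : x.2 ≠ q.sn := by
      intro hne
      exact hnT q hq (Prod.ext hqx hne.symm)
    have hqm := (h.buf i q (toDeliver_subset _ hq)).2.1
    have hkey : q.key = (x.1, q.sn) := Prod.ext hqx rfl
    have h1 := h.before_of_toDeliver hq hnd hnT
    rw [hkey] at h1 hqm
    exact (h.wait x.1 x.2 q.sn _ _ hx hqm (by omega)).2.not_before h1
  · rintro (hd | ⟨q, hq, rfl⟩)
    · exact le_trans hd le_sup_left
    · refine le_trans ?_ le_sup_right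
      exact Finset.le_sup (f := fun q : Quad n M => (q.sn : WithBot ℕ))
        (Finset.mem_filter.2 ⟨hq, rfl⟩)

theorem Inv.deliver (h : Inv st L got) (i : Fin n) :
    Inv (Function.update st i (delivered (st i))) L got := by
  classical
  set st' := Function.update st i (delivered (st i)) with hst
  have hbuf : ∀ j, ∀ q ∈ (st' j).buffer, q ∈ (st j).buffer ∧
      (j = i → q ∉ toDeliver (st i).buffer) := by
    intro j q hq
    by_cases hj : j = i
    · subst hj
      simpa [hst, delivered] using hq
    · simpa [hst, hj] using hq
  have hsn : ∀ j, (st' j).sn = (st j).sn := by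
    intro j; by_cases hj : j = i
    · subst hj; simp [hst, delivered]
    · simp [hst, hj]
  have hw : ∀ j, (st' j).waiting = (st j).waiting := by
    intro j; by_cases hj : j = i
    · subst hj; simp [hst, delivered]
    · simp [hst, hj]
  have hdel : ∀ j x m, IsMsg L x m → (Del st' j x ↔ Del st j x ∨
      (j = i ∧ ∃ q ∈ toDeliver (st i).buffer, q.key = x)) := by
    intro j x m hx
    by_cases hj : j = i
    · subst hj
      simpa [Del, hst] using h.del_delivered hx
    · simp [Del, hst, hj]
  have hmono : ∀ j x, Del st j x → Del st' j x := by
    intro j x hx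
    by_cases hj : j = i
    · subst hj
      simp only [Del, hst, Function.update_self, delivered]
      exact le_trans hx le_sup_left
    · simpa [Del, hst, hj] using hx
  constructor
  case len => simpa [hsn] using h.len
  case form => exact h.form
  case inj => exact h.inj
  case cover =>
    intro j k x hx
    rcases h.cover j k x hx with ⟨q, hq, rfl⟩ | hd
    · by_cases hc : j = i ∧ q ∈ toDeliver (st i).buffer
      · exact Or.inr ((hdel j _ _ (h.buf j q hq).2.1).2 (Or.inr ⟨hc.1, q, hc.2, rfl⟩))
      · refine Or.inl ⟨q, ?_, rfl⟩
        by_cases hj : j = i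
        · subst hj
          simpa [hst, delivered, hq] using hc
        · simpa [hst, hj] using hq
    · exact Or.inr (hmono j x hd)
  case got_le => exact h.got_le
  case rcv => exact h.rcv
  case buf =>
    intro j q hq
    obtain ⟨hqb, hqT⟩ := hbuf j q hq
    obtain ⟨h1, h2, h3⟩ := h.buf j q hqb
    refine ⟨fun hd => ?_, h2, h3⟩
    rcases (hdel j _ _ h2).1 hd with hd | ⟨rfl, q', hq', hk⟩
    · exact h1 hd
    · have := h.uniq j q' (toDeliver_subset _ hq') q hqb hk
      subst this
      exact hqT rfl hq'
  case uniq => exact fun j q hq q' hq' => h.uniq j q (hbuf j q hq).1 q' (hbuf j q' hq').1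
  case cl_at => exact fun j q hq => h.cl_at j q (hbuf j q hq).1
  case cl_rcv => exact fun j q hq => h.cl_rcv j q (hbuf j q hq).1
  case cl_own => exact fun j q hq => h.cl_own j q (hbuf j q hq).1
  case causal => exact h.causal
  case del_log =>
    intro j x m hx hd
    rcases (hdel j x m hx).1 hd with hd | ⟨rfl, q, hq, rfl⟩
    · exact h.del_log j x m hx hd
    · exact (h.buf j q (toDeliver_subset _ hq)).2.2
  case own =>
    intro j hj q hq
    exact h.own j (by rwa [hw] at hj) q (hbuf j q hq).1
  case clock =>
    intro j l
    rw [hsn]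
    by_cases hj : j = i
    · subst hj
      simp only [hst, Function.update_self, delivered]
      refine max_lt (h.clock j l) ?_
      rw [Finset.sup_lt_iff (WithBot.bot_lt_coe _)]
      intro q hq
      rw [Finset.mem_filter] at hq
      obtain ⟨hq, rfl⟩ := hq
      have := (h.buf j q (toDeliver_subset _ hq)).2.1.at.lt
      rw [h.len] at this
      exact_mod_cast this
    · simpa [hst, hj] using h.clock j l
  case before =>
    intro j x m y hx hd hnd
    rcases (hdel j x m hx).1 hd with hd | ⟨rfl, q, hq, rfl⟩
    · exact h.before j x m y hx hd (fun hy => hnd (hmono j y hy))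
    · refine h.before_of_toDeliver hq (fun hy => hnd (hmono j y hy)) ?_
      rintro q' hq' rfl
      exact hnd ((hdel j _ _ (h.buf j q' (toDeliver_subset _ hq')).2.1).2 (Or.inr ⟨rfl, q', hq', rfl⟩))
  case wait =>
    intro s a c m₁ m₂ ha hc hac
    obtain ⟨h1, h2⟩ := h.wait s a c m₁ m₂ ha hc hac
    exact ⟨hmono _ _ h1, h2⟩

end SCD

/-! ## General facts on configurations -/

namespace Config

variable {n : ℕ} {In : Type w} {Resp : Type x} {Ind : Type y} {A : Algorithm.{v} n In Resp Ind}

theorem performed_prefix (c : Config A) (i : Fin n) (tr : Trigger n In) (cut : Option ℕ) :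
    c.performed i tr cut <+: (c.reaction i tr).2 := by
  cases cut with
  | none => exact List.prefix_rfl
  | some k => exact List.take_prefix _ _

theorem hist_prefix_after (c : Config A) (e : Event n In) : c.hist <+: (c.after e).hist := by
  cases e with
  | idle => exact List.prefix_rfl
  | step i tr cut =>
    simp only [after, List.append_assoc]
    exact List.prefix_append _ _

theorem sent_prefix_after (c : Config A) (e : Event n In) (a b : Fin n) :
    c.sent a b <+: (c.after e).sent a b := by
  cases e with
  | idle => exact List.prefix_rfl
  | step i tr cut =>
    simp only [after]
    split
    · exact List.prefix_append _ _
    · exact List.prefix_rfl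

theorem crashed_after (c : Config A) (e : Event n In) {i : Fin n} (h : c.crashed i) :
    (c.after e).crashed i := by
  cases e with
  | idle => exact h
  | step j tr cut => exact Or.inl h

theorem rcvd_subset_after (c : Config A) (e : Event n In) (a b : Fin n) :
    c.rcvd a b ⊆ (c.after e).rcvd a b := by
  cases e with
  | idle => exact subset_rfl
  | step j tr cut =>
    cases tr with
    | invoke _ => exact subset_rfl
    | internal => exact subset_rfl
    | receive src k =>
      simp only [after]
      split
      · exact Finset.subset_insert _ _
      · exact subset_rfl

theorem hist_prefix (ev : ℕ → Event n In) {τ τ' : ℕ} (h : τ ≤ τ') :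
    (configAt A ev τ).hist <+: (configAt A ev τ').hist := by
  induction h with
  | refl => exact List.prefix_rfl
  | step _ ih => exact ih.trans (hist_prefix_after _ _)

theorem sent_prefix (ev : ℕ → Event n In) {τ τ' : ℕ} (h : τ ≤ τ') (a b : Fin n) :
    (configAt A ev τ).sent a b <+: (configAt A ev τ').sent a b := by
  induction h with
  | refl => exact List.prefix_rfl
  | step _ ih => exact ih.trans (sent_prefix_after _ _ _ _)

theorem crashed_mono (ev : ℕ → Event n In) {τ τ' : ℕ} (h : τ ≤ τ') {i : Fin n}
    (hc : (configAt A ev τ).crashed i) : (configAt A ev τ').crashed i := by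
  induction h with
  | refl => exact hc
  | step _ ih => exact crashed_after _ _ ih

theorem rcvd_mono (ev : ℕ → Event n In) {τ τ' : ℕ} (h : τ ≤ τ') (a b : Fin n) :
    (configAt A ev τ).rcvd a b ⊆ (configAt A ev τ').rcvd a b := by
  induction h with
  | refl => exact subset_rfl
  | step _ ih => exact ih.trans (rcvd_subset_after _ _ _ _)

end Config

theorem historyOf_of_hist {n : ℕ} {In : Type w} {Resp : Type x} {Ind : Type y}
    {A : Algorithm.{v} n In Resp Ind} {ev : ℕ → Event n In} {τ p : ℕ}
    {e : HistEvent n In Resp Ind} (h : (Config.configAt A ev τ).hist[p]? = some e) :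
    historyOf A ev p e := ⟨τ, h⟩

theorem hist_of_historyOf {n : ℕ} {In : Type w} {Resp : Type x} {Ind : Type y}
    {A : Algorithm.{v} n In Resp Ind} {ev : ℕ → Event n In} {τ p : ℕ}
    {e : HistEvent n In Resp Ind} (h : historyOf A ev p e)
    (hp : p < (Config.configAt A ev τ).hist.length) :
    (Config.configAt A ev τ).hist[p]? = some e := by
  obtain ⟨τ', h⟩ := h
  rcases le_total τ τ' with hτ | hτ
  · have h1 := SCD.getElem?_of_prefix (Config.hist_prefix (A := A) ev hτ)
      (List.getElem?_eq_getElem hp)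
    rw [h] at h1
    rw [List.getElem?_eq_getElem hp, h1]
  · exact SCD.getElem?_of_prefix (Config.hist_prefix (A := A) ev hτ) h

/-! ### From configurations to transitions of local states, logs and counters -/

namespace SCD

variable {n : ℕ} {M : Type u}
variable {st : Fin n → LocalState n M} {L : Fin n → List (Forward n M)} {got : Fin n → Fin n → ℕ}

open Classical in
/-- The SCD-broadcast algorithm, as a reducible definition. -/
noncomputable abbrev algo (n : ℕ) (M : Type u) : Algorithm.{u} n M Unit (Set M) where
  State := LocalState n M
  Msg := Forward n M
  start := fun _ => { buffer := ∅, sn := 0, clock := fun _ => ⊥, waiting := False }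
  onInvoke := fun i m s =>
    forward i { m := m, sd := i, snsd := s.sn, f := i, snf := s.sn } { s with waiting := True }
  onReceive := fun i _ msg s =>
    ((tryDeliver (forward i msg s).1).1, (forward i msg s).2 ++ (tryDeliver (forward i msg s).1).2)
  onInternal := fun i s =>
    if s.waiting ∧ ¬ ∃ q ∈ s.buffer, q.sd = i then
      ({ s with waiting := False }, [Instr.respond ()])
    else (s, [])

theorem algorithm_eq (n : ℕ) (M : Type u) : algorithm n M = algo n M := rfl

/-- `List.finRange n` contains every destination exactly once. Hence a process sends the same
sequence to all, and a single log per process records its channels. -/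
theorem filterMap_sendTo_broadcast (msg : Forward n M) (j : Fin n) :
    (broadcast msg).filterMap (Instr.sendTo j) = [msg] := by
  have h : ∀ l : List (Fin n), l.filterMap
      (fun d => (Instr.send d msg : Act n M).sendTo j) = List.replicate (l.count j) msg := by
    intro l
    induction l with
    | nil => rfl
    | cons d l ih =>
      simp only [Instr.sendTo] at ih ⊢
      by_cases hd : d = j
      · subst hd; simp [ih, List.replicate_succ]
      · simp [hd, ih]
  unfold broadcast
  rw [List.filterMap_map]
  refine (h _).trans ?_
  rw [List.count_eq_one_of_mem (List.nodup_finRange n) (List.mem_finRange j)]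
  rfl

theorem visible_broadcast (msg : Forward n M) (i : Fin n) :
    ∀ a ∈ broadcast msg, Instr.visible M i a = none := by
  intro a ha
  unfold broadcast at ha
  obtain ⟨j, -, rfl⟩ := List.mem_map.1 ha
  rfl

open Classical in
theorem forward_cases (i : Fin n) (w : Forward n M) (s : LocalState n M) :
    ((w.snsd : WithBot ℕ) ≤ s.clock w.sd ∧ forward i w s = (s, [])) ∨
    (¬ (w.snsd : WithBot ℕ) ≤ s.clock w.sd ∧ (∃ q ∈ s.buffer, q.key = (w.sd, w.snsd)) ∧
      forward i w s = ({ s with buffer := s.buffer.image (mark w) }, [])) ∨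
    (¬ (w.snsd : WithBot ℕ) ≤ s.clock w.sd ∧ (∀ q ∈ s.buffer, q.key ≠ (w.sd, w.snsd)) ∧
      forward i w s = (addQuad s ⟨w.m, w.sd, w.snsd,
        Function.update (fun _ => ⊤) w.f (w.snf : ℕ∞)⟩ s.waiting,
        broadcast ⟨w.m, w.sd, w.snsd, i, s.sn⟩)) := by
  by_cases h1 : s.clock w.sd < (w.snsd : WithBot ℕ)
  · by_cases h2 : ∃ q ∈ s.buffer, q.sd = w.sd ∧ q.sn = w.snsd
    · refine Or.inr (Or.inl ⟨not_le.2 h1, ?_, ?_⟩)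
      · simpa [Quad.key] using h2
      · rw [forward, if_pos h1, if_pos h2]
        rfl
    · refine Or.inr (Or.inr ⟨not_le.2 h1, ?_, ?_⟩)
      · simpa [Quad.key] using h2
      · rw [forward, if_pos h1, if_neg h2]
        rfl
  · exact Or.inl ⟨not_lt.1 h1, by rw [forward, if_neg h1]⟩

/-- Local states after the procedure `forward`. -/
noncomputable def fwdState (st : Fin n → LocalState n M) (i : Fin n) (w : Forward n M) :
    Fin n → LocalState n M :=
  Function.update st i (forward i w (st i)).1

/-- Logs after the procedure `forward`. -/
noncomputable def fwdLog (st : Fin n → LocalState n M) (L : Fin n → List (Forward n M)) (i : Fin n)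
    (w : Forward n M) : Fin n → List (Forward n M) :=
  Function.update L i (L i ++ (forward i w (st i)).2.filterMap (Instr.sendTo i))

theorem Inv.forward (h : Inv st L got) {src i w} (hw : (L src)[got src i]? = some w) :
    Inv (fwdState st i w) (fwdLog st L i w) (bump got src i) := by
  obtain ⟨hwf, hwk, hwm⟩ := h.form _ _ _ hw
  unfold fwdState fwdLog
  rcases forward_cases i w (st i) with ⟨h1, h2⟩ | ⟨h1, h2, h3⟩ | ⟨h1, h2, h3⟩
  · simpa [h2] using h.skip hw h1
  · simpa [h3, setBuf] using h.mark hw h2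
  · rw [h3]
    simp only [filterMap_sendTo_broadcast]
    rw [hwf, hwk]
    refine h.add (x := (w.sd, w.snsd)) (b := (st i).waiting) h1 h2 ?_ ?_ ?_
      (Or.inl ⟨hwm, ⟨w, hw, rfl⟩, by simp [bump], fun _ => id, Iff.rfl⟩)
    · intro f j; unfold bump; split <;> omega
    · intro f j
      have := h.got_le f j
      have := (List.getElem?_eq_some_iff.1 hw).1
      unfold bump
      split <;> grind
    · intro f j k hk hk'
      unfold bump at hk; split at hk <;> grind

theorem fwdState_clock (st : Fin n → LocalState n M) (i : Fin n) (w : Forward n M) (j : Fin n) :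
    (fwdState st i w j).clock = (st j).clock := by
  by_cases hj : j = i
  · subst hj
    rcases forward_cases j w (st j) with ⟨h1, h2⟩ | ⟨h1, h2, h3⟩ | ⟨h1, h2, h3⟩
    · simp [fwdState, h2]
    · simp [fwdState, h3]
    · simp [fwdState, h3, addQuad]
  · simp [fwdState, hj]

theorem fwdState_waiting (st : Fin n → LocalState n M) (i : Fin n) (w : Forward n M) (j : Fin n) :
    (fwdState st i w j).waiting = (st j).waiting := by
  by_cases hj : j = i
  · subst hj
    rcases forward_cases j w (st j) with ⟨h1, h2⟩ | ⟨h1, h2, h3⟩ | ⟨h1, h2, h3⟩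
    · simp [fwdState, h2]
    · simp [fwdState, h3]
    · simp [fwdState, h3, addQuad]
  · simp [fwdState, hj]

/-- Delivering the empty set changes nothing in the state, so the case distinction matters only for
the indication. -/
theorem tryDeliver_fst (s : LocalState n M) : (tryDeliver s).1 = delivered s := by
  unfold tryDeliver
  split
  · rfl
  · rename_i h
    rw [Finset.not_nonempty_iff_eq_empty] at h
    simp [delivered, h]

/-- Local states after an invocation. -/
noncomputable def invState (st : Fin n → LocalState n M) (i : Fin n) (m : M) :
    Fin n → LocalState n M :=
  Function.update st i (addQuad (st i)
    ⟨m, i, (st i).sn, Function.update (fun _ => ⊤) i ((st i).sn : ℕ∞)⟩ True)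

/-- Logs after an invocation. -/
def invLog (st : Fin n → LocalState n M) (L : Fin n → List (Forward n M)) (i : Fin n) (m : M) :
    Fin n → List (Forward n M) :=
  Function.update L i (L i ++ [⟨m, i, (st i).sn, i, (st i).sn⟩])

theorem Inv.fresh (h : Inv st L got) (i j : Fin n) : ¬ Del st j (i, (st i).sn) :=
  not_le.2 (h.clock j i)

theorem Inv.fresh_buffer (h : Inv st L got) (i j : Fin n) :
    ∀ q ∈ (st j).buffer, q.key ≠ (i, (st i).sn) := by
  intro q hq hk
  have := (h.buf j q hq).2.1.at.lt
  rw [hk, h.len] at this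
  exact lt_irrefl _ this

theorem Inv.invoke (h : Inv st L got) {i : Fin n} (hi : ¬ (st i).waiting) (m : M) :
    Inv (invState st i m) (invLog st L i m) got :=
  h.add (x := (i, (st i).sn)) (f₀ := i) (k₀ := (st i).sn) (h.fresh i i) (h.fresh_buffer i i)
    (fun _ _ => le_rfl) h.got_le (fun _ _ _ hk hk' => absurd hk hk')
    (Or.inr ⟨by rw [h.len], rfl, by rw [h.len], hi, trivial, rfl⟩)

/-- The transitions of the algorithm, seen through local states, logs and counters. The last
argument lists the visible events. -/
inductive Step (st : Fin n → LocalState n M) (L : Fin n → List (Forward n M))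
    (got : Fin n → Fin n → ℕ) : Event n M → (Fin n → LocalState n M) →
    (Fin n → List (Forward n M)) → (Fin n → Fin n → ℕ) →
    List (HistEvent n M Unit (Set M)) → Prop
  | idle : Step st L got Event.idle st L got []
  | invoke (i : Fin n) (m : M) (cut : Option ℕ) (hw : ¬ (st i).waiting) :
      Step st L got (Event.step i (Trigger.invoke m) cut) (invState st i m) (invLog st L i m) got
        [HistEvent.inv i m]
  | silent (i src : Fin n) (cut : Option ℕ) (w : Forward n M)
      (hw : (L src)[got src i]? = some w)
      (hc : cut = none → ¬ (toDeliver (fwdState st i w i).buffer).Nonempty) :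
      Step st L got (Event.step i (Trigger.receive src (got src i)) cut)
        (Function.update (fwdState st i w) i (delivered (fwdState st i w i))) (fwdLog st L i w)
        (bump got src i) []
  | deliver (i src : Fin n) (cut : Option ℕ) (w : Forward n M)
      (hw : (L src)[got src i]? = some w)
      (hc : (toDeliver (fwdState st i w i).buffer).Nonempty) :
      Step st L got (Event.step i (Trigger.receive src (got src i)) cut)
        (Function.update (fwdState st i w) i (delivered (fwdState st i w i))) (fwdLog st L i w)
        (bump got src i)
        [HistEvent.ind i {m | ∃ q ∈ toDeliver (fwdState st i w i).buffer, q.m = m}]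
  | respond (i : Fin n) (cut : Option ℕ) (evs : List (HistEvent n M Unit (Set M)))
      (hw : (st i).waiting) (ho : ∀ q ∈ (st i).buffer, q.sd ≠ i)
      (hc : evs = [HistEvent.res i ()] ∨ cut ≠ none ∧ evs = []) :
      Step st L got (Event.step i Trigger.internal cut)
        (Function.update st i { st i with waiting := False }) L got evs
  | pass (i : Fin n) (cut : Option ℕ) (hw : ¬ ((st i).waiting ∧ ∀ q ∈ (st i).buffer, q.sd ≠ i)) :
      Step st L got (Event.step i Trigger.internal cut) st L got []

theorem Step.inv {e st' L' got' evs} (hs : Step st L got e st' L' got' evs) (h : Inv st L got) :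
    Inv st' L' got' := by
  cases hs with
  | idle => exact h
  | invoke i m cut hw => exact h.invoke hw m
  | silent i src cut w hw hc => exact (h.forward hw).deliver i
  | deliver i src cut w hw hc => exact (h.forward hw).deliver i
  | respond i cut evs hw ho hc => exact h.respond ho
  | pass i cut hw => exact h

/-- The logs after an event; the reaction during which a process crashes counts as completed. -/
noncomputable def nextLog (c : Config (algo n M)) (L : Fin n → List (Forward n M)) :
    Event n M → Fin n → List (Forward n M)
  | Event.idle => L
  | Event.step i tr _ => Function.update L i (L i ++
      ((c.reaction i tr).2.filterMap (Instr.sendTo i) : List (Forward n M)))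

/-- The logs of all FORWARD messages broadcast during a run. -/
noncomputable def logAt (ev : ℕ → Event n M) : ℕ → Fin n → List (Forward n M)
  | 0 => fun _ => []
  | τ + 1 => nextLog (Config.configAt (algo n M) ev τ) (logAt ev τ) (ev τ)

/-- The local states during a run. -/
noncomputable abbrev stAt (ev : ℕ → Event n M) (τ : ℕ) : Fin n → LocalState n M :=
  (Config.configAt (algo n M) ev τ).state

/-- The numbers of messages received during a run. -/
noncomputable def gotAt (ev : ℕ → Event n M) (τ : ℕ) (a b : Fin n) : ℕ :=
  ((Config.configAt (algo n M) ev τ).rcvd a b).card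

/-- The relation between configurations and logs. -/
structure Tied (c : Config (algo n M)) (L : Fin n → List (Forward n M)) : Prop where
  inv : Inv c.state L (fun a b => (c.rcvd a b).card)
  rcvd : ∀ a b, c.rcvd a b = Finset.range (c.rcvd a b).card
  -- The log may be strictly longer than the channel for a crashed process: an interrupted reaction
  -- is logged entirely. No other process can observe the missing part.
  sent_prefix : ∀ a b, c.sent a b <+: L a
  sent_eq : ∀ a b, ¬ c.crashed a → c.sent a b = L a
  pending : ∀ a, ¬ c.crashed a → (c.pending a ↔ (c.state a).waiting)

theorem forward_sends (i : Fin n) (w : Forward n M) (s : LocalState n M) (a b : Fin n) :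
    (forward i w s).2.filterMap (Instr.sendTo a) =
      (forward i w s).2.filterMap (Instr.sendTo b) := by
  rcases forward_cases i w s with ⟨h1, h2⟩ | ⟨h1, h2, h3⟩ | ⟨h1, h2, h3⟩
  · simp [h2]
  · simp [h3]
  · rw [h3]
    simp only [filterMap_sendTo_broadcast]

theorem forward_visible (i : Fin n) (w : Forward n M) (s : LocalState n M) (j : Fin n) :
    ∀ a ∈ (forward i w s).2, Instr.visible M j a = none := by
  rcases forward_cases i w s with ⟨h1, h2⟩ | ⟨h1, h2, h3⟩ | ⟨h1, h2, h3⟩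
  · simp [h2]
  · simp [h3]
  · rw [h3]
    exact visible_broadcast _ _

theorem forward_respond (i : Fin n) (w : Forward n M) (s : LocalState n M) :
    ∀ r, Instr.respond r ∉ (forward i w s).2 := fun r hr => by
  simpa [Instr.visible] using forward_visible i w s i _ hr

theorem tryDeliver_sends (s : LocalState n M) (a : Fin n) :
    (tryDeliver s).2.filterMap (Instr.sendTo a) = [] := by
  unfold tryDeliver
  split <;> simp [Instr.sendTo]

variable {c : Config (algo n M)}

/-- On FIFO channels the received positions form an initial segment, so their number is the position
of the next message. -/
theorem Tied.receive_index (h : Tied c L) {i src : Fin n} {k : ℕ} {cut : Option ℕ}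
    (he : c.Enabled Channels.fifo (Event.step i (Trigger.receive src k) cut)) :
    k = (c.rcvd src i).card ∧ ∃ w, (c.sent src i)[k]? = some w ∧ (L src)[k]? = some w := by
  obtain ⟨-, h1, h2, h3⟩ := he
  rw [h.rcvd] at h2
  have hk : k = (c.rcvd src i).card := by
    rcases lt_trichotomy k (c.rcvd src i).card with hk | hk | hk
    · exact absurd (Finset.mem_range.2 hk) h2
    · exact hk
    · have := h3 rfl _ hk
      rw [h.rcvd] at this
      simp at this
  exact ⟨hk, _, List.getElem?_eq_getElem h1,
    getElem?_of_prefix (h.sent_prefix src i) (List.getElem?_eq_getElem h1)⟩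

theorem reaction_sends (c : Config (algo n M)) (i : Fin n) (tr : Trigger n M) (a b : Fin n) :
    (c.reaction i tr).2.filterMap (Instr.sendTo a) =
      (c.reaction i tr).2.filterMap (Instr.sendTo b) := by
  cases tr with
  | invoke m => exact forward_sends _ _ _ _ _
  | receive src k =>
    simp only [Config.reaction]
    cases hk : (c.sent src i)[k]? with
    | none => rfl
    | some w =>
      simp only [List.filterMap_append, tryDeliver_sends, List.append_nil]
      exact forward_sends _ _ _ _ _
  | internal =>
    simp only [Config.reaction]
    split <;> simp [Instr.sendTo]

theorem Tied.forward_invoke (h : Tied c L) (i : Fin n) (m : M) :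
    c.reaction i (Trigger.invoke m) =
      (invState c.state i m i,
        broadcast ⟨m, i, (c.state i).sn, i, (c.state i).sn⟩) := by
  have h1 := h.inv.fresh i i
  have h2 := h.inv.fresh_buffer i i
  simp only [Config.reaction, invState, Function.update_self]
  rcases forward_cases i ⟨m, i, (c.state i).sn, i, (c.state i).sn⟩
    ({ c.state i with waiting := True } : LocalState n M) with ⟨h3, -⟩ | ⟨-, h3, -⟩ | ⟨-, -, h3⟩
  · exact absurd h3 h1
  · obtain ⟨q, hq, hk⟩ := h3
    exact absurd hk (h2 q hq)
  · exact h3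

theorem Tied.after_sent (h : Tied c L) {i : Fin n} {tr : Trigger n M} {cut : Option ℕ}
    (hi : ¬ c.crashed i) (a b : Fin n) :
    (c.after (Event.step i tr cut)).sent a b <+: nextLog c L (Event.step i tr cut) a ∧
      (¬ (c.after (Event.step i tr cut)).crashed a →
        (c.after (Event.step i tr cut)).sent a b = nextLog c L (Event.step i tr cut) a) := by
  by_cases ha : a = i
  · subst ha
    simp only [Config.after, nextLog, Function.update_self, if_true, h.sent_eq a b hi]
    rw [← reaction_sends c a tr b a]
    refine ⟨List.prefix_append_right_inj _ |>.2 ((c.performed_prefix a tr cut).filterMap _), ?_⟩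
    intro hc
    cases cut with
    | none => rfl
    | some k => exact absurd (Or.inr ⟨trivial, rfl⟩) hc
  · simp only [Config.after, nextLog, ha, if_false, Function.update_of_ne ha]
    exact ⟨h.sent_prefix a b, fun hc => h.sent_eq a b (fun h' => hc (Or.inl h'))⟩

theorem Tied.after_pending (h : Tied c L) {i : Fin n} {tr : Trigger n M} {cut : Option ℕ}
    (hst : ∀ j, j ≠ i → (c.after (Event.step i tr cut)).state j = c.state j)
    (hp : cut = none → (((c.pending i ∨ ∃ a, tr = Trigger.invoke a) ∧
      ∀ r, Instr.respond r ∉ (c.reaction i tr).2) ↔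
        (((c.after (Event.step i tr cut)).state i)).waiting)) (a : Fin n)
    (ha : ¬ (c.after (Event.step i tr cut)).crashed a) :
    (c.after (Event.step i tr cut)).pending a ↔
      ((c.after (Event.step i tr cut)).state a).waiting := by
  by_cases hai : a = i
  · subst hai
    have hcut : cut = none := by
      cases cut with
      | none => rfl
      | some k => exact absurd (Or.inr ⟨rfl, rfl⟩) ha
    rw [← hp hcut]
    subst hcut
    simp [Config.after, Config.performed]
  · rw [hst a hai, ← h.pending a (fun h' => ha (Or.inl h'))]
    simp [Config.after, hai]

/-- Every event of a run is a transition in the sense of `Step`. -/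
theorem Tied.after (h : Tied c L) {e : Event n M} (he : c.Enabled Channels.fifo e) :
    Tied (c.after e) (nextLog c L e) ∧
      ∃ evs, (c.after e).hist = c.hist ++ evs ∧
        Step c.state L (fun a b => (c.rcvd a b).card) e (c.after e).state (nextLog c L e)
          (fun a b => ((c.after e).rcvd a b).card) evs := by
  suffices hs : (∃ evs, (c.after e).hist = c.hist ++ evs ∧
        Step c.state L (fun a b => (c.rcvd a b).card) e (c.after e).state (nextLog c L e)
          (fun a b => ((c.after e).rcvd a b).card) evs) ∧
      (∀ a b, (c.after e).rcvd a b = Finset.range ((c.after e).rcvd a b).card) ∧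
      (∀ a, ¬ (c.after e).crashed a → ((c.after e).pending a ↔ ((c.after e).state a).waiting)) by
    obtain ⟨⟨evs, h1, h2⟩, h3, h4⟩ := hs
    refine ⟨⟨h2.inv h.inv, h3, ?_, ?_, h4⟩, evs, h1, h2⟩
    · intro a b
      cases e with
      | idle => exact h.sent_prefix a b
      | step i tr cut => exact (h.after_sent he.1 a b).1
    · intro a b ha
      cases e with
      | idle => exact h.sent_eq a b ha
      | step i tr cut => exact (h.after_sent he.1 a b).2 ha
  cases e with
  | idle => exact ⟨⟨[], by simp [Config.after], Step.idle⟩, h.rcvd, h.pending⟩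
  | step i tr cut =>
    have hstate : (c.after (Event.step i tr cut)).state =
      Function.update c.state i (c.reaction i tr).1 := rfl
    cases tr with
    | invoke m =>
      have hr := h.forward_invoke i m
      have hst : Function.update c.state i (c.reaction i (Trigger.invoke m)).1 =
          invState c.state i m := by
        rw [hr]; simp [invState]
      have hlog : nextLog c L (Event.step i (Trigger.invoke m) cut) = invLog c.state L i m := by
        simp only [nextLog, hr, invLog, filterMap_sendTo_broadcast]
      have hw : ¬ (c.state i).waiting := by
        rw [← h.pending i he.1]
        exact he.2
      refine ⟨⟨[HistEvent.inv i m], ?_, ?_⟩, h.rcvd, ?_⟩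
      · simp only [Config.after]
        rw [List.filterMap_eq_nil_iff.2, List.append_nil]
        intro a ha
        have := (c.performed_prefix i _ cut).subset ha
        rw [hr] at this
        exact visible_broadcast _ _ a this
      · rw [hstate, hst, hlog]
        exact Step.invoke i m cut hw
      · refine h.after_pending (fun j hj => by simp [hstate, hj]) fun _ => ?_
        rw [hstate, hst, hr]
        simp only [invState, addQuad, Function.update_self, iff_true]
        refine ⟨Or.inr ⟨m, rfl⟩, fun r hr => ?_⟩
        simpa [Instr.visible] using visible_broadcast _ i _ hr
    | internal =>
      by_cases hc : (c.state i).waiting ∧ ∀ q ∈ (c.state i).buffer, q.sd ≠ i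
      · have hr : c.reaction i Trigger.internal =
            (({ c.state i with waiting := False } : LocalState n M), [Instr.respond ()]) := by
          simp only [Config.reaction]
          rw [if_pos]
          simpa using hc
        have hlog : nextLog c L (Event.step i Trigger.internal cut) = L := by
          simp [nextLog, hr, Instr.sendTo]
        refine ⟨⟨(c.performed i Trigger.internal cut).filterMap (Instr.visible M i), ?_, ?_⟩,
          h.rcvd, ?_⟩
        · simp [Config.after]
        · rw [hstate, hr, hlog]
          refine Step.respond i cut _ hc.1 hc.2 ?_
          unfold Config.performed
          rw [hr]
          cases cut with
          | none => exact Or.inl rfl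
          | some k =>
            cases k with
            | zero => exact Or.inr ⟨by simp, rfl⟩
            -- The reaction has a single action, so a crash after at least one action still emits
            -- the response.
            | succ k => exact Or.inl (by simp [Instr.visible])
        · refine h.after_pending (fun j hj => by simp [hstate, hj]) fun _ => ?_
          rw [hstate, hr]
          simp
      · have hr : c.reaction i Trigger.internal = (c.state i, []) := by
          simp only [Config.reaction]
          rw [if_neg]
          simpa using hc
        have hlog : nextLog c L (Event.step i Trigger.internal cut) = L := by
          simp [nextLog, hr]
        have hperf : c.performed i Trigger.internal cut = [] := by
          have := c.performed_prefix i Trigger.internal cut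
          rw [hr] at this
          exact List.prefix_nil.1 this
        refine ⟨⟨[], ?_, ?_⟩, h.rcvd, ?_⟩
        · simp [Config.after, hperf]
        · rw [hstate, hr, hlog, Function.update_eq_self]
          exact Step.pass i cut hc
        · refine h.after_pending (fun j hj => by simp [hstate, hj]) fun hcut => ?_
          have hi : ¬ c.crashed i := he.1
          rw [hstate, hr]
          simp [h.pending i hi]
    | receive src k =>
      obtain ⟨rfl, w, hw, hwL⟩ := h.receive_index he
      set k := (c.rcvd src i).card with hk
      have hr : c.reaction i (Trigger.receive src k) =
          (delivered (fwdState c.state i w i), (SCD.forward i w (c.state i)).2 ++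
            (tryDeliver (fwdState c.state i w i)).2) := by
        simp only [Config.reaction]
        rw [hw, ← tryDeliver_fst]
        simp only [fwdState, Function.update_self]
      have hst : Function.update c.state i (c.reaction i (Trigger.receive src k)).1 =
          Function.update (fwdState c.state i w) i (delivered (fwdState c.state i w i)) := by
        rw [hr]; simp [fwdState]
      have hlog : nextLog c L (Event.step i (Trigger.receive src k) cut) =
          fwdLog c.state L i w := by
        simp only [nextLog, hr, fwdLog, List.filterMap_append]
        simp only [tryDeliver_sends, List.append_nil]
      have hrc : ∀ a b, (c.after (Event.step i (Trigger.receive src k) cut)).rcvd a b =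
          Finset.range (bump (fun a b => (c.rcvd a b).card) src i a b) := by
        intro a b
        simp only [Config.after, bump]
        split
        · rename_i hab
          obtain ⟨rfl, rfl⟩ := hab
          rw [Finset.range_add_one, ← h.rcvd]
        · exact h.rcvd a b
      have hgot : (fun a b => ((c.after (Event.step i (Trigger.receive src k) cut)).rcvd a b).card) =
          bump (fun a b => (c.rcvd a b).card) src i := by
        funext a b
        rw [hrc, Finset.card_range]
      have hhist : (c.after (Event.step i (Trigger.receive src k) cut)).hist =
          c.hist ++ (c.performed i (Trigger.receive src k) cut).filterMap (Instr.visible M i) := by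
        simp [Config.after]
      have hvis : ∀ l, l <+: (SCD.forward i w (c.state i)).2 →
          l.filterMap (Instr.visible M i) = [] := fun l hl =>
        List.filterMap_eq_nil_iff.2 fun a ha => forward_visible _ _ _ _ a (hl.subset ha)
      refine ⟨?_, fun a b => by rw [hrc, Finset.card_range], ?_⟩
      · rw [hhist, hstate, hst, hlog, hgot]
        by_cases hT : (toDeliver (fwdState c.state i w i).buffer).Nonempty
        · have htd : (tryDeliver (fwdState c.state i w i)).2 =
              [Instr.indicate {m | ∃ q ∈ toDeliver (fwdState c.state i w i).buffer, q.m = m}] := by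
            rw [tryDeliver, if_pos hT]
          rw [htd] at hr
          have hpp := c.performed_prefix i (Trigger.receive src k) cut
          rw [hr] at hpp
          -- The indication is the last action: a crash either leaves the reaction complete or
          -- suppresses the indication, in which case only invisible actions were performed.
          rcases List.prefix_concat_iff.1 hpp with hp | hp
          · refine ⟨_, rfl, ?_⟩
            rw [hp, List.filterMap_append, hvis _ List.prefix_rfl]
            exact Step.deliver i src cut w hwL hT
          · refine ⟨_, rfl, ?_⟩
            rw [hvis _ hp]
            refine Step.silent i src cut w hwL ?_
            rintro rfl
            simp only [Config.performed, hr] at hp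
            simpa using hp.length_le
        · refine ⟨[], ?_, Step.silent i src cut w hwL fun _ => hT⟩
          rw [hvis]
          have := c.performed_prefix i (Trigger.receive src k) cut
          rw [hr, tryDeliver, if_neg hT, List.append_nil] at this
          exact this
      · refine h.after_pending (fun j hj => by simp [hstate, hj]) fun hcut => ?_
        have hi : ¬ c.crashed i := he.1
        rw [hstate, hst, hr]
        have hr' : ∀ r, Instr.respond r ∉ (tryDeliver (fwdState c.state i w i)).2 := by
          intro r
          unfold tryDeliver
          split <;> simp
        simp [forward_respond, hr', delivered, fwdState_waiting, h.pending i hi]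

/-- The relation between configurations and logs holds during all runs. -/
theorem tied {ev : ℕ → Event n M}
    (he : ∀ τ, (Config.configAt (algo n M) ev τ).Enabled Channels.fifo (ev τ)) (τ : ℕ) :
    Tied (Config.configAt (algo n M) ev τ) (logAt ev τ) := by
  induction τ with
  | zero =>
    refine ⟨inv_initial, fun _ _ => rfl, fun _ _ => List.prefix_rfl, fun _ _ _ => rfl, ?_⟩
    intro a _
    exact Iff.rfl
  | succ τ ih => exact (ih.after (he τ)).1

end SCD

namespace SCD

variable {n : ℕ} {M : Type u}
variable {st st' : Fin n → LocalState n M} {L L' : Fin n → List (Forward n M)}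
  {got got' : Fin n → Fin n → ℕ} {e : Event n M} {evs : List (HistEvent n M Unit (Set M))}

/-! ### Properties of transitions -/

theorem Step.logLE (hs : Step st L got e st' L' got' evs) : LogLE L L' := by
  cases hs with
  | idle => exact fun _ => List.prefix_rfl
  | invoke i m cut hw => exact logLE_append _ _ _
  | silent i src cut w hw hc => exact logLE_append _ _ _
  | deliver i src cut w hw hc => exact logLE_append _ _ _
  | respond i cut evs hw ho hc => exact fun _ => List.prefix_rfl
  | pass i cut hw => exact fun _ => List.prefix_rfl

/-- A message to be forwarded already has its position in its sender's log, so the fresh position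
appended by `forward` cannot be its original broadcast. -/
theorem Inv.isMsg_fwdLog (h : Inv st L got) {src i w} (hw : (L src)[got src i]? = some w) {x m} :
    IsMsg (fwdLog st L i w) x m → IsMsg L x m := by
  intro hx
  unfold fwdLog at hx
  rcases forward_cases i w (st i) with ⟨h1, h2⟩ | ⟨h1, h2, h3⟩ | ⟨h1, h2, h3⟩
  · simpa [h2] using hx
  · simpa [h3] using hx
  · rw [h3] at hx
    simp only [filterMap_sendTo_broadcast] at hx
    rcases isMsg_append.1 hx with hx | ⟨h4, h5, h6⟩
    · exact hx
    · have h7 : (w.sd, w.snsd) = x := Prod.ext (congrArg Forward.sd h6) (congrArg Forward.snsd h6)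
      have h8 := (h.form _ _ _ hw).2.2.at.lt
      rw [h7, h4, h5] at h8
      exact absurd h8 (lt_irrefl _)

theorem Step.isMsg (hs : Step st L got e st' L' got' evs) (h : Inv st L got) {x m}
    (hx : IsMsg L' x m) :
    IsMsg L x m ∨ ((∃ cut, e = Event.step x.1 (Trigger.invoke m) cut) ∧
      x.2 = (st x.1).sn ∧ ¬ (st x.1).waiting) := by
  cases hs with
  | idle => exact Or.inl hx
  | invoke i m' cut hw =>
    rcases isMsg_append.1 hx with hx | ⟨h1, h2, h3⟩
    · exact Or.inl hx
    · subst h1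
      have h4 : m' = m := congrArg Forward.m h3
      subst h4
      exact Or.inr ⟨⟨cut, rfl⟩, h2.trans (h.len _), hw⟩
  | silent i src cut w hw hc => exact Or.inl (h.isMsg_fwdLog hw hx)
  | deliver i src cut w hw hc => exact Or.inl (h.isMsg_fwdLog hw hx)
  | respond i cut evs hw ho hc => exact Or.inl hx
  | pass i cut hw => exact Or.inl hx

theorem del_delivered_iff (h : Inv st L got) {src i w} (hw : (L src)[got src i]? = some w) {j x m}
    (hx : IsMsg L x m) :
    Del (Function.update (fwdState st i w) i (delivered (fwdState st i w i))) j x ↔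
      Del st j x ∨ (j = i ∧ ∃ q ∈ toDeliver (fwdState st i w i).buffer, q.key = x) := by
  by_cases hj : j = i
  · subst hj
    have := (h.forward hw).del_delivered (i := j) (logLE_append L j _ |>.isMsg hx)
    simpa [Del, fwdState_clock] using this
  · simp [Del, hj, fwdState_clock]

theorem Step.del_mono (hs : Step st L got e st' L' got' evs) {j x} (hd : Del st j x) :
    Del st' j x := by
  have h1 : ∀ i w, Del (Function.update (fwdState st i w) i (delivered (fwdState st i w i))) j x := by
    intro i w
    by_cases hj : j = i
    · subst hj
      simp only [Del, Function.update_self, delivered, fwdState_clock]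
      exact le_trans hd le_sup_left
    · simpa [Del, hj, fwdState_clock] using hd
  cases hs with
  | idle => exact hd
  | invoke i m' cut hw =>
    by_cases hj : j = i
    · subst hj; simpa [Del, invState, addQuad] using hd
    · simpa [Del, invState, hj] using hd
  | silent i src cut w hw hc => exact h1 i w
  | deliver i src cut w hw hc => exact h1 i w
  | respond i cut evs hw ho hc =>
    by_cases hj : j = i
    · subst hj; simpa [Del] using hd
    · simpa [Del, hj] using hd
  | pass i cut hw => exact hd

/-! ### The history and its relation to the logs -/

/-- The relation between the history and the local states and logs. -/
structure HistInv (hist : List (HistEvent n M Unit (Set M))) (st : Fin n → LocalState n M)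
    (L : Fin n → List (Forward n M)) : Prop where
  msg_mem : ∀ x m, IsMsg L x m → HistEvent.inv x.1 m ∈ hist
  mem_msg : ∀ i m, HistEvent.inv i m ∈ hist → ∃ a, IsMsg L (i, a) m
  uniq : ∀ x y m, IsMsg L x m → IsMsg L y m → x = y
  ind : ∀ (p : ℕ) (i : Fin n) (ms : Set M), hist[p]? = some (HistEvent.ind i ms) → ms.Nonempty ∧ ∀ m ∈ ms,
    (∃ x, IsMsg L x m ∧ Del st i x) ∧ ∃ p' < p, ∃ j, hist[p']? = some (HistEvent.inv j m)
  once : ∀ (p p' : ℕ) (i : Fin n) (ms ms' : Set M), hist[p]? = some (HistEvent.ind i ms) →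
    hist[p']? = some (HistEvent.ind i ms') → ∀ m, m ∈ ms → m ∈ ms' → p = p'
  order : ∀ (p p' : ℕ) (i : Fin n) (ms ms' : Set M), hist[p]? = some (HistEvent.ind i ms) →
    hist[p']? = some (HistEvent.ind i ms') → p < p' → ∀ m ∈ ms, ∀ m' ∈ ms', ∀ x x',
      IsMsg L x m → IsMsg L x' m' → Maj {f | Before L x x' f}

theorem getElem?_concat_eq {α : Type*} {l : List α} {a b : α} {p : ℕ}
    (h : (l ++ [a])[p]? = some b) : l[p]? = some b ∨ (p = l.length ∧ a = b) := by
  rcases lt_trichotomy p l.length with hp | hp | hp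
  · rw [List.getElem?_append_left hp] at h
    exact Or.inl h
  · simp [hp] at h
    exact Or.inr ⟨hp, h⟩
  · rw [List.getElem?_eq_none (by simp; omega)] at h
    simp at h

/-- Without a new delivery, every assertion about deliveries persists, since logs and clocks only
grow; what remains is to match new messages with new invocations. -/
theorem HistInv.of_no_ind {hist : List (HistEvent n M Unit (Set M))} (hh : HistInv hist st L)
    (h : Inv st L got) (hs : Step st L got e st' L' got' evs)
    (hevs : evs = [] ∨ ∃ ev₀, evs = [ev₀] ∧ (∀ i ms, ev₀ ≠ HistEvent.ind i ms) ∧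
      ∀ i m, ev₀ = HistEvent.inv i m → IsMsg L' (i, (L i).length) m)
    (hinv : ∀ i m cut, e = Event.step i (Trigger.invoke m) cut → evs = [HistEvent.inv i m])
    (hdist : ∀ i m, evs = [HistEvent.inv i m] → ∀ j, HistEvent.inv j m ∉ hist) :
    HistInv (hist ++ evs) st' L' := by
  have hind : ∀ (p : ℕ) i ms, (hist ++ evs)[p]? = some (HistEvent.ind i ms) →
      hist[p]? = some (HistEvent.ind i ms) := by
    intro p i ms hp
    rcases hevs with rfl | ⟨ev₀, rfl, h1, -⟩
    · simpa using hp
    · rcases getElem?_concat_eq hp with hp | ⟨-, hp⟩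
      · exact hp
      · exact absurd hp (h1 i ms)
  have hmsg : ∀ x m, IsMsg L' x m → IsMsg L x m ∨ (evs = [HistEvent.inv x.1 m] ∧
      x.2 = (st x.1).sn) := by
    intro x m hx
    rcases hs.isMsg h hx with hx | ⟨⟨cut, h1⟩, h2, -⟩
    · exact Or.inl hx
    · exact Or.inr ⟨hinv _ _ _ h1, h2⟩
  have hmsg' : ∀ x m m', IsMsg L x m → IsMsg L' x m' → IsMsg L x m' := by
    intro x m m' hx hx'
    rwa [← (hs.logLE.isMsg hx).unique hx']
  have huniq : ∀ x y m, IsMsg L' x m → IsMsg L' y m → x = y := by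
    intro x y m hx hy
    rcases hmsg x m hx with hx | ⟨h1, h2⟩ <;> rcases hmsg y m hy with hy | ⟨h3, h4⟩
    · exact hh.uniq x y m hx hy
    · exact absurd (hh.msg_mem _ _ hx) (hdist _ _ h3 _)
    · exact absurd (hh.msg_mem _ _ hy) (hdist _ _ h1 _)
    · rw [h1] at h3
      have h5 : x.1 = y.1 := by simpa using h3
      refine Prod.ext h5 ?_
      rw [h2, h4, h5]
  constructor
  case msg_mem =>
    intro x m hx
    rcases hmsg x m hx with hx | ⟨h1, -⟩
    · exact List.mem_append_left _ (hh.msg_mem x m hx)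
    · rw [h1]; simp
  case mem_msg =>
    intro i m hm
    rcases List.mem_append.1 hm with hm | hm
    · obtain ⟨a, ha⟩ := hh.mem_msg i m hm
      exact ⟨a, hs.logLE.isMsg ha⟩
    · rcases hevs with rfl | ⟨ev₀, rfl, -, h1⟩
      · simp at hm
      · exact ⟨_, h1 i m (List.mem_singleton.1 hm).symm⟩
  case uniq => exact huniq
  case ind =>
    intro p i ms hp
    obtain ⟨h1, h2⟩ := hh.ind p i ms (hind p i ms hp)
    refine ⟨h1, fun m hm => ?_⟩
    obtain ⟨⟨x, h3, h4⟩, p', h5, j, h6⟩ := h2 m hm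
    exact ⟨⟨x, hs.logLE.isMsg h3, hs.del_mono h4⟩, p', h5, j,
      getElem?_of_prefix (List.prefix_append _ _) h6⟩
  case once =>
    exact fun p p' i ms ms' hp hp' => hh.once p p' i ms ms' (hind _ _ _ hp) (hind _ _ _ hp')
  case order =>
    intro p p' i ms ms' hp hp' hpp m hm m' hm' x x' hx hx'
    obtain ⟨⟨y, h1, -⟩, -⟩ := (hh.ind p i ms (hind _ _ _ hp)).2 m hm
    obtain ⟨⟨y', h2, -⟩, -⟩ := (hh.ind p' i ms' (hind _ _ _ hp')).2 m' hm'
    obtain rfl := huniq x y m hx (hs.logLE.isMsg h1)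
    obtain rfl := huniq x' y' m' hx' (hs.logLE.isMsg h2)
    exact hs.logLE.maj (hh.order p p' i ms ms' (hind _ _ _ hp) (hind _ _ _ hp') hpp m hm m' hm'
      x x' h1 h2)

theorem Step.hist {hist : List (HistEvent n M Unit (Set M))}
    (hs : Step st L got e st' L' got' evs) (hh : HistInv hist st L) (h : Inv st L got)
    (hdist : ∀ i m, evs = [HistEvent.inv i m] → ∀ j, HistEvent.inv j m ∉ hist) :
    HistInv (hist ++ evs) st' L' := by
  have hs' := hs
  cases hs with
  | idle => exact hh.of_no_ind h hs' (Or.inl rfl) (by simp) hdist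
  | invoke i m cut hw =>
    refine hh.of_no_ind h hs' (Or.inr ⟨_, rfl, by simp, ?_⟩) ?_ hdist
    · intro j m' hj
      obtain ⟨rfl, rfl⟩ : i = j ∧ m = m' := by simpa using hj
      refine isMsg_append.2 (Or.inr ⟨rfl, rfl, ?_⟩)
      rw [h.len]
    · intro j m' cut' hj
      obtain ⟨rfl, rfl, -⟩ : i = j ∧ m = m' ∧ cut = cut' := by simpa using hj
      rfl
  | silent i src cut w hw hc => exact hh.of_no_ind h hs' (Or.inl rfl) (by simp) hdist
  | respond i cut evs hw ho hc =>
    refine hh.of_no_ind h hs' ?_ (by simp) hdist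
    rcases hc with rfl | ⟨-, rfl⟩
    · exact Or.inr ⟨_, rfl, by simp, by simp⟩
    · exact Or.inl rfl
  | pass i cut hw => exact hh.of_no_ind h hs' (Or.inl rfl) (by simp) hdist
  | deliver i src cut w hw hc =>
    have hLL := hs'.logLE
    have hback : ∀ {x m}, IsMsg (fwdLog st L i w) x m → IsMsg L x m := h.isMsg_fwdLog hw
    have hF := h.forward hw
    have hq : ∀ q ∈ toDeliver (fwdState st i w i).buffer, IsMsg L q.key q.m ∧
        ¬ Del st i q.key := by
      intro q hq
      obtain ⟨h1, h2, -⟩ := hF.buf i q (toDeliver_subset _ hq)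
      exact ⟨hback h2, by simpa [Del, fwdState_clock] using h1⟩
    have hind : ∀ (p : ℕ) (j : Fin n) (ms : Set M) (l : Set M),
        (hist ++ [(HistEvent.ind i l : HistEvent n M Unit (Set M))])[p]? =
          some (HistEvent.ind j ms) → 
        hist[p]? = some (HistEvent.ind j ms) ∨ (p = hist.length ∧ i = j ∧ l = ms) := by
      intro p j ms l hp
      refine (getElem?_concat_eq hp).imp_right fun h1 => ⟨h1.1, ?_⟩
      simpa using h1.2
    constructor
    case msg_mem => exact fun x m hx => List.mem_append_left _ (hh.msg_mem x m (hback hx))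
    case mem_msg =>
      intro j m hm
      obtain ⟨a, ha⟩ := hh.mem_msg j m (by simpa using hm)
      exact ⟨a, hLL.isMsg ha⟩
    case uniq => exact fun x y m hx hy => hh.uniq x y m (hback hx) (hback hy)
    case ind =>
      intro p j ms hp
      rcases hind p j ms _ hp with hp | ⟨rfl, rfl, rfl⟩
      · obtain ⟨h1, h2⟩ := hh.ind p j ms hp
        refine ⟨h1, fun m hm => ?_⟩
        obtain ⟨⟨x, h3, h4⟩, p', h5, j, h6⟩ := h2 m hm
        exact ⟨⟨x, hLL.isMsg h3, hs'.del_mono h4⟩, p', h5, j,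
          getElem?_of_prefix (List.prefix_append _ _) h6⟩
      · refine ⟨hc.imp' Quad.m fun q hq => ⟨q, hq, rfl⟩, ?_⟩
        rintro m ⟨q, hqT, rfl⟩
        refine ⟨⟨q.key, hLL.isMsg (hq q hqT).1,
          (del_delivered_iff h hw (hq q hqT).1).2 (Or.inr ⟨rfl, q, hqT, rfl⟩)⟩, ?_⟩
        obtain ⟨p', hp'⟩ := List.getElem?_of_mem (hh.msg_mem _ _ (hq q hqT).1)
        exact ⟨p', (List.getElem?_eq_some_iff.1 hp').1, _,
          getElem?_of_prefix (List.prefix_append _ _) hp'⟩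
    case once =>
      have key : ∀ (p : ℕ) ms m, hist[p]? = some (HistEvent.ind i ms) → m ∈ ms →
          ∀ q ∈ toDeliver (fwdState st i w i).buffer, q.m ≠ m := by
        rintro p ms m hp hm q hqT rfl
        obtain ⟨⟨x, h1, h2⟩, -⟩ := (hh.ind p i ms hp).2 _ hm
        rw [hh.uniq x _ _ h1 (hq q hqT).1] at h2
        exact (hq q hqT).2 h2
      intro p p' j ms ms' hp hp' m hm hm'
      rcases hind p j ms _ hp with hp | ⟨rfl, rfl, rfl⟩ <;>
      rcases hind p' _ ms' _ hp' with hp' | ⟨rfl, h1, rfl⟩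
      · exact hh.once p p' j ms ms' hp hp' m hm hm'
      · subst h1
        obtain ⟨q, hqT, hqm⟩ := hm'
        exact absurd hqm (key p ms m hp hm q hqT)
      · obtain ⟨q, hqT, hqm⟩ := hm
        exact absurd hqm (key p' ms' m hp' hm' q hqT)
      · rfl
    case order =>
      intro p p' j ms ms' hp hp' hpp m hm m' hm' x x' hx hx'
      have hx := hback hx
      have hx' := hback hx'
      rcases hind p' j ms' _ hp' with hp' | ⟨rfl, rfl, rfl⟩
      · rcases hind p j ms _ hp with hp | ⟨rfl, -, -⟩
        · exact hLL.maj (hh.order p p' j ms ms' hp hp' hpp m hm m' hm' x x' hx hx')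
        · have := (List.getElem?_eq_some_iff.1 hp').1
          omega
      · rcases hind p i ms _ hp with hp | ⟨rfl, -, -⟩
        -- Just before the new delivery, `x` is delivered at `i` and `x'` is not: exactly the
        -- situation of the field `before`.
        · obtain ⟨⟨y, h1, h2⟩, -⟩ := (hh.ind p i ms hp).2 m hm
          obtain rfl := hh.uniq x y m hx h1
          obtain ⟨q, hqT, rfl⟩ := hm'
          obtain rfl := hh.uniq x' _ _ hx' (hq q hqT).1
          exact hLL.maj (h.before i x m _ hx h2 (hq q hqT).2)
        · omega

/-! ### Safety of runs -/

variable {ev : ℕ → Event n M}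

theorem inv_at (he : ∀ τ, (Config.configAt (algo n M) ev τ).Enabled Channels.fifo (ev τ)) (τ : ℕ) :
    Inv (stAt ev τ) (logAt ev τ) (gotAt ev τ) := (tied he τ).inv

theorem step_at (he : ∀ τ, (Config.configAt (algo n M) ev τ).Enabled Channels.fifo (ev τ)) (τ : ℕ) :
    ∃ evs, (Config.configAt (algo n M) ev (τ + 1)).hist =
        (Config.configAt (algo n M) ev τ).hist ++ evs ∧
      Step (stAt ev τ) (logAt ev τ) (gotAt ev τ) (ev τ) (stAt ev (τ + 1)) (logAt ev (τ + 1))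
        (gotAt ev (τ + 1)) evs :=
  ((tied he τ).after (he τ)).2

theorem histInv_at (he : ∀ τ, (Config.configAt (algo n M) ev τ).Enabled Channels.fifo (ev τ))
    (hD : DistinctBroadcasts (historyOf (algo n M) ev)) (τ : ℕ) :
    HistInv (Config.configAt (algo n M) ev τ).hist (stAt ev τ) (logAt ev τ) := by
  induction τ with
  | zero => constructor <;> simp [Config.configAt, Config.initial, logAt, IsMsg]
  | succ τ ih =>
    obtain ⟨evs, h1, h2⟩ := step_at he τ
    rw [h1]
    refine h2.hist ih (inv_at he τ) ?_
    rintro i m rfl j hj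
    obtain ⟨p, hp⟩ := List.getElem?_of_mem hj
    have hlt := (List.getElem?_eq_some_iff.1 hp).1
    have h3 : historyOf (algo n M) ev (Config.configAt (algo n M) ev τ).hist.length
        (HistEvent.inv i m) := by
      refine ⟨τ + 1, ?_⟩
      rw [h1]
      simp
    have := hD _ _ _ _ _ (historyOf_of_hist hp) h3
    omega

theorem logLE_at (he : ∀ τ, (Config.configAt (algo n M) ev τ).Enabled Channels.fifo (ev τ))
    {τ τ' : ℕ} (h : τ ≤ τ') : LogLE (logAt ev τ) (logAt ev τ') := by
  induction h with
  | refl => exact fun _ => List.prefix_rfl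
  | step _ ih =>
    obtain ⟨evs, -, h2⟩ := step_at he _
    exact fun i => (ih i).trans (h2.logLE i)

theorem del_mono (he : ∀ τ, (Config.configAt (algo n M) ev τ).Enabled Channels.fifo (ev τ))
    {τ τ' : ℕ} (h : τ ≤ τ') {i x} (hd : Del (stAt ev τ) i x) : Del (stAt ev τ') i x := by
  induction h with
  | refl => exact hd
  | step _ ih =>
    obtain ⟨evs, -, h2⟩ := step_at he _
    exact h2.del_mono ih

theorem got_mono {τ τ' : ℕ} (h : τ ≤ τ') (f i : Fin n) : gotAt ev τ f i ≤ gotAt ev τ' f i :=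
  Finset.card_le_card (Config.rcvd_mono (A := algo n M) ev h f i)

/-- Non-faulty processes have handed over to their clients the messages that their clocks have
passed. -/
theorem exists_ind_of_del (he : ∀ τ, (Config.configAt (algo n M) ev τ).Enabled Channels.fifo (ev τ))
    {i : Fin n} {τ : ℕ} (hi : ¬ (Config.configAt (algo n M) ev τ).crashed i) {x m}
    (hx : IsMsg (logAt ev τ) x m) (hd : Del (stAt ev τ) i x) :
    ∃ (p : ℕ) (ms : Set M), (Config.configAt (algo n M) ev τ).hist[p]? = some (HistEvent.ind i ms) ∧ m ∈ ms := by
  induction τ with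
  | zero => simp [logAt, IsMsg] at hx
  | succ τ ih =>
    have hi' : ¬ (Config.configAt (algo n M) ev τ).crashed i := fun h =>
      hi (Config.crashed_mono (A := algo n M) ev τ.le_succ h)
    have hold : IsMsg (logAt ev τ) x m → Del (stAt ev τ) i x →
        ∃ (p : ℕ) (ms : Set M), (Config.configAt (algo n M) ev (τ + 1)).hist[p]? =
          some (HistEvent.ind i ms) ∧ m ∈ ms := by
      intro h1 h2
      obtain ⟨p, ms, h3, h4⟩ := ih hi' h1 h2
      exact ⟨p, ms, getElem?_of_prefix (Config.hist_prefix (A := algo n M) ev τ.le_succ) h3, h4⟩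
    obtain ⟨evs, h1, hs⟩ := step_at he τ
    have hI := inv_at he τ
    -- A cut would crash `i`. In a cut reaction the clock could pass a message whose indication was
    -- never emitted.
    have hcut : ∀ tr cut, ev τ = Event.step i tr cut → cut = none := by
      intro tr cut hev
      cases cut with
      | none => rfl
      | some k =>
        refine absurd ?_ hi
        rw [Config.configAt, hev]
        exact Or.inr ⟨rfl, rfl⟩
    generalize hst : stAt ev (τ + 1) = st' at hs hd
    generalize hL : logAt ev (τ + 1) = L' at hs hx
    generalize hg : gotAt ev (τ + 1) = got' at hs
    generalize hev : ev τ = e at hs hcut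
    have hs' := hs
    cases hs with
    | idle => exact hold hx hd
    | invoke j m' cut hw =>
      have hd' : Del (stAt ev τ) i x := by
        by_cases hj : i = j
        · subst hj; simpa [Del, invState, addQuad] using hd
        · simpa [Del, invState, hj] using hd
      rcases hs'.isMsg hI hx with hx | ⟨-, h2, -⟩
      · exact hold hx hd'
      · rw [show x = (x.1, (stAt ev τ x.1).sn) from Prod.ext rfl h2] at hd'
        exact absurd hd' (hI.fresh _ _)
    | silent j src cut w hw hc =>
      have hx' := hI.isMsg_fwdLog hw hx
      rcases (del_delivered_iff hI hw hx').1 hd with hd | ⟨rfl, q, hq, -⟩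
      · exact hold hx' hd
      · exact absurd ⟨q, hq⟩ (hc (hcut _ _ rfl))
    | deliver j src cut w hw hc =>
      have hx' := hI.isMsg_fwdLog hw hx
      rcases (del_delivered_iff hI hw hx').1 hd with hd | ⟨rfl, q, hq, rfl⟩
      · exact hold hx' hd
      · refine ⟨(Config.configAt (algo n M) ev τ).hist.length,
          {m | ∃ q ∈ toDeliver (fwdState (stAt ev τ) i w i).buffer, q.m = m},
          by rw [h1]; exact List.getElem?_concat_length, q, hq, ?_⟩
        exact ((hI.forward hw).buf i q (toDeliver_subset _ hq)).2.1.unique hx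
    | respond j cut evs hw ho hc =>
      refine hold hx ?_
      by_cases hj : i = j
      · subst hj; simpa [Del] using hd
      · simpa [Del, hj] using hd
    | pass j cut hw => exact hold hx hd

end SCD

namespace SCD

variable {n : ℕ} {M : Type u} {st : Fin n → LocalState n M} {L : Fin n → List (Forward n M)}
  {got : Fin n → Fin n → ℕ} {ev : ℕ → Event n M} {t : ℕ}

/-! ### Liveness -/

/-- A set of messages is delivered at once if all FORWARD messages of the processes of a majority
`C` concerning them have been received, and none of its elements needs to wait for a message outside
the set. -/
theorem Inv.mem_toDeliver (h : Inv st L got) {i : Fin n} {X : Set (Fin n × ℕ)} {C : Set (Fin n)}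
    (hC : Maj C) (hX : ∀ x ∈ X, ∀ f ∈ C, ∃ k < got f i, At L f k x)
    (hB : ∀ x ∈ X, ∀ q ∈ (st i).buffer, q.key ∉ X →
      Maj {f | f ∈ C ∧ ∀ k k', At L f k x → At L f k' q.key → k < k'})
    {q : Quad n M} (hq : q ∈ (st i).buffer) (hqX : q.key ∈ X) : q ∈ toDeliver (st i).buffer := by
  classical
  have hsub : (st i).buffer.filter (fun q => q.key ∈ X) ⊆ toDeliver (st i).buffer := by
    refine subset_purge ?_ ?_
    · intro q hq
      rw [Finset.mem_filter] at hq ⊢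
      refine ⟨hq.1, hC.mono fun f hf => ?_⟩
      obtain ⟨k, hk, hat⟩ := hX _ hq.2 f hf
      simp only [Set.mem_ofPred_eq]
      rw [h.cl_rcv i q hq.1 f k hk hat]
      exact ENat.natCast_lt_top k
    · intro q hq q' hq' hq'S
      rw [Finset.mem_filter] at hq hq'S
      have hq'X : q'.key ∉ X := fun hx => hq'S ⟨hq', hx⟩
      have : Maj {f | q.cl f < q'.cl f} := by
        refine (hB _ hq.2 q' hq' hq'X).mono fun f hf => ?_
        obtain ⟨k, hk, hat⟩ := hX _ hq.2 f hf.1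
        simp only [Set.mem_ofPred_eq]
        rw [h.cl_rcv i q hq.1 f k hk hat]
        by_cases htop : q'.cl f = ⊤
        · rw [htop]; exact ENat.natCast_lt_top k
        · obtain ⟨k', hk'⟩ := ENat.ne_top_iff_exists.1 htop
          rw [← hk']
          exact_mod_cast hf.2 k k' hat (h.cl_at i q' hq' f k' hk'.symm).1
      unfold NotMajorityBefore
      unfold Maj at this
      omega
  exact hsub (Finset.mem_filter.2 ⟨hq, hqX⟩)

/-- The `k`-th FORWARD message that `f` broadcasts during the run concerns `x`. -/
def AtE (ev : ℕ → Event n M) (f : Fin n) (k : ℕ) (x : Fin n × ℕ) : Prop :=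
  ∃ τ, At (logAt ev τ) f k x

/-- If `f` forwards both `x` and `y`, it forwards `x` first. -/
def PreE (ev : ℕ → Event n M) (x y : Fin n × ℕ) (f : Fin n) : Prop :=
  ∀ k k', AtE ev f k x → AtE ev f k' y → k < k'

/-- Some process of `C` forwards `x`. -/
def Star (ev : ℕ → Event n M) (C : Set (Fin n)) (x : Fin n × ℕ) : Prop :=
  ∃ f ∈ C, ∃ k, AtE ev f k x

section

variable (he : ∀ τ, (Config.configAt (algo n M) ev τ).Enabled Channels.fifo (ev τ))

include he

theorem AtE.at {f k x} (h : AtE ev f k x) {τ : ℕ} (hk : k < (logAt ev τ f).length) :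
    At (logAt ev τ) f k x := by
  obtain ⟨τ', h⟩ := h
  rcases le_total τ τ' with hτ | hτ
  · exact ((logLE_at he hτ).at_iff hk).1 h
  · exact (logLE_at he hτ).at h

theorem AtE.key_eq {f k x y} (h : AtE ev f k x) (h' : AtE ev f k y) : x = y := by
  obtain ⟨τ, h⟩ := h
  exact h.key_eq (h'.at he h.lt)

theorem AtE.inj {f k k' x} (h : AtE ev f k x) (h' : AtE ev f k' x) : k = k' := by
  obtain ⟨τ, h⟩ := h
  obtain ⟨τ', h'⟩ := h'
  rcases le_total τ τ' with hτ | hτ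
  · exact (inv_at he τ').inj _ _ _ _ ((logLE_at he hτ).at h) h'
  · exact (inv_at he τ).inj _ _ _ _ h ((logLE_at he hτ).at h')

theorem preE_of_before {τ x y f} (h : Before (logAt ev τ) x y f) : PreE ev x y f := by
  obtain ⟨k₀, h1, h2⟩ := h
  intro k k' hk hk'
  obtain rfl := AtE.inj he ⟨τ, h1⟩ hk
  by_contra hlt
  exact h2 k' (not_lt.1 hlt) (hk'.at he ((not_lt.1 hlt).trans_lt h1.lt))

theorem finite_atE (g : Fin n) (K : ℕ) : {x | ∃ k < K, AtE ev g k x}.Finite := by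
  have : {x | ∃ k < K, AtE ev g k x} = ⋃ k ∈ Finset.range K, {x | AtE ev g k x} := by
    ext x; simp
  rw [this]
  exact Set.Finite.biUnion (Finset.finite_toSet _) fun k _ =>
    Set.Subsingleton.finite fun x hx y hy => AtE.key_eq he hx hy

/-- A clock entry stays below the sender's counter, so position `x.2` of the sender's log was
already written at time `τ`, and it does not change. -/
theorem isMsg_of_del {τ τ' i x m} (hx : IsMsg (logAt ev τ') x m) (hd : Del (stAt ev τ) i x) :
    IsMsg (logAt ev τ) x m := by
  have hlt : x.2 < (logAt ev τ x.1).length := by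
    rw [(inv_at he τ).len]
    exact_mod_cast lt_of_le_of_lt hd ((inv_at he τ).clock i x.1)
  rcases le_total τ τ' with hτ | hτ
  · obtain ⟨m', hm'⟩ := (inv_at he τ).msg_of_at (((logLE_at he hτ).at_iff hlt).1 hx.at)
    rwa [hx.unique ((logLE_at he hτ).isMsg hm')]
  · exact (logLE_at he hτ).isMsg hx

theorem exists_isMsg {f k x} (h : AtE ev f k x) : ∃ τ m, IsMsg (logAt ev τ) x m := by
  obtain ⟨τ, h⟩ := h
  exact ⟨τ, (inv_at he τ).msg_of_at h⟩

end

theorem log_eq_of_crashed {τ τ' : ℕ} {i : Fin n}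
    (he : ∀ τ, (Config.configAt (algo n M) ev τ).Enabled Channels.fifo (ev τ))
    (hi : (Config.configAt (algo n M) ev τ).crashed i) (h : τ ≤ τ') :
    logAt ev τ' i = logAt ev τ i := by
  induction h with
  | refl => rfl
  | @step τ' h ih =>
    rw [← ih, logAt]
    have hc := Config.crashed_mono (A := algo n M) ev h hi
    have h1 := he τ'
    cases hev : ev τ' with
    | idle => rfl
    | step j tr cut =>
      rw [hev] at h1
      have hij : i ≠ j := by rintro rfl; exact h1.1 hc
      simp [nextLog, hij]

theorem maj_correct (hr : IsRun Channels.fifo t (algo n M) ev) (ht : 2 * t < n) :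
    Maj (correctSet (algo n M) ev) := by
  have h1 := Set.ncard_add_ncard_compl (correctSet (algo n M) ev)
  have h2 := hr.crashes
  rw [Nat.card_fin] at h1
  unfold Maj
  omega

section

variable (hr : IsRun Channels.fifo t (algo n M) ev)

include hr

local notation "C" => correctSet (algo n M) ev

theorem exists_received {f i : Fin n} (hf : f ∈ C) (hi : i ∈ C) {k x} (hx : AtE ev f k x) :
    ∃ τ, k < gotAt ev τ f i ∧ At (logAt ev τ) f k x := by
  obtain ⟨τ, hx⟩ := hx
  have hk := hx.lt
  rw [← (tied hr.enabled τ).sent_eq f i (hf τ)] at hk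
  obtain ⟨τ', h⟩ := hr.reliable f i hi τ k hk
  have hT := tied hr.enabled τ'
  rw [hT.rcvd] at h
  have hg : k < gotAt ev τ' f i := Finset.mem_range.1 h
  exact ⟨τ', hg, AtE.at hr.enabled ⟨τ, hx⟩ (hg.trans_le (hT.inv.got_le f i))⟩

/-- Every non-faulty process receives the FORWARD message of a non-faulty one, and has forwarded the
message itself by then. -/
theorem Star.forwarded {x} (hx : Star ev C x) {f : Fin n} (hf : f ∈ C) : ∃ k, AtE ev f k x := by
  obtain ⟨g, hg, k, hk⟩ := hx
  obtain ⟨τ, h1, h2⟩ := exists_received hr hg hf hk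
  obtain ⟨k', h3⟩ := (inv_at hr.enabled τ).rcv g f k x h1 h2
  exact ⟨k', τ, h3⟩

theorem Star.received {x} (hx : Star ev C x) {f i : Fin n} (hf : f ∈ C) (hi : i ∈ C) :
    ∃ τ, ∃ k < gotAt ev τ f i, At (logAt ev τ) f k x := by
  obtain ⟨k, hk⟩ := hx.forwarded hr hf
  obtain ⟨τ, h1, h2⟩ := exists_received hr hf hi hk
  exact ⟨τ, k, h1, h2⟩

/-- A finite set of messages, none of which needs to wait for a message outside the set, is
eventually delivered. -/
theorem del_of_good (hC : Maj C) {X : Set (Fin n × ℕ)} (hXf : X.Finite)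
    (hXs : ∀ x ∈ X, Star ev C x)
    (hX : ∀ x ∈ X, ∀ y, Star ev C y → y ∉ X → Maj {f | f ∈ C ∧ PreE ev x y f})
    {i : Fin n} (hi : i ∈ C) {x} (hx : x ∈ X) : ∃ τ, Del (stAt ev τ) i x := by
  classical
  have he := hr.enabled
  -- `P τ`: process `i` has received all FORWARD messages of `C` about `X`. The delivery is found in
  -- the very step in which `P` becomes true.
  let P : ℕ → Prop := fun τ => ∀ z ∈ X, ∀ f ∈ C, ∃ k < gotAt ev τ f i, At (logAt ev τ) f k z
  have hP : ∃ τ, P τ := by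
    have h1 : ∀ p : (Fin n × ℕ) × Fin n, ∃ τ, p.1 ∈ X → p.2 ∈ C →
        ∃ k < gotAt ev τ p.2 i, At (logAt ev τ) p.2 k p.1 := by
      intro p
      by_cases hp : p.1 ∈ X ∧ p.2 ∈ C
      · obtain ⟨τ, h1⟩ := (hXs _ hp.1).received hr hp.2 hi
        exact ⟨τ, fun _ _ => h1⟩
      · exact ⟨0, fun h1 h2 => absurd ⟨h1, h2⟩ hp⟩
    choose T hT using h1
    obtain ⟨B, hB⟩ := ((hXf.prod (Set.toFinite (Set.univ : Set (Fin n)))).image T).bddAbove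
    refine ⟨B, fun z hz f hf => ?_⟩
    obtain ⟨k, h1, h2⟩ := hT (z, f) hz hf
    have hle : T (z, f) ≤ B := hB (Set.mem_image_of_mem T ⟨hz, Set.mem_univ f⟩)
    exact ⟨k, h1.trans_le (got_mono hle f i), (logLE_at he hle).at h2⟩
  have hP0 : ¬ P 0 := by
    intro h
    obtain ⟨k, h1, -⟩ := h x hx i hi
    simp [gotAt, Config.configAt, Config.initial] at h1
  obtain ⟨τ, hτ, hτ'⟩ : ∃ τ, ¬ P τ ∧ P (τ + 1) := by
    by_contra hcon
    push Not at hcon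
    have : ∀ τ, ¬ P τ := by
      intro τ
      induction τ with
      | zero => exact hP0
      | succ τ ih => exact hcon τ ih
    obtain ⟨τ, h⟩ := hP
    exact this τ h
  refine ⟨τ + 1, ?_⟩
  obtain ⟨evs, h1, hs⟩ := step_at he τ
  have hI := inv_at he τ
  -- Only a reception by `i` can make `P` true, and such a reaction ends with `tryDeliver`.
  have hback : (∀ f, gotAt ev (τ + 1) f i = gotAt ev τ f i) → False := by
    intro hg
    refine hτ fun z hz f hf => ?_
    obtain ⟨k, h2, h3⟩ := hτ' z hz f hf
    rw [hg] at h2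
    exact ⟨k, h2, ((logLE_at he τ.le_succ).at_iff (h2.trans_le (hI.got_le f i))).1 h3⟩
  have main : ∀ src w, (logAt ev τ src)[gotAt ev τ src i]? = some w →
      logAt ev (τ + 1) = fwdLog (stAt ev τ) (logAt ev τ) i w →
      gotAt ev (τ + 1) = bump (gotAt ev τ) src i →
      Del (Function.update (fwdState (stAt ev τ) i w) i
        (delivered (fwdState (stAt ev τ) i w i))) i x := by
    intro src w hw hL hg
    have hF := hI.forward hw
    rw [← hL, ← hg] at hF
    obtain ⟨k, h2, h3⟩ := hτ' x hx i hi
    obtain ⟨m, hm⟩ := hF.msg_of_at h3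
    have hm' : IsMsg (logAt ev τ) x m := hI.isMsg_fwdLog hw (hL ▸ hm)
    rw [del_delivered_iff hI hw hm']
    rcases hF.cover i k x h3 with ⟨q, hq, rfl⟩ | hd
    -- A quadruplet outside `X` in this buffer has been forwarded by the non-faulty `i`, so the
    -- hypothesis on outside messages applies to it.
    · refine Or.inr ⟨rfl, q, hF.mem_toDeliver hC hτ' ?_ hq hx, rfl⟩
      intro z hz q' hq' hq'X
      obtain ⟨k', hk'⟩ := (hF.buf i q' hq').2.2
      refine (hX z hz _ ⟨i, hi, k', _, hk'⟩ hq'X).mono fun f hf => ⟨hf.1, ?_⟩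
      exact fun k k' hk hk' => hf.2 k k' ⟨_, hk⟩ ⟨_, hk'⟩
    · exact Or.inl (by simpa [Del, fwdState_clock] using hd)
  generalize hst : stAt ev (τ + 1) = st' at hs ⊢
  generalize hL : logAt ev (τ + 1) = L' at hs main
  generalize hg : gotAt ev (τ + 1) = got' at hs main hback
  generalize hev : ev τ = e at hs
  have hbump : ∀ j src, j ≠ i → ∀ f, bump (gotAt ev τ) src j f i = gotAt ev τ f i := by
    intro j src hj f
    simp [bump, hj.symm]
  cases hs with
  | idle => exact absurd (fun _ => rfl) hback
  | invoke j m cut hw => exact absurd (fun _ => rfl) hback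
  | silent j src cut w hw hc =>
    by_cases hj : j = i
    · subst hj
      exact main src w hw rfl rfl
    · exact absurd (hbump j src hj) hback
  | deliver j src cut w hw hc =>
    by_cases hj : j = i
    · subst hj
      exact main src w hw rfl rfl
    · exact absurd (hbump j src hj) hback
  | respond j cut evs hw ho hc => exact absurd (fun _ => rfl) hback
  | pass j cut hw => exact absurd (fun _ => rfl) hback

/-- If infinitely many messages are forwarded, then some non-faulty process broadcasts infinitely
many messages. -/
theorem exists_infinite_sender (hinf : ¬ {x | Star ev C x}.Finite) :
    ∃ s ∈ C, {a | ∃ τ m, IsMsg (logAt ev τ) (s, a) m}.Infinite := by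
  have he := hr.enabled
  by_contra hcon
  push Not at hcon
  have hfin : ∀ s, {a | ∃ τ m, IsMsg (logAt ev τ) (s, a) m}.Finite := by
    intro s
    by_cases hs : s ∈ C
    · exact hcon s hs
    · simp only [correctSet, Set.mem_ofPred_eq, not_forall, not_not] at hs
      obtain ⟨τ₀, hs⟩ := hs
      refine (Set.finite_Iio (logAt ev τ₀ s).length).subset ?_
      rintro a ⟨τ, m, ha⟩
      have ha : a < (logAt ev τ s).length := ha.at.lt
      rcases le_total τ τ₀ with hτ | hτ
      · exact ha.trans_le (logLE_at he hτ s).length_le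
      · rwa [log_eq_of_crashed he hs hτ] at ha
  refine hinf ((Set.finite_iUnion fun s => (hfin s).image (Prod.mk s)).subset ?_)
  rintro ⟨s, a⟩ ⟨f, -, k, hk⟩
  obtain ⟨τ, m, hm⟩ := exists_isMsg he hk
  exact Set.mem_iUnion.2 ⟨s, a, ⟨τ, m, hm⟩, rfl⟩

/-- A non-faulty process that broadcasts infinitely many messages delivers all messages that
non-faulty processes forward. -/
theorem del_of_infinite_sender (hC : Maj C) {s : Fin n}
    (hinf : {a | ∃ τ m, IsMsg (logAt ev τ) (s, a) m}.Infinite) {y} (hy : Star ev C y) :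
    ∃ τ, Del (stAt ev τ) s y := by
  have he := hr.enabled
  by_contra hcon
  push Not at hcon
  -- `K f` is the position at which the non-faulty `f` forwards `y`.
  have hK : ∀ f, ∃ K, f ∈ C → AtE ev f K y := by
    intro f
    by_cases hf : f ∈ C
    · obtain ⟨k, hk⟩ := hy.forwarded hr hf
      exact ⟨k, fun _ => hk⟩
    · exact ⟨0, fun h => absurd h hf⟩
  choose K hK using hK
  refine hinf (((Set.finite_iUnion fun f => finite_atE he f (K f)).preimage
    (f := Prod.mk s) (fun a _ b _ hab => (Prod.mk.inj hab).2)).subset ?_)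
  rintro a ⟨τ, m, ha⟩
  obtain ⟨b, ⟨τ', m', hb⟩, hab⟩ := hinf.exists_gt a
  have hτ := logLE_at he (le_max_left τ τ')
  have hτ' := logLE_at he (le_max_right τ τ')
  have hI := inv_at he (max τ τ')
  have hd := (hI.wait s a b m m' (hτ.isMsg ha) (hτ'.isMsg hb) hab).1
  -- As `s` never delivers `y`, a majority forwards `(s, a)` before `y`, and it contains a
  -- non-faulty `f`. So `(s, a)` lies among the first `K f` entries of `f`, a finite supply, whereas
  -- there are infinitely many such `a`.
  obtain ⟨f, hf, hfC⟩ := (hI.before s (s, a) m y (hτ.isMsg ha) hd (hcon _)).inter hC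
  obtain ⟨k, hk, -⟩ := id hf
  exact Set.mem_iUnion.2 ⟨f, k, preE_of_before he hf k (K f) ⟨_, hk⟩ (hK f hfC), _, hk⟩

/-- Every message that some non-faulty process forwards is delivered by all non-faulty
processes. -/
theorem del_of_star (hC : Maj C) {y} (hy : Star ev C y) {i : Fin n} (hi : i ∈ C) :
    ∃ τ, Del (stAt ev τ) i y := by
  have he := hr.enabled
  by_cases hfin : {x | Star ev C x}.Finite
  -- With finitely many messages the set of all of them is good: nothing is outside.
  · exact del_of_good hr hC hfin (fun _ => id) (fun x _ z hz hzX => absurd hz hzX) hi hy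
  obtain ⟨s, hs, hinf⟩ := exists_infinite_sender hr hfin
  have hall : ∀ x, Star ev C x → ∃ τ, Del (stAt ev τ) s x := fun x hx =>
    del_of_infinite_sender hr hC hinf hx
  -- Messages forwarded by some faulty process: finitely many, because logs stop growing at the
  -- crash. For other messages, the majorities of `before` consist of non-faulty processes only.
  set F : Set (Fin n × ℕ) := {x | ∃ f ∉ C, ∃ k, AtE ev f k x} with hF
  have hFfin : F.Finite := by
    have h1 : ∀ f, ∃ K, f ∉ C → ∀ k x, AtE ev f k x → k < K := by
      intro f
      by_cases hf : f ∈ C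
      · exact ⟨0, fun h => absurd hf h⟩
      · have hf' := hf
        simp only [correctSet, Set.mem_ofPred_eq, not_forall, not_not] at hf'
        obtain ⟨τ₀, hf'⟩ := hf'
        refine ⟨(logAt ev τ₀ f).length, fun _ k x hk => ?_⟩
        obtain ⟨τ, hk⟩ := hk
        rcases le_total τ τ₀ with hτ | hτ
        · exact hk.lt.trans_le (logLE_at he hτ f).length_le
        · rw [← log_eq_of_crashed he hf' hτ]
          exact hk.lt
    choose K hK using h1
    refine (Set.finite_iUnion fun f => finite_atE he f (K f)).subset ?_
    rintro x ⟨f, hf, k, hk⟩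
    exact Set.mem_iUnion.2 ⟨f, k, hK f hf k x hk, hk⟩
  -- Messages that some non-faulty process forwards no later than a message of `F`; finitely many as
  -- well.
  set G : Set (Fin n × ℕ) := {x | ∃ g ∈ C, ∃ z ∈ F, ∃ k k', k ≤ k' ∧ AtE ev g k x ∧ AtE ev g k' z}
    with hG
  have hGfin : G.Finite := by
    have h1 : ∀ g, ∃ K, ∀ z ∈ F, ∀ k, AtE ev g k z → k < K := by
      intro g
      have : {k | ∃ z ∈ F, AtE ev g k z}.Finite := by
        have : {k | ∃ z ∈ F, AtE ev g k z} = ⋃ z ∈ F, {k | AtE ev g k z} := by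
          ext k; simp
        rw [this]
        exact hFfin.biUnion fun z _ => Set.Subsingleton.finite fun k hk k' hk' =>
          AtE.inj he hk hk'
      obtain ⟨B, hB⟩ := this.bddAbove
      exact ⟨B + 1, fun z hz k hk => Nat.lt_succ_of_le (hB ⟨z, hz, hk⟩)⟩
    choose K hK using h1
    refine (Set.finite_iUnion fun f => finite_atE he f (K f)).subset ?_
    rintro x ⟨g, -, z, hz, k, k', hkk, hk, hk'⟩
    exact Set.mem_iUnion.2 ⟨g, k, hkk.trans_lt (hK g z hz k' hk'), hk⟩
  obtain ⟨τ₀, hτ₀⟩ : ∃ τ₀, ∀ x ∈ insert y (F ∪ G), Star ev C x → Del (stAt ev τ₀) s x := by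
    have h1 : ∀ x, ∃ τ, Star ev C x → Del (stAt ev τ) s x := by
      intro x
      by_cases hx : Star ev C x
      · obtain ⟨τ, h⟩ := hall x hx
        exact ⟨τ, fun _ => h⟩
      · exact ⟨0, fun h => absurd h hx⟩
    choose T hT using h1
    obtain ⟨B, hB⟩ := (((hFfin.union hGfin).insert y).image T).bddAbove
    exact ⟨B, fun x hx hxs => del_mono he (hB (Set.mem_image_of_mem T hx)) (hT x hxs)⟩
  -- The time `τ₀` is late enough for `s` to have delivered `y` and all messages of `F` and `G` that
  -- non-faulty processes forward. The clock of `s` at that time makes `X` finite.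
  set X : Set (Fin n × ℕ) := {x | Star ev C x ∧ Del (stAt ev τ₀) s x} with hX
  have hI := inv_at he τ₀
  have hXfin : X.Finite := by
    refine (Set.finite_iUnion fun j => (Set.finite_Iio (stAt ev τ₀ j).sn).image
      (Prod.mk j)).subset ?_
    rintro ⟨j, a⟩ ⟨-, ha⟩
    refine Set.mem_iUnion.2 ⟨j, a, ?_, rfl⟩
    exact_mod_cast lt_of_le_of_lt ha (hI.clock s j)
  refine del_of_good hr hC hXfin (fun x hx => hx.1) ?_ hi ⟨hy, hτ₀ y (by simp) hy⟩
  intro x hx z hz hzX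
  have hzd : ¬ Del (stAt ev τ₀) s z := fun h => hzX ⟨hz, h⟩
  -- For `x` in `F`, a non-faulty process that did not forward `x` ahead of `z` would put `z` into
  -- `G`, so `s` would have delivered `z`. For other `x`, the majority of `before` at `s` consists
  -- of non-faulty processes.
  by_cases hxF : x ∈ F
  · refine hC.mono fun g hg => ⟨hg, fun k k' hk hk' => ?_⟩
    by_contra hlt
    refine hzd (hτ₀ z (Or.inr (Or.inr ⟨g, hg, x, hxF, k', k, not_lt.1 hlt, hk', hk⟩)) hz)
  · obtain ⟨f, -, k, hk⟩ := hx.1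
    obtain ⟨τ, m, hm⟩ := exists_isMsg he hk
    refine (hI.before s x m z (isMsg_of_del he hm hx.2) hx.2 hzd).mono fun f hf => ?_
    refine ⟨?_, preE_of_before he hf⟩
    by_contra hfC
    obtain ⟨k, hk, -⟩ := hf
    exact hxF ⟨f, hfC, k, _, hk⟩

end

/-- An operation without response is blocked at its wait statement. -/
theorem waiting_of_no_response
    (he : ∀ τ, (Config.configAt (algo n M) ev τ).Enabled Channels.fifo (ev τ)) {i : Fin n} {p : ℕ}
    (hp : ∀ q, p < q → ¬ historyOf (algo n M) ev q (HistEvent.res i ())) {τ : ℕ} {m : M}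
    (hi : ¬ (Config.configAt (algo n M) ev τ).crashed i)
    (hm : (Config.configAt (algo n M) ev τ).hist[p]? = some (HistEvent.inv i m)) :
    (stAt ev τ i).waiting := by
  induction τ with
  | zero => simp [Config.configAt, Config.initial] at hm
  | succ τ ih =>
    have hi' : ¬ (Config.configAt (algo n M) ev τ).crashed i := fun h =>
      hi (Config.crashed_mono (A := algo n M) ev τ.le_succ h)
    have ih := ih hi'
    obtain ⟨evs, h1, hs⟩ := step_at he τ
    have hcut : ∀ tr cut, ev τ = Event.step i tr cut → cut = none := by
      intro tr cut hev
      cases cut with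
      | none => rfl
      | some k =>
        refine absurd ?_ hi
        rw [Config.configAt, hev]
        exact Or.inr ⟨rfl, rfl⟩
    have hlt : ∀ e', evs = [e'] → e' ≠ HistEvent.inv i m → (stAt ev τ i).waiting := by
      rintro e' rfl he'
      rw [h1] at hm
      rcases getElem?_concat_eq hm with hm | ⟨-, hm⟩
      · exact ih hm
      · exact absurd hm he'
    have hnil : evs = [] → (stAt ev τ i).waiting := by
      rintro rfl
      rw [h1, List.append_nil] at hm
      exact ih hm
    generalize hst : stAt ev (τ + 1) = st' at hs ⊢
    generalize hL : logAt ev (τ + 1) = L' at hs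
    generalize hg : gotAt ev (τ + 1) = got' at hs
    generalize hev : ev τ = e at hs hcut
    have hfwd : ∀ j w, (Function.update (fwdState (stAt ev τ) j w) j
        (delivered (fwdState (stAt ev τ) j w j)) i).waiting = (stAt ev τ i).waiting := by
      intro j w
      by_cases hj : i = j
      · subst hj; simp [delivered, fwdState_waiting]
      · simp [hj, fwdState_waiting]
    cases hs with
    | idle => exact hnil rfl
    | invoke j m' cut hw =>
      by_cases hj : i = j
      · subst hj; simp [invState, addQuad]
      · simpa [invState, hj] using hlt _ rfl (by simp [Ne.symm hj])
    | silent j src cut w hw hc => rw [hfwd]; exact hnil rfl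
    | deliver j src cut w hw hc => rw [hfwd]; exact hlt _ rfl (by simp)
    | respond j cut evs hw ho hc =>
      by_cases hj : i = j
      · subst hj
        obtain rfl := hcut _ _ rfl
        simp only [ne_eq, not_true_eq_false, false_and, or_false] at hc
        subst hc
        have hlen : p < (Config.configAt (algo n M) ev τ).hist.length := by
          rw [h1] at hm
          rcases getElem?_concat_eq hm with hm | ⟨-, hm⟩
          · exact (List.getElem?_eq_some_iff.1 hm).1
          · simp at hm
        refine absurd ⟨τ + 1, ?_⟩ (hp _ hlen)
        rw [h1]
        exact List.getElem?_concat_length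
      · have : (stAt ev τ i).waiting := by
          rcases hc with rfl | ⟨-, rfl⟩
          · exact hlt _ rfl (by simp)
          · exact hnil rfl
        simpa [hj] using this
    | pass j cut hw => exact hnil rfl

/-- While the operation is blocked the process broadcasts no new message, so it has finitely many
messages, all eventually delivered; the next internal step then passes the wait statement. -/
theorem exists_response (hr : IsRun Channels.fifo t (algo n M) ev) (ht : 2 * t < n)
    {i : Fin n} (hi : i ∈ correctSet (algo n M) ev) {p : ℕ} {m : M}
    (hm : historyOf (algo n M) ev p (HistEvent.inv i m)) :
    ∃ q, p < q ∧ historyOf (algo n M) ev q (HistEvent.res i ()) := by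
  by_contra hcon
  have hp : ∀ q, p < q → ¬ historyOf (algo n M) ev q (HistEvent.res i ()) :=
    fun q hq h => hcon ⟨q, hq, h⟩
  have he := hr.enabled
  obtain ⟨τ₀, hm⟩ := hm
  have hpos : ∀ τ, τ₀ ≤ τ → (Config.configAt (algo n M) ev τ).hist[p]? =
      some (HistEvent.inv i m) := fun τ hτ =>
    getElem?_of_prefix (Config.hist_prefix (A := algo n M) ev hτ) hm
  have hwait : ∀ τ, τ₀ ≤ τ → (stAt ev τ i).waiting := fun τ hτ =>
    waiting_of_no_response he hp (hi τ) (hpos τ hτ)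
  -- A new message of `i` would require that `i` is not waiting.
  have hmsg : ∀ τ, τ₀ ≤ τ → ∀ a m', IsMsg (logAt ev τ) (i, a) m' →
      IsMsg (logAt ev τ₀) (i, a) m' := by
    intro τ hτ
    induction hτ with
    | refl => exact fun a m' => id
    | @step τ hτ ih =>
      intro a m' ha
      obtain ⟨evs, h1, hs⟩ := step_at he τ
      rcases hs.isMsg (inv_at he τ) ha with ha | ⟨-, -, hw⟩
      · exact ih a m' ha
      · exact absurd (hwait τ hτ) hw
  obtain ⟨τ₁, hτ₁⟩ : ∃ τ₁, ∀ a m', IsMsg (logAt ev τ₀) (i, a) m' → Del (stAt ev τ₁) i (i, a) := by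
    have h1 : ∀ a, ∃ τ, ∀ m', IsMsg (logAt ev τ₀) (i, a) m' → Del (stAt ev τ) i (i, a) := by
      intro a
      by_cases ha : ∃ m', IsMsg (logAt ev τ₀) (i, a) m'
      · obtain ⟨m', ha⟩ := ha
        obtain ⟨τ, h⟩ := del_of_star hr (maj_correct hr ht) ⟨i, hi, a, τ₀, ha.at⟩ hi
        exact ⟨τ, fun _ _ => h⟩
      · exact ⟨0, fun m' h => absurd ⟨m', h⟩ ha⟩
    choose T hT using h1
    obtain ⟨B, hB⟩ := ((Set.finite_Iio (logAt ev τ₀ i).length).image T).bddAbove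
    exact ⟨B, fun a m' ha => del_mono he (hB (Set.mem_image_of_mem T ha.at.lt)) (hT a m' ha)⟩
  obtain ⟨τ, hτ, hev⟩ := hr.progress i hi (max τ₀ τ₁)
  have h0 : τ₀ ≤ τ := (le_max_left _ _).trans hτ
  have h1 : τ₁ ≤ τ := (le_max_right _ _).trans hτ
  obtain ⟨evs, hh, hs⟩ := step_at he τ
  generalize hst : stAt ev (τ + 1) = st' at hs
  generalize hL : logAt ev (τ + 1) = L' at hs
  generalize hg : gotAt ev (τ + 1) = got' at hs
  rw [hev] at hs
  cases hs with
  | respond j cut evs hw ho hc =>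
    simp only [ne_eq, not_true_eq_false, false_and, or_false] at hc
    subst hc
    refine hp _ (List.getElem?_eq_some_iff.1 (hpos τ h0)).1 ⟨τ + 1, ?_⟩
    rw [hh]
    exact List.getElem?_concat_length
  | pass j cut hw =>
    -- An own message in the buffer would be undelivered, but by now all of them have been
    -- delivered.
    refine hw ⟨hwait τ h0, ?_⟩
    rintro ⟨m', sd, sn, cl⟩ hq rfl
    obtain ⟨h2, h3, -⟩ := (inv_at he τ).buf _ _ hq
    exact h2 (del_mono he h1 (hτ₁ sn m' (hmsg τ h0 sn m' h3)))

/-- The algorithm implements SCD-broadcast when the channels are FIFO and less than half of the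
processes may crash. -/
theorem implementsSCD_algorithm (ht : 2 * t < n) :
    ImplementsSCD Channels.fifo t (algorithm n M) := by
  rw [algorithm_eq]
  intro ev hr hD
  have he := hr.enabled
  have hC := maj_correct hr ht
  have hH := fun τ => histInv_at he hD τ
  have htwo : ∀ {p p' e e'}, historyOf (algo n M) ev p e → historyOf (algo n M) ev p' e' →
      ∃ τ, (Config.configAt (algo n M) ev τ).hist[p]? = some e ∧
        (Config.configAt (algo n M) ev τ).hist[p']? = some e' := by
    rintro p p' e e' ⟨τ, h⟩ ⟨τ', h'⟩
    exact ⟨max τ τ', getElem?_of_prefix (Config.hist_prefix (A := algo n M) ev (le_max_left _ _)) h,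
      getElem?_of_prefix (Config.hist_prefix (A := algo n M) ev (le_max_right _ _)) h'⟩
  have hdeliver : ∀ x m τ, IsMsg (logAt ev τ) x m → Star ev (correctSet (algo n M) ev) x →
      ∀ j ∈ correctSet (algo n M) ev, ∃ q ms,
        historyOf (algo n M) ev q (HistEvent.ind j ms) ∧ m ∈ ms := by
    intro x m τ hx hs j hj
    obtain ⟨τ', hd⟩ := del_of_star hr hC hs hj
    obtain ⟨q, ms, h1, h2⟩ := exists_ind_of_del he (hj τ') (isMsg_of_del he hx hd) hd
    exact ⟨q, ms, ⟨τ', h1⟩, h2⟩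
  constructor
  case nonempty =>
    rintro q i ms ⟨τ, h⟩
    exact ((hH τ).ind q i ms h).1
  case validity =>
    rintro q i ms ⟨τ, h⟩ m hm
    obtain ⟨-, p, hp, j, hj⟩ := ((hH τ).ind q i ms h).2 m hm
    exact ⟨p, hp, j, τ, hj⟩
  case integrity =>
    intro i q q' ms ms' hq hq' m hm hm'
    obtain ⟨τ, h, h'⟩ := htwo hq hq'
    exact (hH τ).once q q' i ms ms' h h' m hm hm'
  case ms_ordering =>
    rintro i a a' msi msi' ha ha' haa m hm m' hm' ⟨j, b, b', msj, msj', hb', hb, hbb, hmj', hmj⟩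
    obtain ⟨τ, h1, h2⟩ := htwo ha ha'
    obtain ⟨τ', h3, h4⟩ := htwo hb hb'
    obtain ⟨⟨x, hx, -⟩, -⟩ := ((hH τ).ind _ _ _ h1).2 m hm
    obtain ⟨⟨x', hx', -⟩, -⟩ := ((hH τ).ind _ _ _ h2).2 m' hm'
    obtain ⟨⟨z, hz, -⟩, -⟩ := ((hH τ').ind _ _ _ h3).2 m hmj
    obtain ⟨⟨z', hz', -⟩, -⟩ := ((hH τ').ind _ _ _ h4).2 m' hmj'
    have hl := logLE_at he (le_max_left τ τ')
    have hl' := logLE_at he (le_max_right τ τ')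
    obtain rfl := (hH (max τ τ')).uniq _ _ _ (hl.isMsg hx) (hl'.isMsg hz)
    obtain rfl := (hH (max τ τ')).uniq _ _ _ (hl.isMsg hx') (hl'.isMsg hz')
    exact (hl.maj ((hH τ).order a a' i _ _ h1 h2 haa m hm m' hm' _ _ hx hx')).not_before
      (hl'.maj ((hH τ').order b' b j _ _ h4 h3 hbb m' hmj' m hmj _ _ hz' hz))
  case termination1 =>
    intro i hi p m hm
    refine ⟨?_, ?_⟩
    · classical
      have hex := exists_response hr ht hi hm
      refine ⟨Nat.find hex, (Nat.find_spec hex).1, (Nat.find_spec hex).2, ?_⟩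
      rintro k ⟨⟩ hpk hkq hk
      exact Nat.find_min hex hkq ⟨hpk, hk⟩
    · obtain ⟨τ, hm⟩ := hm
      obtain ⟨a, ha⟩ := (hH τ).mem_msg i m (List.mem_of_getElem? hm)
      exact hdeliver (i, a) m τ ha ⟨i, hi, a, τ, ha.at⟩ i hi
  case termination2 =>
    rintro i hi q ms ⟨τ, h⟩ m hm j hj
    obtain ⟨⟨x, hx, hd⟩, -⟩ := ((hH τ).ind q i ms h).2 m hm
    obtain ⟨k, hk⟩ := (inv_at he τ).del_log i x m hx hd
    exact hdeliver x m τ hx ⟨i, hi, k, τ, hk⟩ j hj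

end SCD

/-! ## Correctness of the FIFO layer -/

namespace Fifo

variable {n : ℕ} {In : Type w} {Resp : Type x} {Ind : Type y}

/-- The algorithm `A` over a FIFO layer, as a reducible definition. -/
abbrev lay (A : Algorithm.{v} n In Resp Ind) : Algorithm.{v} n In Resp Ind where
  State := LayerState A
  Msg := ℕ × A.Msg
  start := fun i =>
    { inner := A.start i, nextOut := fun _ => 0, nextIn := fun _ => 0,
      pool := fun _ _ => none, turn := 0 }
  onInvoke := fun i a s => run s (A.onInvoke i a s.inner)
  onReceive := fun _ src msg s =>
    ({ s with pool := Function.update s.pool src (Function.update (s.pool src) msg.1 (some msg.2)) },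
      [])
  onInternal := fun i s =>
    if hj : s.turn % (n + 1) < n then
      match s.pool ⟨s.turn % (n + 1), hj⟩ (s.nextIn ⟨s.turn % (n + 1), hj⟩) with
      | some m =>
          run
            { s with
              turn := s.turn + 1
              nextIn := Function.update s.nextIn ⟨s.turn % (n + 1), hj⟩
                (s.nextIn ⟨s.turn % (n + 1), hj⟩ + 1) }
            (A.onReceive i ⟨s.turn % (n + 1), hj⟩ m s.inner)
      | none => ({ s with turn := s.turn + 1 }, [])
    else run { s with turn := s.turn + 1 } (A.onInternal i s.inner)

theorem layer_eq (A : Algorithm.{v} n In Resp Ind) : layer A = lay A := rfl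

section number

variable {Msg : Type v}

/-- The number given to an action depends only on the actions before it, so a crash in the middle of
a numbered reaction corresponds to a crash at the same point of the original one. -/
theorem number_take (c : Fin n → ℕ) (l : List (Instr n Msg Resp Ind)) (k : ℕ) :
    (number c l).2.take k = (number c (l.take k)).2 := by
  induction l generalizing c k with
  | nil => simp [number]
  | cons a l ih =>
    cases k with
    | zero => simp [number]
    | succ k => cases a <;> simp [number, ih]

theorem number_fst (c : Fin n → ℕ) (l : List (Instr n Msg Resp Ind)) (j : Fin n) :
    (number c l).1 j = c j + (l.filterMap (Instr.sendTo j)).length := by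
  induction l generalizing c with
  | nil => simp [number]
  | cons a l ih =>
    cases a with
    | send d m =>
      by_cases hd : d = j
      · subst hd; simp [number, ih, Instr.sendTo]; omega
      · simp [number, ih, Instr.sendTo, hd, Ne.symm hd]
    | respond r => simp [number, ih, List.filterMap_cons, Instr.sendTo]
    | indicate d => simp [number, ih, List.filterMap_cons, Instr.sendTo]

theorem number_sends (c : Fin n → ℕ) (l : List (Instr n Msg Resp Ind)) (j : Fin n) :
    (number c l).2.filterMap (Instr.sendTo j) =
      (l.filterMap (Instr.sendTo j)).mapIdx fun k m => (k + c j, m) := by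
  induction l generalizing c with
  | nil => simp [number]
  | cons a l ih =>
    cases a with
    | send d m =>
      by_cases hd : d = j
      · subst hd
        simp [number, ih, Instr.sendTo, ← add_assoc, add_right_comm]
      · simp [number, ih, Instr.sendTo, hd, Ne.symm hd]
    | respond r => simp [number, ih, List.filterMap_cons, Instr.sendTo]
    | indicate d => simp [number, ih, List.filterMap_cons, Instr.sendTo]

theorem number_visible (c : Fin n → ℕ) (l : List (Instr n Msg Resp Ind)) (i : Fin n) :
    (number c l).2.filterMap (Instr.visible In i) = l.filterMap (Instr.visible In i) := by
  induction l generalizing c with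
  | nil => simp [number]
  | cons a l ih => cases a <;> simp [number, ih, List.filterMap_cons, Instr.visible]

theorem respond_mem_number (c : Fin n → ℕ) (l : List (Instr n Msg Resp Ind)) (r : Resp) :
    Instr.respond r ∈ (number c l).2 ↔ Instr.respond r ∈ l := by
  induction l generalizing c with
  | nil => simp [number]
  | cons a l ih => cases a <;> simp [number, ih]

end number

/-! ### Simulation of the algorithm over FIFO channels -/

variable {A : Algorithm.{v} n In Resp Ind}

/-- The simulation relation between a configuration of the layered algorithm and one of the
algorithm itself. -/
structure Sim (c : Config (lay A)) (d : Config A) : Prop where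
  crashed : ∀ i, c.crashed i ↔ d.crashed i
  pending : ∀ i, c.pending i ↔ d.pending i
  hist : c.hist = d.hist
  sent : ∀ i j, c.sent i j = (d.sent i j).mapIdx fun k m => (k, m)
  -- Local states are compared only before a crash: a crash step may leave unrelated states, which
  -- nothing reads any more.
  inner : ∀ i, ¬ c.crashed i → (c.state i).inner = d.state i
  nextOut : ∀ i j, ¬ c.crashed i → (c.state i).nextOut j = (d.sent i j).length
  nextIn : ∀ i j, ¬ c.crashed j → d.rcvd i j = Finset.range ((c.state j).nextIn i)
  -- The pool may run ahead of `nextIn`. It holds only authentic messages, each stored at its true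
  -- position in the channel.
  pool : ∀ i j k m, ¬ c.crashed j → (c.state j).pool i k = some m → (d.sent i j)[k]? = some m
  rcvd : ∀ i j k, ¬ c.crashed j → k ∈ c.rcvd i j → ∃ m, (c.state j).pool i k = some m

variable {c : Config (lay A)} {d : Config A}

theorem sim_initial : Sim (Config.initial (lay A)) (Config.initial A) := by
  constructor <;> simp [Config.initial]

theorem performed_run {i : Fin n} {tr tr' : Trigger n In} {cut : Option ℕ} {s : LayerState A}
    {a : A.State × List (Instr n A.Msg Resp Ind)}
    (hr : c.reaction i tr = run s a) (hr' : d.reaction i tr' = a) :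
    c.performed i tr cut = (number s.nextOut (d.performed i tr' cut)).2 := by
  cases cut with
  | none => simp [Config.performed, hr, hr', run]
  | some k => simp [Config.performed, hr, hr', run, number_take]

/-- A reaction of the algorithm, executed by the layer. -/
theorem Sim.run (h : Sim c d) {i : Fin n} (hi : ¬ c.crashed i) {tr tr' : Trigger n In}
    {cut : Option ℕ} {s : LayerState A} {a : A.State × List (Instr n A.Msg Resp Ind)}
    (hr : c.reaction i tr = Fifo.run s a) (hr' : d.reaction i tr' = a)
    (hout : s.nextOut = (c.state i).nextOut) (hpool : s.pool = (c.state i).pool)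
    (hinv : ∀ o, tr = Trigger.invoke o ↔ tr' = Trigger.invoke o)
    (hc : ∀ a b, (c.after (Event.step i tr cut)).rcvd a b = c.rcvd a b)
    (hd : ∀ a b, (d.after (Event.step i tr' cut)).rcvd a b =
      if b = i then (if a ∈ {a | s.nextIn a ≠ (c.state i).nextIn a} then
        insert ((c.state i).nextIn a) (d.rcvd a b) else d.rcvd a b) else d.rcvd a b)
    (hin : ∀ a, s.nextIn a ≠ (c.state i).nextIn a → s.nextIn a = (c.state i).nextIn a + 1) :
    Sim (c.after (Event.step i tr cut)) (d.after (Event.step i tr' cut)) := by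
  have hperf := performed_run (cut := cut) hr hr'
  have hst : ∀ j, (c.after (Event.step i tr cut)).state j =
      if j = i then (Fifo.run s a).1 else c.state j := by
    intro j
    by_cases hj : j = i
    · subst hj; simp [Config.after, hr]
    · simp [Config.after, hj]
  have hnc : ∀ j, ¬ (c.after (Event.step i tr cut)).crashed j → ¬ c.crashed j :=
    fun j hj h' => hj (Or.inl h')
  have hsent : ∀ a b, d.sent a b <+: (d.after (Event.step i tr' cut)).sent a b :=
    fun a b => d.sent_prefix_after _ a b
  constructor
  case crashed => simp [Config.after, h.crashed]
  case pending =>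
    intro j
    by_cases hj : j = i
    · subst hj
      simp [Config.after, hperf, respond_mem_number, h.pending, hinv]
    · simp [Config.after, hj, h.pending]
  case hist =>
    simp only [Config.after, hperf, number_visible, h.hist]
    congr 2
    cases tr with
    | invoke o => rw [(hinv o).1 rfl]
    | receive src k => cases tr' with
      | invoke o => exact absurd ((hinv o).2 rfl) (by simp)
      | receive src k => rfl
      | internal => rfl
    | internal => cases tr' with
      | invoke o => exact absurd ((hinv o).2 rfl) (by simp)
      | receive src k => rfl
      | internal => rfl
  case sent =>
    intro a b
    by_cases ha : a = i
    · subst ha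
      simp only [Config.after, if_true, hperf, number_sends, h.sent, List.mapIdx_append]
      rw [hout, h.nextOut _ _ hi]
    · simp [Config.after, ha, h.sent]
  case inner =>
    intro j hj
    rw [hst]
    by_cases hji : j = i
    · subst hji
      simp [Config.after, Fifo.run, hr']
    · simp [Config.after, hji, h.inner j (hnc j hj)]
  case nextOut =>
    intro j b hj
    rw [hst]
    by_cases hji : j = i
    · subst hji
      have hcut : cut = none := by
        cases cut with
        | none => rfl
        | some k => exact absurd (Or.inr ⟨rfl, rfl⟩) hj
      subst hcut
      simp [Config.after, Fifo.run, Config.performed, number_fst, hr', hout, h.nextOut _ _ hi]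
    · simp [Config.after, hji, h.nextOut j b (hnc j hj)]
  case nextIn =>
    intro a b hb
    rw [hst, hd, h.nextIn a b (hnc b hb)]
    by_cases hbi : b = i
    · subst hbi
      by_cases hne : s.nextIn a = (c.state b).nextIn a
      · simp [hne, Fifo.run]
      · simp [Fifo.run, hin a hne, Finset.range_add_one]
    · simp [hbi]
  case pool =>
    intro a b k m hb hp
    refine SCD.getElem?_of_prefix (hsent a b) (h.pool a b k m (hnc b hb) ?_)
    rw [hst] at hp
    by_cases hbi : b = i
    · subst hbi
      simpa [Fifo.run, hpool] using hp
    · simpa [hbi] using hp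
  case rcvd =>
    intro a b k hb hk
    rw [hc] at hk
    obtain ⟨m, hm⟩ := h.rcvd a b k (hnc b hb) hk
    refine ⟨m, ?_⟩
    rw [hst]
    by_cases hbi : b = i
    · subst hbi
      simpa [Fifo.run, hpool] using hm
    · simpa [hbi] using hm

/-- The event of the algorithm that corresponds to a silent step of the layer. -/
def stutter (i : Fin n) : Option ℕ → Event n In
  | none => Event.idle
  | some _ => Event.step i Trigger.internal (some 0)

/-- Storing a message or passing a fruitless turn affects only the pool and the turn counter, so the
upper algorithm does not move. If the process crashes in such a step, the upper one crashes in an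
internal step cut before its first action. -/
theorem Sim.stutter (h : Sim c d) {i : Fin n} {tr : Trigger n In}
    {cut : Option ℕ} {s : LayerState A} (hr : c.reaction i tr = (s, []))
    (hinner : s.inner = (c.state i).inner)
    (hout : s.nextOut = (c.state i).nextOut) (hin : s.nextIn = (c.state i).nextIn)
    (hinv : ∀ o, tr ≠ Trigger.invoke o)
    (hpool : ∀ a k m, s.pool a k = some m →
      (c.state i).pool a k = some m ∨ (d.sent a i)[k]? = some m)
    (hrcvd : ∀ a b k, k ∈ (c.after (Event.step i tr cut)).rcvd a b →
      if b = i then (k ∈ c.rcvd a b → ∃ m, (c.state i).pool a k = some m) →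
        ∃ m, s.pool a k = some m else k ∈ c.rcvd a b) :
    Sim (c.after (Event.step i tr cut)) (d.after (Fifo.stutter i cut)) := by
  have hperf : c.performed i tr cut = [] := by
    have := c.performed_prefix i tr cut
    rw [hr] at this
    exact List.prefix_nil.1 this
  have hst : ∀ j, (c.after (Event.step i tr cut)).state j = if j = i then s else c.state j := by
    intro j
    by_cases hj : j = i
    · subst hj; simp [Config.after, hr]
    · simp [Config.after, hj]
  have hnc : ∀ j, ¬ (c.after (Event.step i tr cut)).crashed j → ¬ c.crashed j :=
    fun j hj h' => hj (Or.inl h')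
  have hdst : ∀ j, ¬ (c.after (Event.step i tr cut)).crashed j →
      (d.after (Fifo.stutter i cut)).state j = d.state j := by
    intro j hj
    cases cut with
    | none => rfl
    | some k =>
      have : j ≠ i := by
        rintro rfl
        exact hj (Or.inr ⟨rfl, rfl⟩)
      simp [Fifo.stutter, Config.after, this]
  have hdsent : (d.after (Fifo.stutter i cut)).sent = d.sent := by
    cases cut with
    | none => rfl
    | some k =>
      funext a b
      simp [Fifo.stutter, Config.after, Config.performed]
  have hdrcvd : (d.after (Fifo.stutter i cut)).rcvd = d.rcvd := by
    cases cut <;> rfl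
  constructor
  case crashed => intro j; cases cut <;> simp [Config.after, h.crashed, Fifo.stutter]
  case pending =>
    intro j
    by_cases hj : j = i
    · subst hj
      simp only [Config.after, hperf, h.pending, hinv]
      cases cut <;> simp [Fifo.stutter, Config.performed]
    · cases cut <;> simp [Config.after, hj, h.pending, Fifo.stutter]
  case hist =>
    have h1 : (d.after (Fifo.stutter i cut)).hist = d.hist := by
      cases cut <;> simp [Fifo.stutter, Config.after, Config.performed]
    rw [h1, ← h.hist]
    cases tr with
    | invoke o => exact absurd rfl (hinv o)
    | receive src k => simp [Config.after, hperf]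
    | internal => simp [Config.after, hperf]
  case sent =>
    intro a b
    rw [hdsent, ← h.sent]
    simp [Config.after, hperf]
  case inner =>
    intro j hj
    rw [hst, hdst j hj, ← h.inner j (hnc j hj)]
    by_cases hji : j = i
    · subst hji; simp [hinner]
    · simp [hji]
  case nextOut =>
    intro j b hj
    rw [hst, hdsent, ← h.nextOut j b (hnc j hj)]
    by_cases hji : j = i
    · subst hji; simp [hout]
    · simp [hji]
  case nextIn =>
    intro a b hb
    rw [hst, hdrcvd, h.nextIn a b (hnc b hb)]
    by_cases hbi : b = i
    · subst hbi; simp [hin]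
    · simp [hbi]
  case pool =>
    intro a b k m hb hp
    rw [hst] at hp
    rw [hdsent]
    by_cases hbi : b = i
    · subst hbi
      rw [if_pos rfl] at hp
      exact (hpool a k m hp).elim (h.pool a b k m (hnc b hb)) id
    · rw [if_neg hbi] at hp
      exact h.pool a b k m (hnc b hb) hp
  case rcvd =>
    intro a b k hb hk
    have h1 := hrcvd a b k hk
    rw [hst]
    by_cases hbi : b = i
    · subst hbi
      rw [if_pos rfl] at h1 ⊢
      exact h1 fun h2 => h.rcvd a b k (hnc b hb) h2
    · rw [if_neg hbi] at h1 ⊢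
      exact h.rcvd a b k (hnc b hb) h1

/-- The event of the algorithm that corresponds to an event of the layered algorithm. -/
def innerEvent (c : Config (lay A)) : Event n In → Event n In
  | Event.idle => Event.idle
  | Event.step i (Trigger.invoke a) cut => Event.step i (Trigger.invoke a) cut
  | Event.step i (Trigger.receive _ _) cut => stutter i cut
  | Event.step i Trigger.internal cut =>
      if hj : (c.state i).turn % (n + 1) < n then
        match (c.state i).pool ⟨_, hj⟩ ((c.state i).nextIn ⟨_, hj⟩) with
        | some _ => Event.step i (Trigger.receive ⟨_, hj⟩ ((c.state i).nextIn ⟨_, hj⟩)) cut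
        | none => stutter i cut
      else Event.step i Trigger.internal cut

theorem enabled_stutter {ch : Channels} {i : Fin n} (hi : ¬ d.crashed i) (cut : Option ℕ) :
    d.Enabled ch (Fifo.stutter i cut) := by
  cases cut with
  | none => trivial
  | some k => exact ⟨hi, trivial⟩

theorem Sim.after (h : Sim c d) {ch : Channels} {e : Event n In} (he : c.Enabled ch e) :
    d.Enabled Channels.fifo (innerEvent c e) ∧ Sim (c.after e) (d.after (innerEvent c e)) := by
  cases e with
  | idle => exact ⟨trivial, h⟩
  | step i tr cut =>
    have hi : ¬ c.crashed i := he.1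
    have hi' : ¬ d.crashed i := by rwa [← h.crashed]
    cases tr with
    | invoke o =>
      refine ⟨⟨hi', ?_⟩, ?_⟩
      · have := he.2
        rwa [h.pending] at this
      · refine h.run (s := c.state i) hi rfl ?_ rfl rfl (fun _ => Iff.rfl) (fun _ _ => rfl) ?_ ?_
        · simp [Config.reaction, h.inner i hi]
        · simp [Config.after]
        · simp
    | receive src k =>
      refine ⟨enabled_stutter hi' cut, ?_⟩
      obtain ⟨-, hk, -, -⟩ := he
      have hk' : k < (d.sent src i).length := by simpa [h.sent] using hk
      have hr : c.reaction i (Trigger.receive src k) =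
          ({ c.state i with
            pool := Function.update (c.state i).pool src
              (Function.update ((c.state i).pool src) k (some (d.sent src i)[k])) }, []) := by
        simp only [Config.reaction, h.sent, List.getElem?_mapIdx, List.getElem?_eq_getElem hk',
          Option.map_some]
      refine h.stutter hr rfl rfl rfl (by simp) ?_ ?_
      · intro a k' m hm
        by_cases ha : a = src
        · subst ha
          by_cases hkk : k' = k
          · subst hkk
            exact Or.inr (by simpa [List.getElem?_eq_getElem hk'] using hm)
          · exact Or.inl (by simpa [hkk] using hm)
        · exact Or.inl (by simpa [ha] using hm)
      · intro a b k' hk1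
        simp only [Config.after] at hk1
        split
        · rename_i hb
          subst hb
          intro h1
          by_cases ha : a = src
          · subst ha
            by_cases hkk : k' = k
            · subst hkk; simp
            · simp [hkk] at hk1
              simpa [hkk] using h1 hk1
          · simp [ha] at hk1
            simpa [ha] using h1 hk1
        · rename_i hb
          simpa [hb] using hk1
    | internal =>
      by_cases hj : (c.state i).turn % (n + 1) < n
      · cases hp : (c.state i).pool ⟨_, hj⟩ ((c.state i).nextIn ⟨_, hj⟩) with
        | none =>
          have hev : innerEvent c (Event.step i Trigger.internal cut) = Fifo.stutter i cut := by
            simp only [innerEvent, dif_pos hj, hp]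
          rw [hev]
          refine ⟨enabled_stutter hi' cut, ?_⟩
          have hr : c.reaction i Trigger.internal =
              ({ c.state i with turn := (c.state i).turn + 1 }, []) := by
            simp only [Config.reaction, dif_pos hj, hp]
          refine h.stutter hr rfl rfl rfl (by simp) (fun _ _ _ => Or.inl) ?_
          intro a b k hk
          split
          · rename_i hb
            subst hb
            exact fun h1 => h1 hk
          · exact hk
        | some m =>
          have hev : innerEvent c (Event.step i Trigger.internal cut) =
              Event.step i (Trigger.receive ⟨_, hj⟩ ((c.state i).nextIn ⟨_, hj⟩)) cut := by
            simp only [innerEvent, dif_pos hj, hp]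
          rw [hev]
          have hm := h.pool _ _ _ _ hi hp
          have hR := h.nextIn ⟨_, hj⟩ i hi
          -- FIFO enabledness is automatic: what the upper algorithm has received is exactly the
          -- range below `nextIn`, and the layer hands over number `nextIn`.
          refine ⟨⟨hi', (List.getElem?_eq_some_iff.1 hm).1, by simp [hR], fun _ k' hk' => ?_⟩, ?_⟩
          · rw [hR]; exact Finset.mem_range.2 hk'
          have hr : c.reaction i Trigger.internal = Fifo.run
              { c.state i with
                turn := (c.state i).turn + 1
                nextIn := Function.update (c.state i).nextIn ⟨_, hj⟩
                  ((c.state i).nextIn ⟨_, hj⟩ + 1) }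
              (A.onReceive i ⟨_, hj⟩ m (c.state i).inner) := by
            simp only [Config.reaction, dif_pos hj, hp]
          refine h.run hi hr ?_ rfl rfl (by simp) (fun _ _ => rfl) ?_ ?_
          · simp only [Config.reaction, hm, h.inner i hi]
          · intro a b
            by_cases hb : b = i
            · subst hb
              by_cases ha : a = ⟨_, hj⟩
              · subst ha; simp [Config.after]
              · simp [Config.after, ha]
            · simp [Config.after, hb]
          · intro a ha
            by_cases ha' : a = ⟨_, hj⟩
            · subst ha'; simp
            · simp [ha'] at ha
      · have hev : innerEvent c (Event.step i Trigger.internal cut) =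
            Event.step i Trigger.internal cut := by
          simp only [innerEvent, dif_neg hj]
        rw [hev]
        refine ⟨⟨hi', trivial⟩, ?_⟩
        have hr : c.reaction i Trigger.internal = Fifo.run
            { c.state i with turn := (c.state i).turn + 1 } (A.onInternal i (c.state i).inner) := by
          simp only [Config.reaction, dif_neg hj]
        refine h.run hi hr ?_ rfl rfl (fun _ => Iff.rfl) (fun _ _ => rfl) ?_ ?_
        · simp [Config.reaction, h.inner i hi]
        · simp [Config.after]
        · simp

/-! ### Fairness of the simulated run -/

variable {ev : ℕ → Event n In} {ch : Channels} {t : ℕ}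

/-- The run of the algorithm that corresponds to a run of the layered algorithm. -/
def innerRun (A : Algorithm.{v} n In Resp Ind) (ev : ℕ → Event n In) (τ : ℕ) : Event n In :=
  innerEvent (Config.configAt (lay A) ev τ) (ev τ)

theorem sim_at (he : ∀ τ, (Config.configAt (lay A) ev τ).Enabled ch (ev τ)) (τ : ℕ) :
    Sim (Config.configAt (lay A) ev τ) (Config.configAt A (innerRun A ev) τ) := by
  induction τ with
  | zero => exact sim_initial
  | succ τ ih => exact (ih.after (he τ)).2

theorem correctSet_innerRun (he : ∀ τ, (Config.configAt (lay A) ev τ).Enabled ch (ev τ)) :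
    correctSet A (innerRun A ev) = correctSet (lay A) ev := by
  ext i
  simp only [correctSet, (sim_at he _).crashed]

theorem historyOf_innerRun (he : ∀ τ, (Config.configAt (lay A) ev τ).Enabled ch (ev τ)) :
    historyOf A (innerRun A ev) = historyOf (lay A) ev := by
  funext p e
  simp only [historyOf, (sim_at he _).hist]

theorem turn_succ {i : Fin n} (hi : i ∈ correctSet (lay A) ev) (τ : ℕ) :
    ((Config.configAt (lay A) ev (τ + 1)).state i).turn =
      ((Config.configAt (lay A) ev τ).state i).turn ∧ ev τ ≠ Event.step i Trigger.internal none ∨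
    ((Config.configAt (lay A) ev (τ + 1)).state i).turn =
      ((Config.configAt (lay A) ev τ).state i).turn + 1 ∧
        ev τ = Event.step i Trigger.internal none := by
  have h1 := hi (τ + 1)
  rw [Config.configAt] at h1 ⊢
  generalize Config.configAt (lay A) ev τ = c at h1 ⊢
  cases hev : ev τ with
  | idle => exact Or.inl ⟨rfl, by simp⟩
  | step j tr cut =>
    rw [hev] at h1
    by_cases hj : i = j
    · subst hj
      have hcut : cut = none := by
        cases cut with
        | none => rfl
        | some k => exact absurd (Or.inr ⟨rfl, rfl⟩) h1
      subst hcut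
      cases tr with
      | invoke o => exact Or.inl ⟨by simp [Config.after, Config.reaction, Fifo.run], by simp⟩
      | receive src k =>
        refine Or.inl ⟨?_, by simp⟩
        simp only [Config.after, Config.reaction, Function.update_self]
        cases (c.sent src i)[k]? <;> rfl
      | internal =>
        refine Or.inr ⟨?_, rfl⟩
        simp only [Config.after, Config.reaction, Function.update_self]
        split
        · split <;> rfl
        · rfl
    · exact Or.inl ⟨by simp [Config.after, hj], by simp [Ne.symm hj]⟩

/-- On a non-faulty process the turn counter grows by one at each uncut internal step and never
otherwise, and such steps recur forever; so it takes every value, and every residue comes up again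
and again. -/
theorem exists_turn (hr : IsRun ch t (lay A) ev) {i : Fin n} (hi : i ∈ correctSet (lay A) ev)
    (τ r : ℕ) (hrn : r < n + 1) : ∃ τ' ≥ τ, ev τ' = Event.step i Trigger.internal none ∧
      ((Config.configAt (lay A) ev τ').state i).turn % (n + 1) = r := by
  set T : ℕ → ℕ := fun τ => ((Config.configAt (lay A) ev τ).state i).turn with hT
  have hmono : Monotone T := monotone_nat_of_le_succ fun τ => by
    rcases turn_succ hi τ with h | h
    · exact h.1.ge
    · exact (Nat.le_succ _).trans h.1.ge
  have hunb : ∀ N, ∃ τ, N ≤ T τ := by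
    intro N
    induction N with
    | zero => exact ⟨0, Nat.zero_le _⟩
    | succ N ih =>
      obtain ⟨τ₁, h1⟩ := ih
      obtain ⟨τ₂, h2, h3⟩ := hr.progress i hi τ₁
      refine ⟨τ₂ + 1, ?_⟩
      rcases turn_succ hi τ₂ with h | h
      · exact absurd h3 h.2
      · have : T (τ₂ + 1) = T τ₂ + 1 := h.1
        have := hmono h2
        omega
  -- A value with residue `r` that is not below the current counter; the step sought is the one that
  -- moves the counter beyond it.
  have hN : T τ ≤ (n + 1) * T τ + r := by nlinarith
  set N := (n + 1) * T τ + r with hNdef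
  have hex := hunb (N + 1)
  classical
  obtain ⟨σ, hσ⟩ : ∃ σ, Nat.find hex = σ + 1 := by
    refine Nat.exists_eq_succ_of_ne_zero fun h0 => ?_
    have h1 := Nat.find_spec hex
    rw [h0] at h1
    have := hmono (Nat.zero_le τ)
    omega
  have h1 : N + 1 ≤ T (σ + 1) := hσ ▸ Nat.find_spec hex
  have h2 : ¬ N + 1 ≤ T σ := Nat.find_min hex (by omega)
  have h3 : τ ≤ σ := by
    by_contra hlt
    have : T (σ + 1) ≤ T τ := hmono (by omega)
    omega
  rcases turn_succ hi σ with h | h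
  · have : T (σ + 1) = T σ := h.1
    omega
  · have h4 : T (σ + 1) = T σ + 1 := h.1
    refine ⟨σ, h3, h.2, ?_⟩
    have h5 : T σ = N := by omega
    rw [show ((Config.configAt (lay A) ev σ).state i).turn = N from h5, hNdef,
      Nat.mul_add_mod, Nat.mod_eq_of_lt hrn]

theorem isRun_innerRun (hr : IsRun ch t (lay A) ev) :
    IsRun Channels.fifo t A (innerRun A ev) where
  enabled τ := ((sim_at hr.enabled τ).after (hr.enabled τ)).1
  crashes := by
    rw [correctSet_innerRun hr.enabled]
    exact hr.crashes
  progress := by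
    rw [correctSet_innerRun hr.enabled]
    intro i hi τ
    -- Residue `n` is the turn at which the layer executes an internal step of the upper algorithm.
    obtain ⟨τ', h1, h2, h3⟩ := exists_turn hr hi τ n (by omega)
    refine ⟨τ', h1, ?_⟩
    simp [innerRun, innerEvent, h2, h3]
  reliable := by
    rw [correctSet_innerRun hr.enabled]
    intro i j hj τ k
    have hS := fun τ => sim_at hr.enabled τ
    induction k using Nat.strong_induction_on with
    | _ k ih =>
    intro hk
    -- By induction all earlier messages of the channel are handed over at some time, so `nextIn`
    -- reaches at least `k`.
    obtain ⟨τ₀, hτ₀⟩ : ∃ τ₀, ∀ k' < k, k' ∈ (Config.configAt A (innerRun A ev) τ₀).rcvd i j := by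
      cases k with
      | zero => exact ⟨0, by simp⟩
      | succ k =>
        obtain ⟨τ₀, h⟩ := ih k k.lt_succ_self (by omega)
        refine ⟨τ₀, fun k' hk' => ?_⟩
        rw [(hS τ₀).nextIn i j (hj τ₀), Finset.mem_range] at h ⊢
        omega
    have hk' : k < ((Config.configAt (lay A) ev τ).sent i j).length := by
      rwa [(hS τ).sent, List.length_mapIdx]
    obtain ⟨τ₁, hτ₁⟩ := hr.reliable i j hj τ k hk'
    -- At the next turn of sender `i` after message `k` has entered the pool, either it has been
    -- handed over before or it is handed over now.
    obtain ⟨σ, hσ, hev, hturn⟩ := exists_turn hr hj (max τ₀ τ₁) i (by omega)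
    have h0 : τ₀ ≤ σ := (le_max_left _ _).trans hσ
    have h1 : τ₁ ≤ σ := (le_max_right _ _).trans hσ
    have hN := (hS σ).nextIn i j (hj σ)
    by_cases hlt : k < ((Config.configAt (lay A) ev σ).state j).nextIn i
    · exact ⟨σ, by rw [hN]; exact Finset.mem_range.2 hlt⟩
    · have hkN : ((Config.configAt (lay A) ev σ).state j).nextIn i = k := by
        rcases Nat.lt_or_ge (((Config.configAt (lay A) ev σ).state j).nextIn i) k with hlt' | hge
        · have := Config.rcvd_mono (A := A) (innerRun A ev) h0 i j (hτ₀ _ hlt')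
          rw [hN] at this
          simp at this
        · omega
      obtain ⟨m, hm⟩ := (hS σ).rcvd i j k (hj σ)
        (Config.rcvd_mono (A := lay A) ev h1 i j hτ₁)
      refine ⟨σ + 1, ?_⟩
      have hjn : ((Config.configAt (lay A) ev σ).state j).turn % (n + 1) < n := by omega
      have hfin : (⟨((Config.configAt (lay A) ev σ).state j).turn % (n + 1), hjn⟩ : Fin n) = i :=
        Fin.ext hturn
      have hev' : innerRun A ev σ = Event.step j (Trigger.receive i k) none := by
        simp only [innerRun, innerEvent, hev, dif_pos hjn, hfin, hkN, hm]
      rw [Config.configAt, hev']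
      simp [Config.after]

/-- Over unordered channels, the FIFO layer makes up for FIFO channels. -/
theorem implementsSCD_layer {M : Type u} {A : Algorithm.{v} n M Unit (Set M)}
    (hA : ImplementsSCD Channels.fifo t A) : ImplementsSCD ch t (layer A) := by
  rw [layer_eq]
  intro ev hr hD
  rw [← historyOf_innerRun hr.enabled] at hD ⊢
  rw [← correctSet_innerRun hr.enabled]
  exact hA _ (isRun_innerRun hr) hD

end Fifo

/-! ## Impossibility without a majority of non-faulty processes -/

section

variable {n : ℕ} {In : Type w} {Resp : Type x} {Ind : Type y} {A : Algorithm.{v} n In Resp Ind}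

/-- The process of a visible event. -/
def HistEvent.proc : HistEvent n In Resp Ind → Fin n
  | inv i _ => i
  | res i _ => i
  | ind i _ => i

/-- Events that neither are crashes nor invoke operations. -/
def Benign : Event n In → Prop
  | Event.idle => True
  | Event.step _ tr cut => cut = none ∧ ∀ a, tr ≠ Trigger.invoke a

/-! ### Reachable configurations and their fair extensions -/

/-- The configurations that can be reached over FIFO channels. -/
inductive Reachable (A : Algorithm.{v} n In Resp Ind) : Config A → Prop
  | initial : Reachable A (Config.initial A)
  | after {c : Config A} (e : Event n In) : Reachable A c → c.Enabled Channels.fifo e →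
      Reachable A (c.after e)

/-- FIFO schedules are admissible over either kind of channels, so constructing FIFO runs settles
both impossibility results at once. -/
theorem Config.Enabled.of_fifo {c : Config A} {e : Event n In} (h : c.Enabled Channels.fifo e)
    (ch : Channels) : c.Enabled ch e := by
  cases e with
  | idle => trivial
  | step i tr cut =>
    refine ⟨h.1, ?_⟩
    cases tr with
    | invoke a => exact h.2
    | receive src k => exact ⟨h.2.1, h.2.2.1, fun _ => h.2.2.2 rfl⟩
    | internal => trivial

theorem Reachable.rcvd {c : Config A} (h : Reachable A c) (a b : Fin n) :
    c.rcvd a b = Finset.range (c.rcvd a b).card ∧ (c.rcvd a b).card ≤ (c.sent a b).length := by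
  induction h with
  | initial => simp [Config.initial]
  | @after c e _ he ih =>
    have hlen := (c.sent_prefix_after e a b).length_le
    have hsame : (c.after e).rcvd a b = c.rcvd a b →
        (c.after e).rcvd a b = Finset.range ((c.after e).rcvd a b).card ∧
          ((c.after e).rcvd a b).card ≤ ((c.after e).sent a b).length := by
      intro h
      rw [h]
      exact ⟨ih.1, ih.2.trans hlen⟩
    cases e with
    | idle => exact hsame rfl
    | step i tr cut =>
      cases tr with
      | invoke o => exact hsame rfl
      | internal => exact hsame rfl
      | receive src k =>
        by_cases hab : a = src ∧ b = i
        · obtain ⟨rfl, rfl⟩ := hab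
          obtain ⟨-, h1, h2, h3⟩ := he
          have hk : k = (c.rcvd a b).card := by
            rcases lt_trichotomy k (c.rcvd a b).card with hk | hk | hk
            · rw [ih.1] at h2
              exact absurd (Finset.mem_range.2 hk) h2
            · exact hk
            · have := h3 rfl _ hk
              rw [ih.1] at this
              simp at this
          have hr : (c.after (Event.step b (Trigger.receive a k) cut)).rcvd a b =
              Finset.range (k + 1) := by
            simp only [Config.after, and_self, if_true]
            rw [Finset.range_add_one, hk, ← ih.1]
          rw [hr, Finset.card_range]
          exact ⟨rfl, h1.trans_le hlen⟩
        · exact hsame (by simp [Config.after, hab])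

/-- The tasks of the scheduler: an internal step of a process, or a reception. Every task comes up
infinitely often. -/
def task (n τ : ℕ) : Option (Fin n × Option (Fin n)) := Encodable.decode τ.unpair.1

theorem exists_task (k : Fin n × Option (Fin n)) (τ : ℕ) : ∃ τ' ≥ τ, task n τ' = some k :=
  -- The second component of the pair is ignored by `task` and serves to make the time large.
  ⟨Nat.pair (Encodable.encode k) τ, Nat.right_le_pair _ _, by simp [task]⟩

open Classical in
/-- A fair scheduler. -/
noncomputable def fairEvent (c : Config A) : Option (Fin n × Option (Fin n)) → Event n In
  | none => Event.idle
  | some (i, none) => if c.crashed i then Event.idle else Event.step i Trigger.internal none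
  | some (i, some src) =>
      if c.crashed i ∨ (c.sent src i).length ≤ (c.rcvd src i).card then Event.idle
      else Event.step i (Trigger.receive src (c.rcvd src i).card) none

theorem benign_fairEvent (c : Config A) (k : Option (Fin n × Option (Fin n))) :
    Benign (fairEvent c k) := by
  unfold fairEvent
  split
  · trivial
  · split
    · trivial
    · exact ⟨rfl, by simp⟩
  · split
    · trivial
    · exact ⟨rfl, by simp⟩

theorem Reachable.enabled_fairEvent {c : Config A} (h : Reachable A c)
    (k : Option (Fin n × Option (Fin n))) : c.Enabled Channels.fifo (fairEvent c k) := by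
  unfold fairEvent
  split
  · trivial
  · split
    · trivial
    · rename_i hc
      exact ⟨hc, trivial⟩
  · rename_i i src
    split
    · trivial
    · rename_i hc
      push Not at hc
      refine ⟨hc.1, hc.2, ?_, fun _ k' hk' => ?_⟩
      · rw [(h.rcvd src i).1]; simp
      · rw [(h.rcvd src i).1]; exact Finset.mem_range.2 hk'

theorem Benign.crashed {c : Config A} {e : Event n In} (he : Benign e) (i : Fin n) :
    (c.after e).crashed i ↔ c.crashed i := by
  cases e with
  | idle => rfl
  | step j tr cut =>
    obtain ⟨rfl, -⟩ := he
    simp [Config.after]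

theorem visible_ne_inv (i j : Fin n) (a : In) {Msg : Type v} (l : List (Instr n Msg Resp Ind)) :
    HistEvent.inv j a ∉ l.filterMap (Instr.visible In i) := by
  intro h
  obtain ⟨b, -, hb⟩ := List.mem_filterMap.1 h
  cases b <;> simp [Instr.visible] at hb

theorem Benign.hist {c : Config A} {e : Event n In} (he : Benign e) {p : ℕ} {j : Fin n} {a : In}
    (h : (c.after e).hist[p]? = some (HistEvent.inv j a)) :
    c.hist[p]? = some (HistEvent.inv j a) := by
  cases e with
  | idle => exact h
  | step i tr cut =>
    obtain ⟨rfl, htr⟩ := he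
    by_cases hp : p < c.hist.length
    · have := c.hist_prefix_after (Event.step i tr none)
      rw [List.getElem?_eq_getElem hp]
      rw [SCD.getElem?_of_prefix this (List.getElem?_eq_getElem hp)] at h
      exact h
    · exfalso
      simp only [Config.after, List.append_assoc] at h
      rw [List.getElem?_append_right (by omega)] at h
      have h := List.mem_of_getElem? h
      cases tr with
      | invoke o => exact htr o rfl
      | receive src k => exact visible_ne_inv _ _ _ _ (by simpa using h)
      | internal => exact visible_ne_inv _ _ _ _ (by simpa using h)

theorem Config.configAt_congr {ev ev' : ℕ → Event n In} {T : ℕ} (h : ∀ τ < T, ev τ = ev' τ) :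
    configAt A ev T = configAt A ev' T := by
  induction T with
  | zero => rfl
  | succ T ih =>
    rw [configAt, configAt, ih fun τ hτ => h τ (by omega), h T (by omega)]

theorem Reachable.exists_events {c : Config A} (h : Reachable A c) :
    ∃ ev T, Config.configAt A ev T = c ∧
      ∀ τ < T, (Config.configAt A ev τ).Enabled Channels.fifo (ev τ) := by
  induction h with
  | initial => exact ⟨fun _ => Event.idle, 0, rfl, by simp⟩
  | @after c e _ he ih =>
    obtain ⟨ev, T, h1, h2⟩ := ih
    have hcong : ∀ τ ≤ T, Config.configAt A (Function.update ev T e) τ =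
        Config.configAt A ev τ := fun τ hτ =>
      Config.configAt_congr fun σ hσ => by simp [show σ ≠ T by omega]
    refine ⟨Function.update ev T e, T + 1, ?_, ?_⟩
    · rw [Config.configAt, hcong T le_rfl, h1]
      simp
    · intro τ hτ
      rw [hcong τ (by omega)]
      by_cases hτT : τ = T
      · subst hτT; simpa [h1] using he
      · simpa [hτT] using h2 τ (by omega)

/-- Configurations under the fair scheduler, started at time `T`. -/
noncomputable def fairConfig (A : Algorithm.{v} n In Resp Ind) (ev : ℕ → Event n In) (T : ℕ) :
    ℕ → Config A
  | 0 => Config.initial A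
  | τ + 1 => (fairConfig A ev T τ).after
      (if τ < T then ev τ else fairEvent (fairConfig A ev T τ) (task n τ))

/-- Every reachable configuration is part of a fair run without further crashes and
invocations. -/
theorem Reachable.extend {c : Config A} (h : Reachable A c) {t : ℕ}
    (ht : {i | c.crashed i}.ncard ≤ t) (ch : Channels) :
    ∃ ev T, Config.configAt A ev T = c ∧ IsRun ch t A ev ∧
      (∀ τ, (Config.configAt A ev τ).Enabled Channels.fifo (ev τ)) ∧
      correctSet A ev = {i | ¬ c.crashed i} ∧ (∀ τ ≥ T, Benign (ev τ)) ∧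
      ∀ p j a, historyOf A ev p (HistEvent.inv j a) → c.hist[p]? = some (HistEvent.inv j a) := by
  obtain ⟨ev₀, T, h1, h2⟩ := h.exists_events
  set ev : ℕ → Event n In := fun τ =>
    if τ < T then ev₀ τ else fairEvent (fairConfig A ev₀ T τ) (task n τ) with hev
  -- The scheduler reads the configuration produced by its own choices; `fairConfig` resolves this
  -- recursion, and here it is identified with the configurations of the resulting run.
  have hconf : ∀ τ, Config.configAt A ev τ = fairConfig A ev₀ T τ := by
    intro τ
    induction τ with
    | zero => rfl
    | succ τ ih => rw [Config.configAt, fairConfig, ih]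
  have hpre : ∀ τ ≤ T, Config.configAt A ev τ = Config.configAt A ev₀ τ := fun τ hτ =>
    Config.configAt_congr fun σ hσ => by simp [hev, show σ < T by omega]
  have hT : Config.configAt A ev T = c := by rw [hpre T le_rfl, h1]
  have hfair : ∀ τ ≥ T, ev τ = fairEvent (Config.configAt A ev τ) (task n τ) := by
    intro τ hτ
    rw [hconf]
    simp [hev, show ¬ τ < T by omega]
  have hreach : ∀ τ, Reachable A (Config.configAt A ev τ) ∧
      (Config.configAt A ev τ).Enabled Channels.fifo (ev τ) := by
    have hen : ∀ τ, Reachable A (Config.configAt A ev τ) →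
        (Config.configAt A ev τ).Enabled Channels.fifo (ev τ) := by
      intro τ hr
      by_cases hτ : τ < T
      · have := h2 τ hτ
        rw [← hpre τ hτ.le] at this
        rwa [show ev τ = ev₀ τ by simp [hev, hτ]]
      · rw [hfair τ (by omega)]
        exact hr.enabled_fairEvent _
    intro τ
    induction τ with
    | zero => exact ⟨Reachable.initial, hen 0 Reachable.initial⟩
    | succ τ ih =>
      have := Reachable.after _ ih.1 ih.2
      exact ⟨this, hen _ this⟩
  have hben : ∀ τ ≥ T, Benign (ev τ) := by
    intro τ hτ
    rw [hfair τ hτ]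
    exact benign_fairEvent _ _
  have hcr : ∀ τ ≥ T, ∀ i, (Config.configAt A ev τ).crashed i ↔ c.crashed i := by
    intro τ hτ i
    induction hτ with
    | refl => rw [hT]
    | @step τ hτ ih => rw [← ih, Config.configAt, (hben τ hτ).crashed]
  have hcorr : correctSet A ev = {i | ¬ c.crashed i} := by
    ext i
    constructor
    · intro hi hc
      exact hi T ((hcr T le_rfl i).2 hc)
    · intro hi τ hc
      exact hi ((hcr (max τ T) (le_max_right _ _) i).1
        (Config.crashed_mono (A := A) ev (le_max_left _ _) hc))
  refine ⟨ev, T, hT, ⟨fun τ => (hreach τ).2.of_fifo ch, ?_, ?_, ?_⟩, fun τ => (hreach τ).2, hcorr,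
    hben, ?_⟩
  · rw [hcorr]
    convert ht using 2
    ext i
    simp
  · intro i hi τ
    obtain ⟨τ', hτ', htask⟩ := exists_task (i, none) (max τ T)
    refine ⟨τ', (le_max_left _ _).trans hτ', ?_⟩
    rw [hfair τ' ((le_max_right _ _).trans hτ'), htask]
    simp [fairEvent, hi τ']
  · intro i j hj τ k hk
    -- Each visit of the task `(j, some i)` receives the next message of the channel if one is
    -- outstanding; after enough visits position `k` is covered.
    have key : ∀ m ≤ k + 1, ∃ τ' ≥ max τ T, m ≤ ((Config.configAt A ev τ').rcvd i j).card := by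
      intro m
      induction m with
      | zero => exact fun _ => ⟨max τ T, le_rfl, Nat.zero_le _⟩
      | succ m ih =>
        intro hm
        obtain ⟨τ₁, h3, h4⟩ := ih (by omega)
        obtain ⟨τ₂, h5, htask⟩ := exists_task (j, some i) τ₁
        have h6 := Finset.card_le_card (Config.rcvd_mono (A := A) ev h5 i j)
        by_cases h7 : m + 1 ≤ ((Config.configAt A ev τ₂).rcvd i j).card
        · exact ⟨τ₂, h3.trans h5, h7⟩
        · refine ⟨τ₂ + 1, (h3.trans h5).trans τ₂.le_succ, ?_⟩
          have h8 : ((Config.configAt A ev τ₂).rcvd i j).card = m := by omega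
          have h9 : m < ((Config.configAt A ev τ₂).sent i j).length := by
            have := (Config.sent_prefix (A := A) ev
              ((le_max_left τ T).trans (h3.trans h5)) i j).length_le
            omega
          have hevt : ev τ₂ = Event.step j (Trigger.receive i m) none := by
            rw [hfair τ₂ ((le_max_right _ _).trans (h3.trans h5)), htask]
            simp [fairEvent, hj τ₂, h8, h9]
          have h10 := ((hreach τ₂).1.rcvd i j).1
          rw [h8] at h10
          rw [Config.configAt, hevt]
          simp [Config.after, h10]
    obtain ⟨τ', -, h3⟩ := key (k + 1) le_rfl
    refine ⟨τ', ?_⟩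
    rw [((hreach τ').1.rcvd i j).1]
    exact Finset.mem_range.2 h3
  · rintro p j a ⟨τ, hp⟩
    have hmax := SCD.getElem?_of_prefix (Config.hist_prefix (A := A) ev (le_max_left τ T)) hp
    have hall : ∀ σ ≥ T, (Config.configAt A ev σ).hist[p]? = some (HistEvent.inv j a) →
        c.hist[p]? = some (HistEvent.inv j a) := by
      intro σ hσ
      induction hσ with
      | refl => rw [hT]; exact id
      | @step σ hσ ih =>
        intro h3
        exact ih ((hben σ hσ).hist h3)
    exact hall _ (le_max_right _ _) hmax

/-! ### Solo runs of a group and their replay -/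

/-- The processes of `S` have not taken any step. -/
structure Fresh (S : Set (Fin n)) (c : Config A) : Prop where
  state : ∀ i ∈ S, c.state i = A.start i
  sent : ∀ i ∈ S, ∀ j, c.sent i j = []
  rcvd : ∀ i ∈ S, ∀ j, c.rcvd j i = ∅
  pending : ∀ i ∈ S, ¬ c.pending i
  crashed : ∀ i ∈ S, ¬ c.crashed i

theorem fresh_initial (S : Set (Fin n)) : Fresh S (Config.initial A) := by
  constructor <;> simp [Config.initial]

/-- The processes outside `S` crash initially. -/
theorem exists_crashed (A : Algorithm.{v} n In Resp Ind) (S : Set (Fin n)) :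
    ∃ c, Reachable A c ∧ Fresh S c ∧ (∀ i, c.crashed i ↔ i ∉ S) ∧ (∀ i j, c.sent i j = []) ∧
      c.hist = [] := by
  classical
  have h : ∀ Q : Finset (Fin n), ∃ c, Reachable A c ∧ Fresh {i | i ∉ Q} c ∧
      (∀ i, c.crashed i ↔ i ∈ Q) ∧ (∀ i j, c.sent i j = []) ∧ c.hist = [] := by
    intro Q
    induction Q using Finset.induction_on with
    | empty =>
      exact ⟨_, Reachable.initial, fresh_initial _, by simp [Config.initial],
        by simp [Config.initial], rfl⟩
    | insert q Q hq ih =>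
      obtain ⟨c, h1, h2, h3, h4, h5⟩ := ih
      -- An internal step cut before its first action sends nothing and shows nothing. It may change
      -- the state of `q`, but `q` leaves the fresh set.
      refine ⟨_, Reachable.after (Event.step q Trigger.internal (some 0)) h1
        ⟨by rwa [h3], trivial⟩, ?_, ?_, ?_, ?_⟩
      · constructor
        · intro i hi
          have hi : i ≠ q ∧ i ∉ Q := by simpa using hi
          simp [Config.after, hi.1, h2.state i hi.2]
        · intro i hi j
          simp [Config.after, Config.performed, h4]
        · intro i hi j
          have hi : i ≠ q ∧ i ∉ Q := by simpa using hi
          exact h2.rcvd i hi.2 j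
        · intro i hi
          have hi : i ≠ q ∧ i ∉ Q := by simpa using hi
          simp [Config.after, hi.1, h2.pending i hi.2]
        · intro i hi
          have hi : i ≠ q ∧ i ∉ Q := by simpa using hi
          simp [Config.after, hi.1, h3, hi.2]
      · intro i
        simp [Config.after, h3, or_comm]
      · intro i j
        simp [Config.after, Config.performed, h4]
      · simp [Config.after, Config.performed, h5]
  obtain ⟨c, h1, h2, h3, h4, h5⟩ := h Sᶜ.toFinset
  exact ⟨c, h1, by simpa using h2, by simpa using h3, h4, h5⟩

/-- The configuration `c'` results from `b` when the processes of `S` do what they do in `c`, where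
all other processes are initially crashed. -/
structure Replay (S : Set (Fin n)) (b c c' : Config A) : Prop where
  state : ∀ i ∈ S, c'.state i = c.state i
  sent : ∀ i ∈ S, ∀ j, c'.sent i j = c.sent i j
  rcvd : ∀ i ∈ S, ∀ j, c'.rcvd j i = c.rcvd j i
  pending : ∀ i ∈ S, (c'.pending i ↔ c.pending i)
  not_crashed : ∀ i ∈ S, ¬ c'.crashed i
  hist : c'.hist = b.hist ++ c.hist
  crashed : ∀ i, i ∉ S → c.crashed i
  silent : ∀ i, i ∉ S → ∀ j, c.sent i j = []
  proc : ∀ e ∈ c.hist, e.proc ∈ S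
  frame_state : ∀ i, i ∉ S → c'.state i = b.state i
  frame_sent : ∀ i, i ∉ S → ∀ j, c'.sent i j = b.sent i j
  frame_rcvd : ∀ i, i ∉ S → ∀ j, c'.rcvd j i = b.rcvd j i
  frame_pending : ∀ i, i ∉ S → (c'.pending i ↔ b.pending i)
  frame_crashed : ∀ i, c'.crashed i ↔ b.crashed i

theorem visible_proc (i : Fin n) {Msg : Type v} (l : List (Instr n Msg Resp Ind)) :
    ∀ e ∈ l.filterMap (Instr.visible In i), e.proc = i := by
  intro e he
  obtain ⟨b, -, hb⟩ := List.mem_filterMap.1 he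
  cases b <;> simp only [Instr.visible, Option.some.injEq, reduceCtorEq] at hb
  · subst hb; rfl
  · subst hb; rfl

/-- In `c` the processes outside `S` are crashed and have sent nothing, so each event concerns a
process of `S` and a reception has its source in `S`. States and channels inside `S` agree in both
configurations, so the same event is possible with the same effect; messages from outside that may
be in transit in `c'` simply stay there. -/
theorem Replay.after {S : Set (Fin n)} {b c c' : Config A} (h : Replay S b c c') {e : Event n In}
    (he : c.Enabled Channels.fifo e) (hcut : ∀ i tr cut, e = Event.step i tr cut → cut = none) :
    c'.Enabled Channels.fifo e ∧ Replay S b (c.after e) (c'.after e) := by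
  cases e with
  | idle => exact ⟨trivial, h⟩
  | step i tr cut =>
    obtain rfl := hcut i tr cut rfl
    have hi : i ∈ S := by
      by_contra hi
      exact he.1 (h.crashed i hi)
    -- A message from outside `S` cannot be received in `c`, as none has been sent.
    have hsrc : ∀ src k, tr = Trigger.receive src k → src ∈ S := by
      rintro src k rfl
      by_contra hs
      have := he.2.1
      rw [h.silent src hs] at this
      simp at this
    have hreact : c'.reaction i tr = c.reaction i tr := by
      cases tr with
      | invoke a => simp [Config.reaction, h.state i hi]
      | internal => simp [Config.reaction, h.state i hi]
      | receive src k =>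
        simp only [Config.reaction, h.state i hi, h.sent src (hsrc src k rfl)]
    have hperf : c'.performed i tr none = c.performed i tr none := by
      simp [Config.performed, hreact]
    refine ⟨⟨h.not_crashed i hi, ?_⟩, ?_⟩
    · have := he.2
      cases tr with
      | invoke a => simpa [h.pending i hi] using this
      | internal => trivial
      | receive src k =>
        have hs := hsrc src k rfl
        simp only [h.sent src hs, h.rcvd i hi]
        exact ⟨this.1, this.2.1, fun _ => this.2.2 rfl⟩
    · have hne : ∀ j, j ∉ S → j ≠ i := by
        rintro j hj rfl
        exact hj hi
      constructor
      case state =>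
        intro j hj
        by_cases hji : j = i
        · subst hji; simp [Config.after, hreact]
        · simp [Config.after, hji, h.state j hj]
      case sent =>
        intro j hj k
        simp [Config.after, hperf, h.sent j hj]
      case rcvd =>
        intro j hj k
        simp only [Config.after, h.rcvd j hj]
      case pending =>
        intro j hj
        by_cases hji : j = i
        · subst hji; simp [Config.after, hperf, h.pending j hj]
        · simp [Config.after, hji, h.pending j hj]
      case not_crashed =>
        intro j hj
        simpa [Config.after] using h.not_crashed j hj
      case hist => simp [Config.after, hperf, h.hist]
      case crashed => exact fun j hj => Or.inl (h.crashed j hj)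
      case silent =>
        intro j hj k
        simp [Config.after, hne j hj, h.silent j hj]
      case proc =>
        intro e he'
        simp only [Config.after, List.mem_append] at he'
        rcases he' with (he' | he') | he'
        · exact h.proc e he'
        · cases tr with
          | invoke a =>
            rw [List.mem_singleton] at he'
            subst he'
            exact hi
          | internal => simp at he'
          | receive src k => simp at he'
        · rw [visible_proc _ _ e he']
          exact hi
      case frame_state =>
        intro j hj
        simp [Config.after, hne j hj, h.frame_state j hj]
      case frame_sent =>
        intro j hj k
        simp [Config.after, hne j hj, h.frame_sent j hj]
      case frame_rcvd =>
        intro j hj k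
        rw [← h.frame_rcvd j hj]
        cases tr <;> simp [Config.after, hne j hj]
      case frame_pending =>
        intro j hj
        simp [Config.after, hne j hj, h.frame_pending j hj]
      case frame_crashed =>
        intro j
        simpa [Config.after] using h.frame_crashed j

/-- The run in which the processes outside `S` crash initially and process `i` invokes one operation.
It can be replayed in every configuration in which the processes of `S` have not taken any step. -/
theorem exists_solo (A : Algorithm.{v} n In Resp Ind) {S : Set (Fin n)} {t : ℕ}
    (ht : Sᶜ.ncard ≤ t) (ch : Channels) {i : Fin n} (hi : i ∈ S) (a : In) :
    ∃ ev, IsRun ch t A ev ∧ correctSet A ev = S ∧ historyOf A ev 0 (HistEvent.inv i a) ∧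
      (∀ p j o, historyOf A ev p (HistEvent.inv j o) → p = 0 ∧ j = i ∧ o = a) ∧
      ∀ τ₀, ∃ τ ≥ τ₀, (∀ e ∈ (Config.configAt A ev τ).hist, e.proc ∈ S) ∧
        ∀ b, Reachable A b → Fresh S b → ∃ c', Reachable A c' ∧
          c'.hist = b.hist ++ (Config.configAt A ev τ).hist ∧
          (∀ S', Disjoint S' S → Fresh S' b → Fresh S' c') ∧
          ∀ j, c'.crashed j ↔ b.crashed j := by
  obtain ⟨c₀, h1, h2, h3, h4, h5⟩ := exists_crashed A S
  have hen : c₀.Enabled Channels.fifo (Event.step i (Trigger.invoke a) none) :=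
    ⟨h2.crashed i hi, h2.pending i hi⟩
  set c₁ := c₀.after (Event.step i (Trigger.invoke a) none) with hc₁
  have hcr : ∀ j, c₁.crashed j ↔ j ∉ S := by
    intro j
    simp [hc₁, Config.after, h3]
  have hhist : c₁.hist = HistEvent.inv i a ::
      (c₀.performed i (Trigger.invoke a) none).filterMap (Instr.visible In i) := by
    simp [hc₁, Config.after, h5]
  have hcard : {j | c₁.crashed j}.ncard ≤ t := by
    rwa [show {j | c₁.crashed j} = Sᶜ from Set.ext hcr]
  obtain ⟨ev, T, hT, hrun, hfifo, hcorr, hben, hinv⟩ :=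
    (Reachable.after _ h1 hen).extend hcard ch
  have hT : Config.configAt A ev T = c₁ := hT
  refine ⟨ev, hrun, ?_, ?_, ?_, fun τ₀ => ⟨max τ₀ T, le_max_left _ _, ?_⟩⟩
  · rw [hcorr]
    exact Set.ext fun j => (not_congr (hcr j)).trans not_not
  · exact ⟨T, by rw [hT, hhist]; rfl⟩
  · intro p j o hp
    have hp := hinv p j o hp
    change c₁.hist[p]? = _ at hp
    rw [hhist] at hp
    cases p with
    | zero =>
      simp only [List.getElem?_cons_zero, Option.some.injEq, HistEvent.inv.injEq] at hp
      exact ⟨rfl, hp.1.symm, hp.2.symm⟩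
    | succ p =>
      rw [List.getElem?_cons_succ] at hp
      exact absurd (List.mem_of_getElem? hp) (visible_ne_inv _ _ _ _)
  -- After time `T`, which lies just after the invocation, all events are benign; so the replay can
  -- be continued for as long as desired.
  · have key : ∀ b, Reachable A b → Fresh S b → ∀ τ ≥ T, ∃ c', Reachable A c' ∧
        Replay S b (Config.configAt A ev τ) c' := by
      intro b hb hS τ hτ
      induction hτ with
      | refl =>
        have h0 : Replay S b c₀ b := by
          constructor
          case state => intro j hj; rw [hS.state j hj, h2.state j hj]
          case sent => intro j hj k; rw [hS.sent j hj, h2.sent j hj]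
          case rcvd => intro j hj k; rw [hS.rcvd j hj, h2.rcvd j hj]
          case pending => intro j hj; simp [hS.pending j hj, h2.pending j hj]
          case not_crashed => exact hS.crashed
          case hist => rw [h5, List.append_nil]
          case crashed => exact fun j hj => (h3 j).2 hj
          case silent => exact fun j _ => h4 j
          case proc => simp [h5]
          case frame_state => exact fun _ _ => rfl
          case frame_sent => exact fun _ _ _ => rfl
          case frame_rcvd => exact fun _ _ _ => rfl
          case frame_pending => exact fun _ _ => Iff.rfl
          case frame_crashed => exact fun _ => Iff.rfl
        obtain ⟨h6, h7⟩ := h0.after hen (by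
          intro j tr cut h
          cases h
          rfl)
        refine ⟨_, Reachable.after _ hb h6, ?_⟩
        rw [hT]
        exact h7
      | @step τ hτ ih =>
        obtain ⟨c', h6, h7⟩ := ih
        obtain ⟨h8, h9⟩ := h7.after (hfifo τ) (by
          intro j tr cut h
          have := hben τ hτ
          rw [h] at this
          exact this.1)
        exact ⟨_, Reachable.after _ h6 h8, h9⟩
    refine ⟨?_, ?_⟩
    · obtain ⟨c', -, h6⟩ := key _ Reachable.initial (fresh_initial S) _ (le_max_right τ₀ T)
      exact h6.proc
    · intro b hb hS
      obtain ⟨c', h6, h7⟩ := key b hb hS _ (le_max_right τ₀ T)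
      refine ⟨c', h6, h7.hist, ?_, h7.frame_crashed⟩
      intro S' hdisj hS'
      have hn : ∀ j ∈ S', j ∉ S := fun j hj hj' => Set.disjoint_left.1 hdisj hj hj'
      constructor
      · intro j hj; rw [h7.frame_state j (hn j hj), hS'.state j hj]
      · intro j hj k; rw [h7.frame_sent j (hn j hj), hS'.sent j hj]
      · intro j hj k; rw [h7.frame_rcvd j (hn j hj), hS'.rcvd j hj]
      · intro j hj; rw [h7.frame_pending j (hn j hj)]; exact hS'.pending j hj
      · intro j hj; rw [h7.frame_crashed j]; exact hS'.crashed j hj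

end

/-! ### Gluing two groups, and the impossibility results -/

/-- The complement of `S` is chosen with exactly `t` elements, containing `j` but not `i`; then `S`
has `n - t ≤ t` elements. -/
theorem exists_partition {n t : ℕ} (h : n ≤ 2 * t) (ht : t < n) {i j : Fin n} (hij : i ≠ j) :
    ∃ S : Set (Fin n), i ∈ S ∧ j ∉ S ∧ S.ncard ≤ t ∧ Sᶜ.ncard ≤ t := by
  have hn : 1 < n := by
    have := i.isLt
    have := j.isLt
    have : (i : ℕ) ≠ j := fun h => hij (Fin.ext h)
    omega
  obtain ⟨Q, hQ, hQ', hcard⟩ := Finset.exists_subsuperset_card_eq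
    (s := {j}) (t := Finset.univ.erase i) (n := t)
    (by simp [hij.symm]) (by simp; omega) (by simp; omega)
  refine ⟨(Q : Set (Fin n))ᶜ, ?_, ?_, ?_, ?_⟩
  · intro hi
    simpa using hQ' hi
  · simpa using hQ
  · rw [Set.ncard_compl, Set.ncard_coe_finset, Nat.card_fin]
    omega
  · rw [compl_compl, Set.ncard_coe_finset]
    omega

/-- Two groups of processes, each of which may be initially crashed in the eyes of the other one, run
one after the other. -/
theorem exists_glued {n t : ℕ} {In : Type w} {Resp : Type x} {Ind : Type y}
    (A : Algorithm.{v} n In Resp Ind) (h : n ≤ 2 * t) (ht : t < n) (ch : Channels) {i j : Fin n}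
    (hij : i ≠ j) (a b : In) :
    ∃ ev₁ ev₂, ∃ S : Set (Fin n), i ∈ S ∧ j ∉ S ∧
      IsRun ch t A ev₁ ∧ correctSet A ev₁ = S ∧ historyOf A ev₁ 0 (HistEvent.inv i a) ∧
      (∀ p k o, historyOf A ev₁ p (HistEvent.inv k o) → p = 0 ∧ k = i ∧ o = a) ∧
      IsRun ch t A ev₂ ∧ correctSet A ev₂ = Sᶜ ∧ historyOf A ev₂ 0 (HistEvent.inv j b) ∧
      (∀ p k o, historyOf A ev₂ p (HistEvent.inv k o) → p = 0 ∧ k = j ∧ o = b) ∧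
      ∀ τ₁ τ₂, ∃ ev, IsRun ch t A ev ∧ correctSet A ev = Set.univ ∧
        ∃ l₁ l₂ : List (HistEvent n In Resp Ind),
          (∃ σ ≥ τ₁, l₁ = (Config.configAt A ev₁ σ).hist) ∧
          (∃ σ ≥ τ₂, l₂ = (Config.configAt A ev₂ σ).hist) ∧ (∀ e ∈ l₁, e.proc ∈ S) ∧
          (∀ p < l₁.length, ∀ e, historyOf A ev p e ↔ l₁[p]? = some e) ∧
          (∀ p < l₂.length, ∀ e, historyOf A ev (l₁.length + p) e ↔ l₂[p]? = some e) ∧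
          ∀ p k o, historyOf A ev p (HistEvent.inv k o) →
            (p = 0 ∧ k = i ∧ o = a) ∨ (p = l₁.length ∧ k = j ∧ o = b) := by
  obtain ⟨S, hi, hj, hS, hS'⟩ := exists_partition h ht hij
  obtain ⟨ev₁, hr₁, hc₁, h0₁, hu₁, hrep₁⟩ := exists_solo A (t := t) hS' ch hi a
  obtain ⟨ev₂, hr₂, hc₂, h0₂, hu₂, hrep₂⟩ :=
    exists_solo A (S := Sᶜ) (t := t) (by rwa [compl_compl]) ch hj b
  refine ⟨ev₁, ev₂, S, hi, hj, hr₁, hc₁, h0₁, hu₁, hr₂, hc₂, h0₂, hu₂, fun τ₁ τ₂ => ?_⟩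
  obtain ⟨σ₁, hσ₁, hp₁, hrep₁⟩ := hrep₁ τ₁
  obtain ⟨σ₂, hσ₂, -, hrep₂⟩ := hrep₂ τ₂
  obtain ⟨c₁, h1, h2, h3, h4⟩ := hrep₁ _ Reachable.initial (fresh_initial S)
  -- The first replay leaves the other group fresh: messages sent to it are still in transit.
  obtain ⟨c₂, h5, h6, -, h7⟩ := hrep₂ c₁ h1 (h3 _ disjoint_compl_left (fresh_initial _))
  have hcr : ∀ k, ¬ c₂.crashed k := by
    intro k
    rw [h7, h4]
    exact id
  -- Nobody has crashed in the glued configuration. The fair extension delivers the delayed messages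
  -- and makes every process non-faulty.
  obtain ⟨ev, T, hT, hrun, -, hcorr, -, hinv⟩ := h5.extend (t := t) (by simp [hcr]) ch
  have h2 : c₁.hist = (Config.configAt A ev₁ σ₁).hist := by
    rw [h2]
    rfl
  rw [h2] at h6
  have hiff : ∀ p < c₂.hist.length, ∀ e, historyOf A ev p e ↔ c₂.hist[p]? = some e := by
    intro p hp e
    rw [← hT] at hp ⊢
    exact ⟨fun h => hist_of_historyOf h hp, historyOf_of_hist⟩
  refine ⟨ev, hrun, by simp [hcorr, hcr], (Config.configAt A ev₁ σ₁).hist,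
    (Config.configAt A ev₂ σ₂).hist, ⟨σ₁, hσ₁, rfl⟩, ⟨σ₂, hσ₂, rfl⟩, hp₁, ?_, ?_, ?_⟩
  · intro p hp e
    rw [hiff p (by rw [h6, List.length_append]; omega), h6, List.getElem?_append_left hp]
  · intro p hp e
    rw [hiff _ (by rw [h6, List.length_append]; omega), h6,
      List.getElem?_append_right (by omega), Nat.add_sub_cancel_left]
  · intro p k o hp
    have hp := hinv p k o hp
    rw [h6] at hp
    by_cases hlt : p < (Config.configAt A ev₁ σ₁).hist.length
    · rw [List.getElem?_append_left hlt] at hp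
      exact Or.inl (hu₁ p k o (historyOf_of_hist hp))
    · rw [List.getElem?_append_right (by omega)] at hp
      obtain ⟨h8, h9⟩ := hu₂ _ k o (historyOf_of_hist hp)
      exact Or.inr ⟨by omega, h9⟩

/-- The group of `i` completes a write of `v₁` alone; the group of `j`, alone, has to read `v₀`.
When the solo runs are glued the read starts after the write has returned, and still returns `v₀`.
-/
theorem not_implementsRegister {n t : ℕ} (h : n ≤ 2 * t) (ht : t < n) (ch : Channels) {V : Type u}
    {v₀ v₁ : V} (hv : v₀ ≠ v₁) {W R : Set (Fin n)} {i j : Fin n} (hi : i ∈ W) (hj : j ∈ R)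
    (hij : i ≠ j) (A : Algorithm.{v} n (RegOp V) (RegResp V) Empty) :
    ¬ ImplementsRegister ch t v₀ W R A := by
  intro hA
  obtain ⟨ev₁, ev₂, S, hiS, hjS, hr₁, hc₁, h0₁, hu₁, hr₂, hc₂, h0₂, hu₂, hglue⟩ :=
    exists_glued A h ht ch hij (RegOp.write v₁) RegOp.read
  have hreg₁ : IsAtomicRegister v₀ (historyOf A ev₁) (correctSet A ev₁) := by
    refine hA ev₁ hr₁ fun p k => ⟨fun hp => ?_, fun o hp => ?_⟩
    · exact absurd (hu₁ p k _ hp).2.2 (by simp)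
    · rw [(hu₁ p k _ hp).2.1]; exact hi
  have hreg₂ : IsAtomicRegister v₀ (historyOf A ev₂) (correctSet A ev₂) := by
    refine hA ev₂ hr₂ fun p k => ⟨fun hp => ?_, fun o hp => ?_⟩
    · rw [(hu₂ p k _ hp).2.1]; exact hj
    · exact absurd (hu₂ p k _ hp).2.2 (by simp)
  obtain ⟨q₁, r₁, hret₁⟩ := hreg₁.liveness i (by rw [hc₁]; exact hiS) 0 _ h0₁
  obtain ⟨q₂, r₂, hret₂⟩ := hreg₂.liveness j (by rw [hc₂]; exact hjS) 0 _ h0₂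
  -- No write is ever invoked in the solo run of the reader, so only the initial value can be
  -- returned.
  have hr₂v : r₂ = RegResp.value v₀ := by
    obtain ⟨ops, rank, -, -, -, -, -, hread⟩ := hreg₂.consistency
    obtain ⟨x, rfl, ⟨s, -, k, hs, -⟩ | ⟨rfl, -⟩⟩ := hread j 0 q₂ r₂ h0₂ hret₂
    · exact absurd (hu₂ s k _ hs).2.2 (by simp)
    · rfl
  subst hr₂v
  obtain ⟨τ₁, hτ₁⟩ := hret₁.2.1
  obtain ⟨τ₂, hτ₂⟩ := hret₂.2.1
  obtain ⟨ev, hr, hc, l₁, l₂, ⟨σ₁, hσ₁, rfl⟩, ⟨σ₂, hσ₂, rfl⟩, -, hl₁, hl₂, hu⟩ := hglue τ₁ τ₂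
  have hq₁ : q₁ < (Config.configAt A ev₁ σ₁).hist.length :=
    (List.getElem?_eq_some_iff.1 hτ₁).1.trans_le (Config.hist_prefix ev₁ hσ₁).length_le
  have hq₂ : q₂ < (Config.configAt A ev₂ σ₂).hist.length :=
    (List.getElem?_eq_some_iff.1 hτ₂).1.trans_le (Config.hist_prefix ev₂ hσ₂).length_le
  set l₁ := (Config.configAt A ev₁ σ₁).hist with hl₁def
  set l₂ := (Config.configAt A ev₂ σ₂).hist with hl₂def
  have ht₁ : ∀ p < l₁.length, ∀ e, historyOf A ev p e ↔ historyOf A ev₁ p e := fun p hp e =>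
    (hl₁ p hp e).trans ⟨historyOf_of_hist, fun h => hist_of_historyOf h hp⟩
  have ht₂ : ∀ p < l₂.length, ∀ e, historyOf A ev (l₁.length + p) e ↔ historyOf A ev₂ p e :=
    fun p hp e => (hl₂ p hp e).trans ⟨historyOf_of_hist, fun h => hist_of_historyOf h hp⟩
  have hreg : IsAtomicRegister v₀ (historyOf A ev) (correctSet A ev) := by
    refine hA ev hr fun p k => ⟨fun hp => ?_, fun o hp => ?_⟩
    · rcases hu p k _ hp with ⟨-, -, h⟩ | ⟨-, rfl, -⟩
      · simp at h
      · exact hj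
    · rcases hu p k _ hp with ⟨-, rfl, -⟩ | ⟨-, -, h⟩
      · exact hi
      · simp at h
  have hw : historyOf A ev 0 (HistEvent.inv i (RegOp.write v₁)) :=
    (ht₁ 0 (by omega) _).2 h0₁
  have hrd : historyOf A ev l₁.length (HistEvent.inv j RegOp.read) :=
    (ht₂ 0 (by omega) _).2 h0₂
  have hretw : Returns (historyOf A ev) i 0 q₁ r₁ := by
    refine ⟨hret₁.1, (ht₁ _ hq₁ _).2 hret₁.2.1, fun k r' hk hkq hres => ?_⟩
    exact hret₁.2.2 k r' hk hkq ((ht₁ k (by omega) _).1 hres)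
  have hretr : Returns (historyOf A ev) j l₁.length (l₁.length + q₂) (RegResp.value v₀) := by
    have := hret₂.1
    refine ⟨by omega, (ht₂ _ hq₂ _).2 hret₂.2.1, fun k r' hk hkq hres => ?_⟩
    obtain ⟨k, rfl⟩ := Nat.exists_eq_add_of_le hk.le
    exact hret₂.2.2 k r' (by omega) (by omega) ((ht₂ k (by omega) _).1 hres)
  obtain ⟨ops, rank, -, hops, -, hrt, -, hread⟩ := hreg.consistency
  have h0 := hops _ _ _ _ _ hw hretw
  have hl := hops _ _ _ _ _ hrd hretr
  have hrank := hrt _ _ _ _ _ hw hretw _ hl hq₁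
  -- The only write of the glued run writes `v₁ ≠ v₀`, so `v₀` is not a written value; nor can it be
  -- the initial one, since that write precedes the read.
  obtain ⟨x, hx, ⟨s, -, k, hs, -⟩ | ⟨-, hno⟩⟩ := hread _ _ _ _ hrd hretr
  · obtain rfl : v₀ = x := by simpa using hx
    rcases hu s k _ hs with ⟨-, -, h⟩ | ⟨-, -, h⟩
    · exact hv (by simpa using h)
    · simp at h
  · exact hno 0 h0 i v₁ hw hrank

/-- Each group, alone, delivers its own message. In the glued run everybody is non-faulty, so each
of `i` and `j` must later deliver the other message as well, and they do so in opposite orders. -/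
theorem not_implementsSCD {n t : ℕ} (h : n ≤ 2 * t) (ht : t < n) (ch : Channels) {M : Type u}
    [Nontrivial M] (A : Algorithm.{v} n M Unit (Set M)) : ¬ ImplementsSCD ch t A := by
  intro hA
  obtain ⟨m, m', hmm⟩ := exists_pair_ne M
  -- The hypotheses `n ≤ 2 * t` and `t < n` exclude `n ≤ 1`, so there are two processes to separate.
  have hn : 1 < n := by omega
  have hij : (⟨0, by omega⟩ : Fin n) ≠ ⟨1, hn⟩ := by simp
  generalize (⟨0, by omega⟩ : Fin n) = i at hij
  generalize (⟨1, hn⟩ : Fin n) = j at hij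
  obtain ⟨ev₁, ev₂, S, hiS, hjS, hr₁, hc₁, h0₁, hu₁, hr₂, hc₂, h0₂, hu₂, hglue⟩ :=
    exists_glued A h ht ch hij m m'
  have hscd₁ : IsSCDBroadcast (historyOf A ev₁) (correctSet A ev₁) := by
    refine hA ev₁ hr₁ fun p p' k k' o hp hp' => ?_
    rw [(hu₁ p k o hp).1, (hu₁ p' k' o hp').1]
  have hscd₂ : IsSCDBroadcast (historyOf A ev₂) (correctSet A ev₂) := by
    refine hA ev₂ hr₂ fun p p' k k' o hp hp' => ?_
    rw [(hu₂ p k o hp).1, (hu₂ p' k' o hp').1]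
  obtain ⟨-, q₁, ms₁, hq₁, hm₁⟩ := hscd₁.termination1 i (by rw [hc₁]; exact hiS) 0 m h0₁
  obtain ⟨-, q₂, ms₂, hq₂, hm₂⟩ := hscd₂.termination1 j (by rw [hc₂]; exact hjS) 0 m' h0₂
  obtain ⟨τ₁, hτ₁⟩ := id hq₁
  obtain ⟨τ₂, hτ₂⟩ := id hq₂
  obtain ⟨ev, hr, hc, l₁, l₂, ⟨σ₁, hσ₁, rfl⟩, ⟨σ₂, hσ₂, rfl⟩, hproc, hl₁, hl₂, hu⟩ := hglue τ₁ τ₂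
  have hlt₁ : q₁ < (Config.configAt A ev₁ σ₁).hist.length :=
    (List.getElem?_eq_some_iff.1 hτ₁).1.trans_le (Config.hist_prefix ev₁ hσ₁).length_le
  have hlt₂ : q₂ < (Config.configAt A ev₂ σ₂).hist.length :=
    (List.getElem?_eq_some_iff.1 hτ₂).1.trans_le (Config.hist_prefix ev₂ hσ₂).length_le
  set l₁ := (Config.configAt A ev₁ σ₁).hist with hl₁def
  set l₂ := (Config.configAt A ev₂ σ₂).hist with hl₂def
  have hscd : IsSCDBroadcast (historyOf A ev) (correctSet A ev) := by
    refine hA ev hr fun p p' k k' o hp hp' => ?_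
    rcases hu p k o hp with ⟨rfl, -, rfl⟩ | ⟨rfl, -, rfl⟩ <;>
    rcases hu p' k' o hp' with ⟨rfl, -, h⟩ | ⟨rfl, -, h⟩
    · rfl
    · exact absurd h hmm
    · exact absurd h.symm hmm
    · rfl
  have hdi : historyOf A ev q₁ (HistEvent.ind i ms₁) :=
    (hl₁ _ hlt₁ _).2 (hist_of_historyOf hq₁ hlt₁)
  have hdj : historyOf A ev (l₁.length + q₂) (HistEvent.ind j ms₂) :=
    (hl₂ _ hlt₂ _).2 (hist_of_historyOf hq₂ hlt₂)
  have hcor : ∀ k, k ∈ correctSet A ev := by simp [hc]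
  obtain ⟨a', msi, ha', hmi⟩ := hscd.termination2 j (hcor j) _ _ hdj m' hm₂ i (hcor i)
  obtain ⟨b, msj, hb, hmj⟩ := hscd.termination2 i (hcor i) _ _ hdi m hm₁ j (hcor j)
  -- Validity: `m'` is broadcast only at position `l₁.length`, after the delivery of `m` by `i`.
  have hlt : q₁ < a' := by
    obtain ⟨p, hp, k, hk⟩ := hscd.validity _ _ _ ha' m' hmi
    rcases hu p k m' hk with ⟨-, -, h⟩ | ⟨rfl, -⟩
    · exact absurd h.symm hmm
    · omega
  -- An earlier delivery of `m` by `j` is impossible: the first part of the history contains no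
  -- event of `j`, and the second part is copied from a run in which `m` is never broadcast.
  have hlt' : l₁.length + q₂ < b := by
    by_contra hle
    by_cases hbl : b < l₁.length
    · exact hjS (hproc _ (List.mem_of_getElem? ((hl₁ b hbl _).1 hb)))
    · obtain ⟨b, rfl⟩ := Nat.exists_eq_add_of_le (not_lt.1 hbl)
      have hb₂ : historyOf A ev₂ b (HistEvent.ind j msj) :=
        historyOf_of_hist ((hl₂ b (by omega) _).1 hb)
      obtain ⟨p, -, k, hk⟩ := hscd₂.validity _ _ _ hb₂ m hmj
      exact hmm (hu₂ p k m hk).2.2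
  exact hscd.ms_ordering i q₁ a' ms₁ msi hdi ha' hlt m hm₁ m' hmi
    ⟨j, b, _, msj, ms₂, hdj, hb, hlt', hm₂, hmj⟩
theorem mainTheorem5 (n t : ℕ) :
    (2 * t < n → ∀ M : Type u,
      ImplementsSCD Channels.fifo t (SCD.algorithm n M) ∧
      ImplementsSCD Channels.unordered t (Fifo.layer (SCD.algorithm n M))) ∧
    (n ≤ 2 * t → t < n → ∀ ch : Channels,
      (∀ (V : Type u) (v₀ v₁ : V), v₀ ≠ v₁ →
        ∀ (W R : Set (Fin n)), (∃ i ∈ W, ∃ j ∈ R, i ≠ j) →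
          ¬ ∃ A : Algorithm.{v} n (RegOp V) (RegResp V) Empty, ImplementsRegister ch t v₀ W R A) ∧
      (∀ M : Type u, Nontrivial M →
          ¬ ∃ A : Algorithm.{v} n M Unit (Set M), ImplementsSCD ch t A)) := by
  refine ⟨fun ht M => ⟨SCD.implementsSCD_algorithm ht,
    Fifo.implementsSCD_layer (SCD.implementsSCD_algorithm ht)⟩, fun h ht ch => ⟨?_, ?_⟩⟩
  · rintro V v₀ v₁ hv W R ⟨i, hi, j, hj, hij⟩ ⟨A, hA⟩
    exact not_implementsRegister h ht ch hv hi hj hij A hA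
  · rintro M _ ⟨A, hA⟩
    exact not_implementsSCD h ht ch A hA
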